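/- Let $N\ge 2$ be an integer, $1<p<N$ and, for $\alpha>0$, let $p_\alpha^*=\frac{p(N+\alpha)}{N-p}$ and $$U_\alpha(x)=\frac{C_{N,p,\alpha}}{\bigl(1+|x|^{\frac{p+\alpha}{p-1}}\bigr)^{\frac{N-p}{p+\alpha}}},\qquad C_{N,p,\alpha}=\Bigl((N+\alpha)\bigl(\tfrac{N-p}{p-1}\bigr)^{p-1}\Bigr)^{\frac{N-p}{p(p+\alpha)}},$$ the radial solution of $-\Delta_p u=|x|^\alpha u^{p_\alpha^*-1}$, $u>0$, in $\mathbb R^N$. Let $m(\alpha)$ be the Morse index of $U_\alpha$, that is, the largest dimension of a linear space of functions $v\in C_c^\infty(\mathbb R^N)$ with $\int_{\mathbb R^N}|\nabla U_\alpha|^{p-2}|\nabla v|^2\,dx<\infty$ on which the quadratic form of the linearized equation at $U_\alpha$, $$Q_\alpha(v)=\int_{\mathbb R^N}|\nabla U_\alpha|^{p-2}|\nabla v|^2+(p-2)|\nabla U_\alpha|^{p-4}(\nabla U_\alpha\cdot\nabla v)^2-(p_\alpha^*-1)|x|^\alpha U_\alpha^{p_\alpha^*-2}v^2\,dx,$$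 is negative definite. Let $\Phi_k(\mathbb R^N)$ be the space of real homogeneous harmonic polynomials of degree $k$ on $\mathbb R^N$. Then, for every $\alpha>0$, $$m(\alpha)=\sum_{k\in\mathbb Z,\ 0\le k<\zeta(\alpha)}\dim\Phi_k(\mathbb R^N),\qquad \zeta(\alpha)=\frac{(2p-Np)+\sqrt{4(p-1)\alpha^2+4p(N+p-2)\alpha+N^2p^2}}{2p},$$ where $\dim\Phi_0(\mathbb R^N)=1$ and $\dim\Phi_k(\mathbb R^N)=\frac{(N+2k-2)(N+k-3)!}{(N-2)!\,k!}$ whenever $(N,k)\ne(2,0)$. In particular, for every integer $k\ge2$ the Morse index changes as $\alpha$ crosses $$\alpha(k)=\frac{p\sqrt{(N+p-2)^2+4(k-1)(p-1)(k+N-1)}-p(N+p-2)}{2(p-1)}>0,$$ namely $m(\alpha)<m(\beta)$ whenever $0<\alpha<\alpha(k)<\beta$; and $m(\alpha)\to+\infty$ as $\alpha\to+\infty$. -/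

import Mathlib

open Filter Topology MeasureTheory
open scoped ContDiff Nat

noncomputable section

namespace Henon

/-- The critical exponent `p_α^* = p (N + α) / (N - p)`. -/
def criticalExponent (N : ℕ) (p α : ℝ) : ℝ := p * (N + α) / (N - p)

/-- The constant `C_{N,p,α} = ((N + α) ((N - p)/(p - 1))^(p - 1))^((N - p)/(p (p + α)))`. -/
def bubbleConst (N : ℕ) (p α : ℝ) : ℝ :=
  ((N + α) * (((N : ℝ) - p) / (p - 1)) ^ (p - 1)) ^ (((N : ℝ) - p) / (p * (p + α)))

/-- The radial solution
`U_α(x) = C_{N,p,α} / (1 + |x|^((p + α)/(p - 1)))^((N - p)/(p + α))`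
of `-Δ_p u = |x|^α u^(p_α^* - 1)`, `u > 0`, in `ℝ^N`. -/
def radialSolution (N : ℕ) (p α : ℝ) (x : EuclideanSpace ℝ (Fin N)) : ℝ :=
  bubbleConst N p α /
    (1 + ‖x‖ ^ ((p + α) / (p - 1))) ^ (((N : ℝ) - p) / (p + α))

/-- The quadratic form of the linearization of `-Δ_p u = |x|^α u^(p_α^* - 1)` at `U = U_α`:
`Q(v) = ∫ |∇U|^(p-2) |∇v|^2 + (p-2) |∇U|^(p-4) (∇U · ∇v)^2 - (p_α^* - 1) |x|^α U^(p_α^* - 2) v^2`.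
It is only used for `v` satisfying `IsAdmissible` below, for which the integrand is integrable. -/
def linearizedForm (N : ℕ) (p α : ℝ) (v : EuclideanSpace ℝ (Fin N) → ℝ) : ℝ :=
  ∫ x, (‖gradient (radialSolution N p α) x‖ ^ (p - 2) * ‖gradient v x‖ ^ 2
    + (p - 2) * ‖gradient (radialSolution N p α) x‖ ^ (p - 4)
        * (inner ℝ (gradient (radialSolution N p α) x) (gradient v x)) ^ 2
    - (criticalExponent N p α - 1) * ‖x‖ ^ α
        * radialSolution N p α x ^ (criticalExponent N p α - 2) * v x ^ 2)

/-- Test functions: `v ∈ C_c^∞(ℝ^N)` with `∫ |∇U_α|^(p-2) |∇v|^2 < ∞`. The last condition is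
automatic for `p ≥ 2`; for `p < 2` the weight is singular at the critical point `0` of `U_α`. -/
structure IsAdmissible (N : ℕ) (p α : ℝ) (v : EuclideanSpace ℝ (Fin N) → ℝ) : Prop where
  contDiff : ContDiff ℝ ∞ v
  hasCompactSupport : HasCompactSupport v
  integrable_energy :
    Integrable fun x => ‖gradient (radialSolution N p α) x‖ ^ (p - 2) * ‖gradient v x‖ ^ 2

/-- `V` is a space of admissible functions on which the quadratic form is negative definite. -/
def IsNegativeSubspace (N : ℕ) (p α : ℝ)
    (V : Submodule ℝ (EuclideanSpace ℝ (Fin N) → ℝ)) : Prop :=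
  ∀ v ∈ V, IsAdmissible N p α v ∧ (v ≠ 0 → linearizedForm N p α v < 0)

/-- The Morse index of `U_α`: the largest dimension (possibly `⊤`) of a finite-dimensional space
of admissible functions on which the quadratic form of the linearized operator is negative
definite. -/
def morseIndex (N : ℕ) (p α : ℝ) : ℕ∞ :=
  ⨆ (V : Submodule ℝ (EuclideanSpace ℝ (Fin N) → ℝ)) (_ : FiniteDimensional ℝ V)
    (_ : IsNegativeSubspace N p α V), (Module.finrank ℝ V : ℕ∞)

/-- The Laplacian on real polynomials in `N` variables. -/
def polyLaplacian (N : ℕ) : MvPolynomial (Fin N) ℝ →ₗ[ℝ] MvPolynomial (Fin N) ℝ :=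
  ∑ i, (MvPolynomial.pderiv i).toLinearMap ∘ₗ (MvPolynomial.pderiv i).toLinearMap

/-- The space `Φ_k(ℝ^N)` of harmonic polynomials on `ℝ^N`, homogeneous of degree `k`. -/
def harmonicPolynomials (N k : ℕ) : Submodule ℝ (MvPolynomial (Fin N) ℝ) :=
  MvPolynomial.homogeneousSubmodule (Fin N) ℝ k ⊓ LinearMap.ker (polyLaplacian N)

/-- The threshold `ζ(α)`. -/
def zeta (N : ℕ) (p α : ℝ) : ℝ :=
  ((2 * p - N * p)
      + √(4 * (p - 1) * α ^ 2 + 4 * p * (N + p - 2) * α + (N : ℝ) ^ 2 * p ^ 2)) / (2 * p)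

/-- The critical values `α(k)`. -/
def alphaCrit (N : ℕ) (p : ℝ) (k : ℕ) : ℝ :=
  (p * √(((N : ℝ) + p - 2) ^ 2 + 4 * ((k : ℝ) - 1) * (p - 1) * (k + N - 1))
      - p * (N + p - 2)) / (2 * (p - 1))

end Henon

end

/-!
The weight `|∇U|^(p-2)` is radial, so in polar coordinates `x = rθ` the linearized form separates:
with `M(r) = r^(N-2) |U'(r)|^(p-2)`, `T = r^β / (1 + r^β)` and `β = (p+α)/(p-1)`, a mode
`f(r) Y(θ)`, where `Y` is a normalized spherical harmonic of degree `k`, contributes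
`∫ (p-1) M r f'² + (M/r) (λ_k - κ T (1-T)) f²` with `λ_k = k (k+N-2)`
(`integrable_sphere_energies`, `linearizedForm_modeSum_le`). Everything depends on the sign of these
one-dimensional energies, and the associated equations have explicit solutions.

* For the angular eigenvalue `λ* = ζ (ζ + N - 2)` (`criticalEigenvalue`, `zeta_mul_eq`) the function
  `r^(β/p) (1 + r^β)^(-B/β)`, with `B = (N+α)/(p-1)`, is a positive solution. By Picone's inequality
  the energy is nonnegative when `λ_k ≥ λ*` (`energy_nonneg_of_riccati`), and a logarithmic cut-off
  of the solution has negative energy when `λ_k < λ*` (`exists_radial_test`).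
* For the eigenvalue `0` the derivative of the scaling `λ^((N-p)/p) U(λx)` at `λ = 1` is a solution,
  with exactly one zero `r₀` on `(0, ∞)`. By Picone's inequality on either side of `r₀` the energy is
  nonnegative on functions vanishing at `r₀` (`energy_nonneg_of_riccati_pole`).

Both inequalities are stated for a solution `ψ = r φ'/φ` of the Riccati equation, and for the sums
`H = ∑ f_a²` and `K = ∑ f_a'²` over a family of modes instead of a single `f`, so that the infinitely
many high modes need not be separated.

For the upper bound, let `k` be the least degree with `λ_k ≥ λ*`. If a test function `v` has vanishing
coefficients of degree `< k` on the sphere of radius `r₀`, then the form is nonnegative at `v`: the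
degrees `< k` are handled by the second solution, since `λ_j ≥ 0`, and the rest by the first
together with the spectral gap `λ_k` of the sphere (`linearizedForm_nonneg`). These are
`∑_{j<k} dim Φ_j` linear conditions, so a negative subspace has at most that dimension. For the lower
bound, the span of `f(|x|) Y(x/|x|)` over the harmonics `Y` of degree `< k`, with `f` from
`exists_radial_test`, is a negative subspace of that dimension (`exists_isNegativeSubspace`).

The theory of spherical harmonics that this uses rests on the Fischer decomposition
`P_{k+2} = Φ_{k+2} ⊕ |x|² P_k` of homogeneous polynomials (`harmonic_sup_range`), which gives the
dimensions and, with the Stone–Weierstrass theorem, completeness; and on Green's formula on the sphere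
(`green_sphere`), deduced from the divergence theorem in `ℝ^N` for a tangential vector field times a
radial cut-off. The statements about `α(k)` follow because `ζ` is increasing and `ζ(α(k)) = k`.
-/

noncomputable section

namespace Henon

/-! ### Harmonic polynomials -/

section HarmonicPolynomials

open MvPolynomial

variable {N : ℕ}

/-- The Fischer (apolar) product `⟨p, q⟩ = ∑ m, m! p_m q_m` of real polynomials, for which
multiplication by `X i` is adjoint to `∂/∂X i`. -/
def fischer (p q : MvPolynomial (Fin N) ℝ) : ℝ :=
  ∑ m ∈ p.support, ((∏ i, (m i)! : ℕ) : ℝ) * coeff m p * coeff m q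

lemma fischer_eq_sum {p : MvPolynomial (Fin N) ℝ} {s : Finset (Fin N →₀ ℕ)} (hs : p.support ⊆ s)
    (q : MvPolynomial (Fin N) ℝ) :
    fischer p q = ∑ m ∈ s, ((∏ i, (m i)! : ℕ) : ℝ) * coeff m p * coeff m q := by
  refine Finset.sum_subset hs fun m _ hm => ?_
  simp [notMem_support_iff.1 hm]

lemma fischer_add_left (p p' q : MvPolynomial (Fin N) ℝ) :
    fischer (p + p') q = fischer p q + fischer p' q := by
  classical
  rw [fischer_eq_sum (s := p.support ∪ p'.support) support_add,
    fischer_eq_sum (p := p) (s := p.support ∪ p'.support) Finset.subset_union_left,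
    fischer_eq_sum (p := p') (s := p.support ∪ p'.support) Finset.subset_union_right,
    ← Finset.sum_add_distrib]
  refine Finset.sum_congr rfl fun m _ => ?_
  rw [coeff_add]; ring

lemma fischer_add_right (p q q' : MvPolynomial (Fin N) ℝ) :
    fischer p (q + q') = fischer p q + fischer p q' := by
  simp only [fischer, coeff_add, mul_add, Finset.sum_add_distrib]

lemma fischer_sum_left {ι : Type*} (s : Finset ι) (f : ι → MvPolynomial (Fin N) ℝ)
    (q : MvPolynomial (Fin N) ℝ) :
    fischer (∑ i ∈ s, f i) q = ∑ i ∈ s, fischer (f i) q :=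
  map_sum (AddMonoidHom.mk' (fun p => fischer p q) fun a b => fischer_add_left a b q) f s

lemma fischer_sum_right {ι : Type*} (s : Finset ι) (f : ι → MvPolynomial (Fin N) ℝ)
    (p : MvPolynomial (Fin N) ℝ) :
    fischer p (∑ i ∈ s, f i) = ∑ i ∈ s, fischer p (f i) :=
  map_sum (AddMonoidHom.mk' (fun q => fischer p q) fun a b => fischer_add_right p a b) f s

lemma fischer_X_mul (i : Fin N) (p q : MvPolynomial (Fin N) ℝ) :
    fischer (X i * p) q = fischer p (pderiv i q) := by
  classical
  rw [fischer, fischer, support_X_mul, Finset.sum_map]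
  refine Finset.sum_congr rfl fun m _ => ?_
  have hprod : (∏ j, ((Finsupp.single i 1 + m : Fin N →₀ ℕ) j)!) = (m i + 1) * ∏ j, (m j)! := by
    rw [← Finset.mul_prod_erase _ _ (Finset.mem_univ i),
      ← Finset.mul_prod_erase _ (fun j => (m j)!) (Finset.mem_univ i), ← mul_assoc]
    congr 1
    · simp [add_comm 1 (m i), Nat.factorial_succ]
    · refine Finset.prod_congr rfl fun j hj => ?_
      have : j ≠ i := (Finset.mem_erase.1 hj).1
      simp [this]
  rw [addLeftEmbedding_apply, coeff_X_mul, hprod, coeff_pderiv, add_comm m]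
  push_cast; ring

/-- The Fischer product is positive definite. -/
lemma eq_zero_of_fischer_self {p : MvPolynomial (Fin N) ℝ} (h : fischer p p = 0) : p = 0 := by
  by_contra hp
  obtain ⟨m, hm⟩ := support_nonempty.2 hp
  have h0 : ∀ n ∈ p.support, 0 ≤ ((∏ i, (n i)! : ℕ) : ℝ) * coeff n p * coeff n p := fun n _ => by
    rw [mul_assoc]; exact mul_nonneg (Nat.cast_nonneg _) (mul_self_nonneg _)
  have := (Finset.sum_eq_zero_iff_of_nonneg h0).1 h m hm
  have hc := mem_support_iff.1 hm
  have hf : ((∏ i, (m i)! : ℕ) : ℝ) ≠ 0 :=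
    Nat.cast_ne_zero.2 (Finset.prod_ne_zero_iff.2 fun i _ => Nat.factorial_ne_zero _)
  simp_all

variable (N) in
/-- The polynomial `|x|² = ∑ i, x_i²`. -/
def normSqPoly : MvPolynomial (Fin N) ℝ := ∑ i, X i * X i

lemma isHomogeneous_normSqPoly : (normSqPoly N).IsHomogeneous 2 :=
  IsHomogeneous.sum _ _ _ fun i _ => (isHomogeneous_X ℝ i).mul (isHomogeneous_X ℝ i)

lemma polyLaplacian_apply (p : MvPolynomial (Fin N) ℝ) :
    polyLaplacian N p = ∑ i, pderiv i (pderiv i p) := by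
  simp [polyLaplacian, LinearMap.sum_apply]

lemma fischer_normSqPoly_mul (p q : MvPolynomial (Fin N) ℝ) :
    fischer (normSqPoly N * p) q = fischer p (polyLaplacian N q) := by
  rw [normSqPoly, Finset.sum_mul, fischer_sum_left, polyLaplacian_apply, fischer_sum_right]
  simp only [mul_assoc, fischer_X_mul]

/-- No nonzero multiple of `|x|²` is harmonic: `⟨|x|²q, |x|²q⟩ = ⟨q, Δ(|x|²q)⟩`. -/
lemma eq_zero_of_polyLaplacian_normSqPoly_mul {q : MvPolynomial (Fin N) ℝ} (hN : 0 < N)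
    (h : polyLaplacian N (normSqPoly N * q) = 0) : q = 0 := by
  have h1 : normSqPoly N * q = 0 := by
    refine eq_zero_of_fischer_self ?_
    rw [fischer_normSqPoly_mul, h]
    simp [fischer]
  refine (mul_eq_zero.1 h1).resolve_left fun h2 => ?_
  have := congrArg (eval fun _ => (1 : ℝ)) h2
  simp [normSqPoly] at this
  omega

instance (k : ℕ) : FiniteDimensional ℝ (homogeneousSubmodule (Fin N) ℝ k) :=
  Module.Finite.iff_fg.2 (homogeneousSubmodule_fg _ _ _)

instance (k : ℕ) : FiniteDimensional ℝ (harmonicPolynomials N k) :=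
  Submodule.finiteDimensional_of_le (inf_le_left : _ ≤ homogeneousSubmodule (Fin N) ℝ k)

lemma finrank_homogeneousSubmodule (k : ℕ) :
    Module.finrank ℝ (homogeneousSubmodule (Fin N) ℝ k) = (N + k - 1).choose k := by
  rw [homogeneousSubmodule_eq_finsupp_supported,
    (AddMonoidAlgebra.supportedEquivFinsupp (R := ℝ) (S := ℝ) _).finrank_eq]
  have h : {d : Fin N →₀ ℕ | d.degree = k} =
      (↑((Finset.univ : Finset (Fin N)).finsuppAntidiag k) : Set (Fin N →₀ ℕ)) := by
    ext d; simp [Finsupp.degree_eq_sum]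
  rw [h, Module.finrank_finsupp]
  have := Finset.card_finsuppAntidiag_nat_eq_choose (s := (Finset.univ : Finset (Fin N))) k
  simpa using this

lemma polyLaplacian_mem (k : ℕ) {p : MvPolynomial (Fin N) ℝ} (hp : p.IsHomogeneous (k + 2)) :
    (polyLaplacian N p).IsHomogeneous k := by
  rw [polyLaplacian_apply]
  exact IsHomogeneous.sum _ _ _ fun i _ => hp.pderiv.pderiv

lemma harmonicPolynomials_of_lt_two {k : ℕ} (hk : k < 2) :
    harmonicPolynomials N k = homogeneousSubmodule (Fin N) ℝ k := by
  refine inf_eq_left.2 fun p hp => ?_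
  have hp : p.IsHomogeneous k := hp
  rw [LinearMap.mem_ker, polyLaplacian_apply]
  refine Finset.sum_eq_zero fun i _ => ?_
  have h : (pderiv i p).IsHomogeneous 0 := by
    have := hp.pderiv (i := i)
    rwa [show k - 1 = 0 by omega] at this
  rw [totalDegree_eq_zero_iff_eq_C.1 ((totalDegree_zero_iff_isHomogeneous (Fin N)).2 h), pderiv_C]

/-- Multiplication by `|x|²` as a map `P_k → P_{k+2}` between spaces of homogeneous polynomials. -/
def mulNormSq (k : ℕ) :
    homogeneousSubmodule (Fin N) ℝ k →ₗ[ℝ] MvPolynomial (Fin N) ℝ :=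
  LinearMap.mulLeft ℝ (normSqPoly N) ∘ₗ Submodule.subtype _

lemma mulNormSq_injective (hN : 0 < N) (k : ℕ) : Function.Injective (mulNormSq (N := N) k) := by
  rw [← LinearMap.ker_eq_bot, LinearMap.ker_eq_bot']
  intro q hq
  have : normSqPoly N * (q : MvPolynomial (Fin N) ℝ) = 0 := hq
  exact Subtype.ext (eq_zero_of_polyLaplacian_normSqPoly_mul hN (by rw [this, map_zero]))

lemma range_mulNormSq_le (k : ℕ) :
    LinearMap.range (mulNormSq (N := N) k) ≤ homogeneousSubmodule (Fin N) ℝ (k + 2) := by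
  rintro _ ⟨q, rfl⟩
  have := isHomogeneous_normSqPoly.mul (show (q : MvPolynomial (Fin N) ℝ).IsHomogeneous k from q.2)
  rw [add_comm] at this
  exact this

lemma disjoint_harmonic_range (hN : 0 < N) (k : ℕ) :
    harmonicPolynomials N (k + 2) ⊓ LinearMap.range (mulNormSq (N := N) k) = ⊥ := by
  rw [eq_bot_iff]
  rintro _ ⟨⟨_, h⟩, q, rfl⟩
  have h0 : (q : MvPolynomial (Fin N) ℝ) = 0 := eq_zero_of_polyLaplacian_normSqPoly_mul hN h
  have h1 : q = 0 := Subtype.ext h0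
  rw [h1, map_zero]
  exact zero_mem _

/-- The Laplacian maps `P_{k+2}` to `P_k` with kernel `Φ_{k+2}`. -/
lemma finrank_homogeneousSubmodule_le (k : ℕ) :
    Module.finrank ℝ (homogeneousSubmodule (Fin N) ℝ (k + 2)) ≤
      Module.finrank ℝ (harmonicPolynomials N (k + 2)) +
        Module.finrank ℝ (homogeneousSubmodule (Fin N) ℝ k) := by
  let L : homogeneousSubmodule (Fin N) ℝ (k + 2) →ₗ[ℝ] homogeneousSubmodule (Fin N) ℝ k :=
    (polyLaplacian N).restrict fun p hp => polyLaplacian_mem k hp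
  have h1 := L.finrank_range_add_finrank_ker
  have h2 := Submodule.finrank_le (LinearMap.range L)
  have h3 : Module.finrank ℝ (LinearMap.ker L) ≤ Module.finrank ℝ (harmonicPolynomials N (k + 2)) := by
    refine LinearMap.finrank_le_finrank_of_injective
      (f := (Submodule.subtype _ ∘ₗ Submodule.subtype (LinearMap.ker L)).codRestrict _ ?_) ?_
    · rintro ⟨p, hp⟩
      exact ⟨p.2, congrArg Subtype.val hp⟩
    · intro a b hab
      have h := congrArg (fun y : harmonicPolynomials N (k + 2) => (y : MvPolynomial (Fin N) ℝ)) hab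
      exact Subtype.ext (Subtype.ext h)
  omega

/-- `P_{k+2} = Φ_{k+2} ⊕ |x|² P_k`. -/
lemma harmonic_sup_range (hN : 0 < N) (k : ℕ) :
    harmonicPolynomials N (k + 2) ⊔ LinearMap.range (mulNormSq (N := N) k) =
      homogeneousSubmodule (Fin N) ℝ (k + 2) ∧
    Module.finrank ℝ (homogeneousSubmodule (Fin N) ℝ (k + 2)) =
      Module.finrank ℝ (harmonicPolynomials N (k + 2)) +
        Module.finrank ℝ (homogeneousSubmodule (Fin N) ℝ k) := by
  have h1 := Submodule.finrank_sup_add_finrank_inf_eq (harmonicPolynomials N (k + 2))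
    (LinearMap.range (mulNormSq (N := N) k))
  rw [disjoint_harmonic_range hN k, finrank_bot, add_zero,
    LinearMap.finrank_range_of_inj (mulNormSq_injective hN k)] at h1
  have hle : harmonicPolynomials N (k + 2) ⊔ LinearMap.range (mulNormSq (N := N) k) ≤
      homogeneousSubmodule (Fin N) ℝ (k + 2) := sup_le inf_le_left (range_mulNormSq_le k)
  have h2 := finrank_homogeneousSubmodule_le (N := N) k
  have h3 := Submodule.finrank_mono hle
  exact ⟨Submodule.eq_of_le_of_finrank_le hle (by omega), by omega⟩

lemma finrank_harmonicPolynomials_zero :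
    Module.finrank ℝ (harmonicPolynomials N 0) = 1 := by
  rw [harmonicPolynomials_of_lt_two (by norm_num), finrank_homogeneousSubmodule]
  simp

lemma finrank_harmonicPolynomials (hN : 2 ≤ N) (k : ℕ) (hk : ¬ (N = 2 ∧ k = 0)) :
    (Module.finrank ℝ (harmonicPolynomials N k) : ℝ) =
      ((N : ℝ) + 2 * k - 2) * ((N + k - 3)! : ℝ) / (((N - 2)! : ℝ) * (k ! : ℝ)) := by
  obtain ⟨n, rfl⟩ := Nat.exists_eq_add_of_le hN
  match k with
  | 0 =>
    obtain ⟨m, rfl⟩ : ∃ m, n = m + 1 := Nat.exists_eq_succ_of_ne_zero (by omega)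
    rw [finrank_harmonicPolynomials_zero]
    have e1 : 2 + (m + 1) + 0 - 3 = m := by omega
    have e2 : 2 + (m + 1) - 2 = m + 1 := by omega
    rw [e1, e2, Nat.factorial_succ]
    push_cast
    have := Nat.cast_ne_zero (R := ℝ).2 (Nat.factorial_ne_zero m)
    field_simp
    simp
  | 1 =>
    rw [harmonicPolynomials_of_lt_two (by norm_num), finrank_homogeneousSubmodule]
    have e1 : 2 + n + 1 - 3 = n := by omega
    have e2 : 2 + n - 2 = n := by omega
    rw [e1, e2]
    have := Nat.cast_ne_zero (R := ℝ).2 (Nat.factorial_ne_zero n)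
    simp only [Nat.factorial_one, Nat.add_sub_cancel, Nat.choose_one_right]
    push_cast
    field_simp
    ring
  | k + 2 =>
    have h := (harmonic_sup_range (N := 2 + n) (by omega) k).2
    rw [finrank_homogeneousSubmodule, finrank_homogeneousSubmodule] at h
    have e1 : 2 + n + (k + 2) - 1 = n + 1 + (k + 2) := by omega
    have e2 : 2 + n + k - 1 = n + 1 + k := by omega
    have e3 : 2 + n + (k + 2) - 3 = n + k + 1 := by omega
    have e4 : 2 + n - 2 = n := by omega
    rw [e1, e2] at h
    rw [e3, e4]
    have h' : (Module.finrank ℝ (harmonicPolynomials (2 + n) (k + 2)) : ℝ) =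
        ((n + 1 + (k + 2)).choose (k + 2) : ℝ) - ((n + 1 + k).choose k : ℝ) := by
      rw [h]; push_cast; ring
    rw [h', Nat.add_choose, Nat.add_choose,
      Nat.cast_div (Nat.factorial_mul_factorial_dvd_factorial_add _ _) (by positivity),
      Nat.cast_div (Nat.factorial_mul_factorial_dvd_factorial_add _ _) (by positivity)]
    have a1 : (n + 1 + (k + 2))! = (n + k + 3) * (n + k + 2) * (n + k + 1)! := by
      rw [show n + 1 + (k + 2) = n + k + 1 + 1 + 1 by ring, Nat.factorial_succ, Nat.factorial_succ]
      ring
    have a2 : (k + 2)! = (k + 2) * (k + 1) * k ! := by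
      rw [Nat.factorial_succ, Nat.factorial_succ]; ring
    rw [a1, a2, Nat.factorial_succ n, show n + 1 + k = n + k + 1 by ring]
    push_cast
    have f1 := Nat.cast_ne_zero (R := ℝ).2 (Nat.factorial_ne_zero n)
    have f2 := Nat.cast_ne_zero (R := ℝ).2 (Nat.factorial_ne_zero k)
    have f3 : (n : ℝ) + 1 ≠ 0 := by positivity
    have f4 : (k : ℝ) + 1 ≠ 0 := by positivity
    have f5 : (k : ℝ) + 2 ≠ 0 := by positivity
    field_simp
    ring

lemma finrank_harmonicPolynomials_pos (hN : 2 ≤ N) (k : ℕ) :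
    0 < Module.finrank ℝ (harmonicPolynomials N k) := by
  by_cases hk : N = 2 ∧ k = 0
  · rw [hk.2, finrank_harmonicPolynomials_zero]; exact one_pos
  · have h := finrank_harmonicPolynomials hN k hk
    have h2 : (2 : ℝ) ≤ N := by exact_mod_cast hN
    have h3 : 0 < (N : ℝ) + 2 * k - 2 := by
      by_cases hN2 : N = 2
      · have : (1 : ℝ) ≤ k := by exact_mod_cast Nat.one_le_iff_ne_zero.2 fun h => hk ⟨hN2, h⟩
        linarith
      · have : (3 : ℝ) ≤ N := by exact_mod_cast (show 3 ≤ N by omega)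
        have : (0 : ℝ) ≤ k := Nat.cast_nonneg k
        linarith
    have : (0 : ℝ) < Module.finrank ℝ (harmonicPolynomials N k) := by rw [h]; positivity
    exact_mod_cast this

/-- Iterating `P_{k+2} = Φ_{k+2} ⊕ |x|² P_k` and using `|x|² = 1`. The family `h` is indexed by all
degrees, the terms of degree `> k` being zero, so that families for different `k` can be added. -/
lemma exists_harmonic_sum_of_isHomogeneous (hN : 0 < N) (k : ℕ) {p : MvPolynomial (Fin N) ℝ}
    (hp : p.IsHomogeneous k) :
    ∃ h : ℕ → MvPolynomial (Fin N) ℝ, (∀ j, h j ∈ harmonicPolynomials N j) ∧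
      ∀ x : Fin N → ℝ, ∑ i, x i ^ 2 = 1 → ∀ n, k < n →
        eval x p = ∑ j ∈ Finset.range n, eval x (h j) := by
  induction k using Nat.strong_induction_on generalizing p with
  | _ k ih =>
    by_cases hk : k < 2
    · refine ⟨fun j => if j = k then p else 0, fun j => ?_, fun x _ n hn => ?_⟩
      · dsimp only
        split_ifs with h
        · rw [h, harmonicPolynomials_of_lt_two hk]; exact hp
        · exact zero_mem _
      · rw [Finset.sum_eq_single_of_mem k (Finset.mem_range.2 hn)]
        · simp
        · intro j _ hj; simp [hj]
    · obtain ⟨k, rfl⟩ := Nat.exists_eq_add_of_le' (not_lt.1 hk)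
      have : p ∈ harmonicPolynomials N (k + 2) ⊔ LinearMap.range (mulNormSq (N := N) k) := by
        rw [(harmonic_sup_range hN k).1]; exact hp
      obtain ⟨h0, hh0, _, ⟨q, rfl⟩, rfl⟩ := Submodule.mem_sup.1 this
      obtain ⟨h, hh, hs⟩ := ih k (by omega) q.2
      refine ⟨fun j => (if j = k + 2 then h0 else 0) + h j, fun j => ?_, fun x hx n hn => ?_⟩
      · refine add_mem ?_ (hh j)
        split_ifs with h
        · rw [h]; exact hh0
        · exact zero_mem _
      · have e : eval x (mulNormSq k q) = eval x (q : MvPolynomial (Fin N) ℝ) := by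
          change eval x (normSqPoly N * (q : MvPolynomial (Fin N) ℝ)) = _
          rw [map_mul, normSqPoly, map_sum]
          simp only [map_mul, eval_X, ← sq (x _), hx, one_mul]
        simp only [map_add, Finset.sum_add_distrib]
        have e' : ∑ j ∈ Finset.range n, eval x (if j = k + 2 then h0 else 0) = eval x h0 := by
          rw [Finset.sum_eq_single_of_mem (k + 2) (Finset.mem_range.2 hn), if_pos rfl]
          intro j _ hj; rw [if_neg hj, map_zero]
        rw [e, e', hs x hx n (by omega)]

/-- On the unit sphere every polynomial is a finite sum of homogeneous harmonic polynomials. -/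
lemma exists_harmonic_sum (hN : 0 < N) (p : MvPolynomial (Fin N) ℝ) :
    ∃ (n : ℕ) (h : ℕ → MvPolynomial (Fin N) ℝ), (∀ j, h j ∈ harmonicPolynomials N j) ∧
      ∀ x : Fin N → ℝ, ∑ i, x i ^ 2 = 1 → ∀ m, n ≤ m →
        eval x p = ∑ j ∈ Finset.range m, eval x (h j) := by
  choose h hh hs using fun k => exists_harmonic_sum_of_isHomogeneous hN k
    (homogeneousComponent_isHomogeneous k p)
  refine ⟨p.totalDegree + 1, fun j => ∑ k ∈ Finset.range (p.totalDegree + 1), h k j,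
    fun j => Submodule.sum_mem _ fun k _ => hh k j, fun x hx m hm => ?_⟩
  conv_lhs => rw [← sum_homogeneousComponent p, map_sum]
  simp only [map_sum]
  rw [Finset.sum_comm]
  refine Finset.sum_congr rfl fun k hk => ?_
  exact hs k x hx m (by have := Finset.mem_range.1 hk; omega)

end HarmonicPolynomials

/-! ### Polar coordinates -/

section Polar

variable {N : ℕ}

/-- The unit sphere of `ℝ^N`. -/
abbrev UnitSphere (N : ℕ) : Type := Metric.sphere (0 : EuclideanSpace ℝ (Fin N)) 1

/-- The surface measure of the unit sphere of `ℝ^N`. -/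
abbrev surfaceMeasure (N : ℕ) : Measure (UnitSphere N) :=
  (volume : Measure (EuclideanSpace ℝ (Fin N))).toSphere

/-- Integration in polar coordinates, together with the integrability of the radial function
`r ↦ r^(N-1) ∫_S F(rθ) dθ` on `(0, ∞)`. -/
lemma integral_polar {F : EuclideanSpace ℝ (Fin N) → ℝ} (hN : 0 < N) (hF : Integrable F) :
    IntegrableOn (fun r : ℝ => r ^ (N - 1) *
      ∫ θ : UnitSphere N, F (r • (θ : EuclideanSpace ℝ (Fin N))) ∂surfaceMeasure N) (Set.Ioi 0) ∧
    ∫ x, F x = ∫ r in Set.Ioi (0 : ℝ), r ^ (N - 1) *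
      ∫ θ : UnitSphere N, F (r • (θ : EuclideanSpace ℝ (Fin N))) ∂surfaceMeasure N := by
  have : Nonempty (Fin N) := ⟨⟨0, hN⟩⟩
  have hd : Module.finrank ℝ (EuclideanSpace ℝ (Fin N)) = N := finrank_euclideanSpace_fin
  have mp := (volume : Measure (EuclideanSpace ℝ (Fin N))).measurePreserving_homeomorphUnitSphereProd
  rw [hd] at mp
  have me := (homeomorphUnitSphereProd (EuclideanSpace ℝ (Fin N))).measurableEmbedding
  set G : UnitSphere N × Set.Ioi (0 : ℝ) → ℝ := fun q => F ((q.2 : ℝ) • (q.1 : (EuclideanSpace ℝ (Fin N)))) with hG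
  have hcomp : G ∘ (homeomorphUnitSphereProd (EuclideanSpace ℝ (Fin N))) = F ∘ Subtype.val := by
    ext x
    have := (homeomorphUnitSphereProd (EuclideanSpace ℝ (Fin N))).symm_apply_apply x
    have h2 := congrArg Subtype.val this
    rw [homeomorphUnitSphereProd_symm_apply_coe] at h2
    simp only [G, Function.comp, h2]
  have hms : MeasurableSet ({0}ᶜ : Set (EuclideanSpace ℝ (Fin N))) := (measurableSet_singleton _).compl
  have hFi : Integrable (F ∘ Subtype.val) (Measure.comap (Subtype.val : ({0}ᶜ : Set (EuclideanSpace ℝ (Fin N))) → (EuclideanSpace ℝ (Fin N))) volume) :=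
    (integrableOn_iff_comap_subtypeVal hms).1 hF.integrableOn
  have hGi : Integrable G ((surfaceMeasure N).prod (Measure.volumeIoiPow (N - 1))) := by
    rw [← mp.integrable_comp_emb me, hcomp]; exact hFi
  have hGint : ∫ q, G q ∂((surfaceMeasure N).prod (Measure.volumeIoiPow (N - 1))) = ∫ x, F x := by
    rw [← mp.integral_comp me]
    change ∫ x, (G ∘ (homeomorphUnitSphereProd (EuclideanSpace ℝ (Fin N)))) x ∂_ = _
    rw [hcomp]
    change ∫ x : ({0}ᶜ : Set (EuclideanSpace ℝ (Fin N))), F x ∂_ = _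
    rw [integral_subtype_comap hms, restrict_compl_singleton]
  have h1 := hGi.integral_prod_right
  have h2 := integral_prod_symm G hGi
  have hmeas : Measurable fun r : Set.Ioi (0 : ℝ) => Real.toNNReal ((r : ℝ) ^ (N - 1)) :=
    (measurable_subtype_coe.pow_const _).real_toNNReal
  constructor
  · rw [Measure.volumeIoiPow] at h1
    have h3 := (integrable_withDensity_iff_integrable_smul hmeas).1 h1
    rw [integrableOn_iff_comap_subtypeVal measurableSet_Ioi]
    refine h3.congr (ae_of_all _ fun r => ?_)
    simp only [Function.comp, NNReal.smul_def, smul_eq_mul, G]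
    rw [Real.coe_toNNReal _ (pow_nonneg r.2.out.le _)]
  · rw [← hGint, h2, Measure.volumeIoiPow]
    have h3 := integral_withDensity_eq_integral_smul (μ := Measure.comap (Subtype.val : Set.Ioi (0 : ℝ) → ℝ) volume)
      hmeas (fun r => ∫ θ, G (θ, r) ∂surfaceMeasure N)
    refine h3.trans ?_
    rw [← integral_subtype_comap measurableSet_Ioi]
    refine integral_congr_ae (ae_of_all _ fun r => ?_)
    simp only [NNReal.smul_def, smul_eq_mul, G]
    rw [Real.coe_toNNReal _ (pow_nonneg r.2.out.le _)]

lemma integrable_sphere {f : UnitSphere N → ℝ} (hf : Continuous f) :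
    Integrable f (surfaceMeasure N) :=
  hf.integrable_of_hasCompactSupport (HasCompactSupport.of_compactSpace f)

lemma integrable_sphere_coe {f : EuclideanSpace ℝ (Fin N) → ℝ} (hf : Continuous f) :
    Integrable (fun θ : UnitSphere N => f θ) (surfaceMeasure N) :=
  integrable_sphere (hf.comp continuous_subtype_val)

lemma norm_coe_unitSphere (θ : UnitSphere N) : ‖(θ : EuclideanSpace ℝ (Fin N))‖ = 1 := by
  simp

/-- Differentiation under the integral over the sphere. -/
lemma hasDerivAt_integral_sphere {F F' : ℝ → UnitSphere N → ℝ}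
    (hF : ∀ r, Continuous (F r)) (hF' : Continuous (Function.uncurry F'))
    (h : ∀ r θ, HasDerivAt (fun s => F s θ) (F' r θ) r) (r : ℝ) :
    HasDerivAt (fun s => ∫ θ, F s θ ∂surfaceMeasure N) (∫ θ, F' r θ ∂surfaceMeasure N) r := by
  have hK : IsCompact (Metric.closedBall r 1 ×ˢ (Set.univ : Set (UnitSphere N))) :=
    (isCompact_closedBall r 1).prod isCompact_univ
  obtain ⟨C, hC⟩ := hK.exists_bound_of_continuousOn hF'.continuousOn
  refine (hasDerivAt_integral_of_dominated_loc_of_deriv_le (bound := fun _ => C)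
    (Metric.closedBall_mem_nhds r one_pos)
    (Eventually.of_forall fun s => (hF s).aestronglyMeasurable)
    (integrable_sphere (hF r)) ?_ ?_ (integrable_const C) ?_).2
  · exact (hF'.comp (by fun_prop : Continuous fun θ : UnitSphere N => (r, θ))).aestronglyMeasurable
  · exact ae_of_all _ fun θ s hs => hC (s, θ) ⟨hs, trivial⟩
  · exact ae_of_all _ fun θ s _ => h s θ

lemma continuousOn_integral_sphere {F : ℝ → UnitSphere N → ℝ} {s : Set ℝ}
    (hF : ContinuousOn (Function.uncurry F) (s ×ˢ Set.univ)) :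
    ContinuousOn (fun r => ∫ θ, F r θ ∂surfaceMeasure N) s :=
  continuousOn_integral_of_compact_support (μ := surfaceMeasure N) (f := F)
    isCompact_univ hF (by simp)

lemma continuous_integral_sphere {F : ℝ → UnitSphere N → ℝ}
    (hF : Continuous (Function.uncurry F)) :
    Continuous fun r => ∫ θ, F r θ ∂surfaceMeasure N :=
  continuousOn_univ.1 (continuousOn_integral_sphere hF.continuousOn)

/-- A smooth function of one variable vanishing near `(-∞, 0]` gives a smooth radial function. -/
lemma contDiff_comp_norm {ψ : ℝ → ℝ} (hψ : ContDiff ℝ ∞ ψ) {ε : ℝ} (hε : 0 < ε)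
    (h0 : ∀ r, r < ε → ψ r = 0) :
    ContDiff ℝ ∞ fun x : EuclideanSpace ℝ (Fin N) => ψ ‖x‖ := by
  rw [contDiff_iff_contDiffAt]
  intro x
  by_cases hx : x = 0
  · refine (contDiffAt_const (c := (0 : ℝ))).congr_of_eventuallyEq ?_
    filter_upwards [Metric.ball_mem_nhds x hε] with y hy
    exact h0 _ (by simpa [hx] using hy)
  · exact hψ.contDiffAt.comp x (contDiffAt_norm ℝ hx)

lemma hasCompactSupport_comp_norm {ψ : ℝ → ℝ} {R : ℝ} (h : ∀ r, R < r → ψ r = 0) :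
    HasCompactSupport fun x : EuclideanSpace ℝ (Fin N) => ψ ‖x‖ := by
  refine HasCompactSupport.of_support_subset_isCompact
    (isCompact_closedBall (0 : EuclideanSpace ℝ (Fin N)) R) fun x hx => ?_
  by_contra hxR
  exact hx (h _ (by simpa using hxR))

/-- Divergence theorem for a compactly supported `C¹` field `X` against a `C¹` function `u`. -/
lemma integral_fderiv_field {u : EuclideanSpace ℝ (Fin N) → ℝ} (hu : ContDiff ℝ 1 u)
    {X : Fin N → EuclideanSpace ℝ (Fin N) → ℝ} (hX : ∀ i, ContDiff ℝ 1 (X i))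
    (hXc : ∀ i, HasCompactSupport (X i)) :
    ∫ x, ∑ i, X i x * fderiv ℝ u x (EuclideanSpace.single i 1) =
      - ∫ x, u x * ∑ i, fderiv ℝ (X i) x (EuclideanSpace.single i 1) := by
  have c1 : ∀ v, Continuous fun x => fderiv ℝ u x v := fun v =>
    (hu.continuous_fderiv one_ne_zero).clm_apply continuous_const
  have c2 : ∀ i v, Continuous fun x => fderiv ℝ (X i) x v := fun i v =>
    ((hX i).continuous_fderiv one_ne_zero).clm_apply continuous_const
  have i1 : ∀ i, Integrable fun x => X i x * fderiv ℝ u x (EuclideanSpace.single i 1) := fun i =>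
    ((hX i).continuous.mul (c1 _)).integrable_of_hasCompactSupport (hXc i).mul_right
  have i2 : ∀ i, Integrable fun x => fderiv ℝ (X i) x (EuclideanSpace.single i 1) * u x := fun i =>
    ((c2 i _).mul hu.continuous).integrable_of_hasCompactSupport
      (((hXc i).fderiv_apply ℝ _).mul_right)
  have i3 : ∀ i, Integrable fun x => X i x * u x := fun i =>
    ((hX i).continuous.mul hu.continuous).integrable_of_hasCompactSupport (hXc i).mul_right
  rw [integral_finsetSum _ fun i _ => i1 i]
  simp only [Finset.mul_sum]
  rw [integral_finsetSum _ fun i _ => by simpa only [mul_comm] using i2 i, ← Finset.sum_neg_distrib]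
  refine Finset.sum_congr rfl fun i _ => ?_
  rw [integral_mul_fderiv_eq_neg_fderiv_mul_of_integrable (i2 i) (i1 i) (i3 i)
    (fun x _ => (hX i).differentiable one_ne_zero x) (fun x _ => hu.differentiable one_ne_zero x)]
  simp only [mul_comm]

end Polar

/-! ### Green's formula on the sphere -/

section Green

open MvPolynomial

variable {N : ℕ}

/-- A real polynomial as a function on `ℝ^N`. -/
def polyFun (q : MvPolynomial (Fin N) ℝ) (x : EuclideanSpace ℝ (Fin N)) : ℝ :=
  eval (fun i => x i) q

lemma polyFun_add (p q : MvPolynomial (Fin N) ℝ) (x) :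
    polyFun (p + q) x = polyFun p x + polyFun q x := map_add _ _ _

lemma polyFun_sub (p q : MvPolynomial (Fin N) ℝ) (x) :
    polyFun (p - q) x = polyFun p x - polyFun q x := map_sub _ _ _

lemma polyFun_mul (p q : MvPolynomial (Fin N) ℝ) (x) :
    polyFun (p * q) x = polyFun p x * polyFun q x := map_mul _ _ _

lemma polyFun_sum {ι : Type*} (s : Finset ι) (f : ι → MvPolynomial (Fin N) ℝ) (x) :
    polyFun (∑ a ∈ s, f a) x = ∑ a ∈ s, polyFun (f a) x := map_sum _ _ _

lemma polyFun_smul (c : ℝ) (q : MvPolynomial (Fin N) ℝ) (x) :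
    polyFun (c • q) x = c * polyFun q x := by simp [polyFun]

lemma polyFun_C (c : ℝ) (x : EuclideanSpace ℝ (Fin N)) : polyFun (C c) x = c := eval_C _

lemma polyFun_X (i : Fin N) (x : EuclideanSpace ℝ (Fin N)) : polyFun (X i) x = x i := eval_X _

lemma polyFun_normSqPoly (x : EuclideanSpace ℝ (Fin N)) :
    polyFun (normSqPoly N) x = ‖x‖ ^ 2 := by
  rw [normSqPoly, polyFun_sum, EuclideanSpace.real_norm_sq_eq]
  simp only [polyFun_mul, polyFun_X, sq]

lemma contDiff_polyFun (q : MvPolynomial (Fin N) ℝ) {n : WithTop ℕ∞} :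
    ContDiff ℝ n (polyFun q) := by
  unfold polyFun
  induction q using MvPolynomial.induction_on with
  | C a => simpa using contDiff_const
  | add p q hp hq => simpa using hp.add hq
  | mul_X p i hp =>
    simp only [map_mul, eval_X]
    exact hp.mul (by fun_prop)

lemma continuous_polyFun (q : MvPolynomial (Fin N) ℝ) : Continuous (polyFun q) :=
  (contDiff_polyFun q (n := 0)).continuous

lemma differentiable_polyFun (q : MvPolynomial (Fin N) ℝ) : Differentiable ℝ (polyFun q) :=
  (contDiff_polyFun q (n := 1)).differentiable one_ne_zero

lemma fderiv_polyFun_single (q : MvPolynomial (Fin N) ℝ) (x : EuclideanSpace ℝ (Fin N))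
    (i : Fin N) :
    fderiv ℝ (polyFun q) x (EuclideanSpace.single i 1) = polyFun (pderiv i q) x := by
  induction q using MvPolynomial.induction_on with
  | C a =>
    have : polyFun (N := N) (C a) = fun _ => a := by
      ext y; exact polyFun_C a y
    rw [this, pderiv_C]
    simp [polyFun]
  | add p q hp hq =>
    have : polyFun (p + q) = polyFun p + polyFun q := by
      ext y; exact polyFun_add p q y
    rw [this, fderiv_add (differentiable_polyFun p x) (differentiable_polyFun q x), map_add,
      polyFun_add]
    simp [hp, hq]
  | mul_X p j hp =>
    have : polyFun (p * X j) = polyFun p * polyFun (X j) := by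
      ext y; exact polyFun_mul p (X j) y
    have hX : fderiv ℝ (polyFun (X j)) x (EuclideanSpace.single i 1) = polyFun (pderiv i (X j)) x := by
      have : polyFun (X j) = fun x : EuclideanSpace ℝ (Fin N) =>
        EuclideanSpace.proj (𝕜 := ℝ) j x := by
        ext y; exact polyFun_X j y
      rw [this, ContinuousLinearMap.fderiv]
      classical
      rw [pderiv_X]
      by_cases h : j = i
      · subst h; simp [polyFun]
      · simp [polyFun, h]
    rw [this, fderiv_mul (differentiable_polyFun p x) (differentiable_polyFun (X j) x), pderiv_mul,
      polyFun_add, polyFun_mul, polyFun_mul]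
    simp only [add_apply, smul_apply, smul_eq_mul, hp, hX]
    ring

lemma gradient_apply (u : EuclideanSpace ℝ (Fin N) → ℝ) (x : EuclideanSpace ℝ (Fin N)) (i : Fin N) :
    gradient u x i = fderiv ℝ u x (EuclideanSpace.single i 1) := by
  rw [← inner_gradient_left, EuclideanSpace.inner_single_right]
  simp

lemma inner_eq_sum (x y : EuclideanSpace ℝ (Fin N)) : inner ℝ x y = ∑ i, x i * y i := by
  simp [PiLp.inner_apply, mul_comm]

lemma gradient_polyFun_apply (q : MvPolynomial (Fin N) ℝ) (x : EuclideanSpace ℝ (Fin N))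
    (i : Fin N) : gradient (polyFun q) x i = polyFun (pderiv i q) x := by
  rw [gradient_apply, fderiv_polyFun_single]

lemma inner_gradient_polyFun {q : MvPolynomial (Fin N) ℝ} {k : ℕ} (hq : q.IsHomogeneous k)
    (x : EuclideanSpace ℝ (Fin N)) :
    inner ℝ x (gradient (polyFun q) x) = k * polyFun q x := by
  have := congrArg (fun p => polyFun p x) hq.sum_X_mul_pderiv
  simp only [polyFun_sum, polyFun_mul, polyFun_X] at this
  rw [inner_eq_sum]
  simp only [gradient_polyFun_apply, this]
  simp [polyFun]

lemma polyFun_smul_arg {q : MvPolynomial (Fin N) ℝ} {k : ℕ} (hq : q.IsHomogeneous k) (r : ℝ)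
    (x : EuclideanSpace ℝ (Fin N)) : polyFun q (r • x) = r ^ k * polyFun q x := by
  unfold polyFun
  rw [eval_eq, eval_eq, Finset.mul_sum]
  refine Finset.sum_congr rfl fun m hm => ?_
  have hm : m.degree = k := by
    rw [Finsupp.degree_eq_weight_one]; exact hq (mem_support_iff.1 hm)
  simp only [PiLp.smul_apply, smul_eq_mul, mul_pow, Finset.prod_mul_distrib]
  rw [Finset.prod_pow_eq_pow_sum, ← Finsupp.degree_apply, hm]
  ring

lemma hasFDerivAt_norm {x : EuclideanSpace ℝ (Fin N)} (hx : x ≠ 0) :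
    HasFDerivAt (fun y : EuclideanSpace ℝ (Fin N) => ‖y‖) (‖x‖⁻¹ • innerSL ℝ x) x := by
  have h := (hasStrictFDerivAt_norm_sq x).hasFDerivAt.sqrt (pow_ne_zero 2 (norm_ne_zero_iff.2 hx))
  simp only [Real.sqrt_sq (norm_nonneg _)] at h
  refine h.congr_fderiv ?_
  ext y
  simp
  field_simp

lemma hasFDerivAt_comp_norm {ψ : ℝ → ℝ} {x : EuclideanSpace ℝ (Fin N)} (hx : x ≠ 0) {d : ℝ}
    (hψ : HasDerivAt ψ d ‖x‖) :
    HasFDerivAt (fun y : EuclideanSpace ℝ (Fin N) => ψ ‖y‖) ((d * ‖x‖⁻¹) • innerSL ℝ x) x := by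
  have := hψ.comp_hasFDerivAt x (hasFDerivAt_norm hx)
  rwa [smul_smul] at this

lemma gradient_comp_norm {ψ : ℝ → ℝ} {x : EuclideanSpace ℝ (Fin N)} (hx : x ≠ 0) {d : ℝ}
    (hψ : HasDerivAt ψ d ‖x‖) :
    gradient (fun y : EuclideanSpace ℝ (Fin N) => ψ ‖y‖) x = (d * ‖x‖⁻¹) • x := by
  refine HasGradientAt.gradient ?_
  rw [hasGradientAt_iff_hasFDerivAt]
  refine (hasFDerivAt_comp_norm hx hψ).congr_fderiv ?_
  ext y
  simp

lemma fderiv_comp_norm_apply {ψ : ℝ → ℝ} (hψ : ContDiff ℝ ∞ ψ) {ε : ℝ} (hε : 0 < ε)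
    (h0 : ∀ r, r < ε → ψ r = 0) (x y : EuclideanSpace ℝ (Fin N)) :
    fderiv ℝ (fun z : EuclideanSpace ℝ (Fin N) => ψ ‖z‖) x y =
      deriv ψ ‖x‖ * ‖x‖⁻¹ * inner ℝ x y := by
  by_cases hx : x = 0
  · have : (fun z : EuclideanSpace ℝ (Fin N) => ψ ‖z‖) =ᶠ[𝓝 x] fun _ => 0 := by
      filter_upwards [Metric.ball_mem_nhds x hε] with y hy
      exact h0 _ (by simpa [hx] using hy)
    rw [this.fderiv_eq]
    simp [hx]
  · rw [(hasFDerivAt_comp_norm hx (hψ.differentiable (by simp) _).hasDerivAt).fderiv]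
    simp

/-- If a continuous function integrates to zero against every smooth radial bump supported away
from the origin, then its integral over every sphere centred at the origin vanishes. -/
lemma integral_sphere_eq_zero_of_radial (hN : 0 < N) {J : EuclideanSpace ℝ (Fin N) → ℝ}
    (hJ : Continuous J)
    (h : ∀ ψ : ℝ → ℝ, ContDiff ℝ ∞ ψ → (∃ ε > 0, ∀ r, r < ε → ψ r = 0) →
      (∃ R, ∀ r, R < r → ψ r = 0) → ∫ x, ψ ‖x‖ * J x = 0) {r : ℝ} (hr : 0 < r) :
    ∫ θ : UnitSphere N, J (r • (θ : EuclideanSpace ℝ (Fin N))) ∂surfaceMeasure N = 0 := by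
  set I : ℝ → ℝ := fun r => ∫ θ : UnitSphere N, J (r • (θ : EuclideanSpace ℝ (Fin N)))
    ∂surfaceMeasure N with hI
  have hIc : Continuous I := continuous_integral_sphere
    (F := fun r (θ : UnitSphere N) => J (r • (θ : EuclideanSpace ℝ (Fin N))))
    (hJ.comp (by fun_prop))
  have hc : Continuous fun r : ℝ => r ^ (N - 1) * I r := by fun_prop
  have key : ∀ᵐ r : ℝ, r ∈ Set.Ioi (0 : ℝ) → r ^ (N - 1) * I r = 0 := by
    refine isOpen_Ioi.ae_eq_zero_of_integral_contDiff_smul_eq_zero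
      (hc.locallyIntegrable.locallyIntegrableOn _) fun ψ hψ hψc hψs => ?_
    have h1 : ∃ ε > 0, ∀ r, r < ε → ψ r = 0 := by
      have : (tsupport ψ)ᶜ ∈ 𝓝 (0 : ℝ) :=
        (isClosed_tsupport ψ).isOpen_compl.mem_nhds fun h => lt_irrefl (0 : ℝ) (hψs h)
      obtain ⟨ε, hε, hb⟩ := Metric.mem_nhds_iff.1 this
      refine ⟨ε, hε, fun r hr => ?_⟩
      by_contra hne
      have hrs : r ∈ tsupport ψ := subset_tsupport ψ hne
      have h0 : 0 < r := hψs hrs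
      exact hb (by simpa [abs_of_pos h0] using hr) hrs
    have h2 : ∃ R, ∀ r, R < r → ψ r = 0 := by
      obtain ⟨R, hR⟩ := hψc.isCompact.bddAbove
      refine ⟨R, fun r hr => ?_⟩
      by_contra hne
      exact not_lt.2 (hR (subset_tsupport ψ hne)) hr
    obtain ⟨ε, hε, hz⟩ := h1
    obtain ⟨R, hR⟩ := h2
    have hint : Integrable fun x : EuclideanSpace ℝ (Fin N) => ψ ‖x‖ * J x :=
      ((contDiff_comp_norm hψ hε hz).continuous.mul hJ).integrable_of_hasCompactSupport
        (hasCompactSupport_comp_norm hR).mul_right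
    have h3 := (integral_polar hN hint).2
    rw [h ψ hψ ⟨ε, hε, hz⟩ ⟨R, hR⟩] at h3
    have h4 : ∫ r, ψ r • (r ^ (N - 1) * I r) =
        ∫ r in Set.Ioi (0 : ℝ), ψ r • (r ^ (N - 1) * I r) := by
      rw [setIntegral_eq_integral_of_forall_compl_eq_zero]
      intro r hr
      rw [hz r (lt_of_le_of_lt (not_lt.1 hr) hε), zero_smul]
    rw [h4]
    refine Eq.trans ?_ h3.symm
    refine setIntegral_congr_fun measurableSet_Ioi fun r hr => ?_
    have hr : 0 < r := hr
    simp only [norm_smul, norm_coe_unitSphere, mul_one, Real.norm_of_nonneg hr.le,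
      integral_const_mul, hI, smul_eq_mul]
    ring
  have h5 : Set.EqOn (fun r : ℝ => r ^ (N - 1) * I r) (fun _ => 0) (Set.Ioi 0) := by
    refine Measure.eqOn_open_of_ae_eq (μ := volume) ?_ isOpen_Ioi hc.continuousOn
      continuousOn_const
    rw [Filter.EventuallyEq, ae_restrict_iff' measurableSet_Ioi]
    exact key
  have h6 := h5 (Set.mem_Ioi.2 hr)
  exact (mul_eq_zero.1 h6).resolve_left (pow_ne_zero _ hr.ne')

/-- The bilinear form `|x|² ⟨g, h⟩ - ⟨x, g⟩ ⟨x, h⟩`, which for `|x| = 1` is the inner product of the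
components of `g` and `h` orthogonal to `x`. -/
def tangentialInner (x g h : EuclideanSpace ℝ (Fin N)) : ℝ :=
  ‖x‖ ^ 2 * inner ℝ g h - inner ℝ x g * inner ℝ x h

/-- The eigenvalue `k (k + N - 2)` of the Laplace–Beltrami operator of the unit sphere. -/
def sphereEigenvalue (N k : ℕ) : ℝ := k * (k + N - 2)

/-- The tangential vector field `|x|² ∇q - k q x`, whose divergence is `-k(k+N-2) q` when `q` is
harmonic and homogeneous of degree `k`. -/
def tangentialField (q : MvPolynomial (Fin N) ℝ) (k : ℕ) (i : Fin N) : MvPolynomial (Fin N) ℝ :=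
  normSqPoly N * pderiv i q - (k : MvPolynomial (Fin N) ℝ) * q * X i

lemma polyFun_tangentialField (q : MvPolynomial (Fin N) ℝ) (k : ℕ) (i : Fin N)
    (x : EuclideanSpace ℝ (Fin N)) :
    polyFun (tangentialField q k i) x = ‖x‖ ^ 2 * polyFun (pderiv i q) x - k * polyFun q x * x i := by
  rw [tangentialField, polyFun_sub, polyFun_mul, polyFun_mul, polyFun_mul, polyFun_normSqPoly,
    polyFun_X]
  simp [polyFun]

/-- The field `tangentialField q k` is orthogonal to `x`, so multiplying it by a radial function
multiplies its divergence by that function. -/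
lemma sum_mul_tangentialField {q : MvPolynomial (Fin N) ℝ} {k : ℕ} (hq : q.IsHomogeneous k)
    (x : EuclideanSpace ℝ (Fin N)) : ∑ i, x i * polyFun (tangentialField q k i) x = 0 := by
  have h1 := inner_gradient_polyFun hq x
  rw [inner_eq_sum] at h1
  simp only [gradient_polyFun_apply] at h1
  have h2 : ∑ i, x i * x i = ‖x‖ ^ 2 := by
    rw [← inner_eq_sum, real_inner_self_eq_norm_sq]
  calc ∑ i, x i * polyFun (tangentialField q k i) x
      = ‖x‖ ^ 2 * ∑ i, x i * polyFun (pderiv i q) x - k * polyFun q x * ∑ i, x i * x i := by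
        rw [Finset.mul_sum, Finset.mul_sum, ← Finset.sum_sub_distrib]
        exact Finset.sum_congr rfl fun i _ => by rw [polyFun_tangentialField]; ring
    _ = 0 := by rw [h1, h2]; ring

lemma div_tangentialField {q : MvPolynomial (Fin N) ℝ} {k : ℕ} (hq : q ∈ harmonicPolynomials N k)
    (x : EuclideanSpace ℝ (Fin N)) :
    ∑ i, polyFun (pderiv i (tangentialField q k i)) x = - (sphereEigenvalue N k * polyFun q x) := by
  have hh : q.IsHomogeneous k := hq.1
  have h1 := inner_gradient_polyFun hh x
  rw [inner_eq_sum] at h1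
  simp only [gradient_polyFun_apply] at h1
  have h2 : ∑ i, polyFun (pderiv i (pderiv i q)) x = 0 := by
    have h3 : polyLaplacian N q = 0 := hq.2
    rw [polyLaplacian_apply] at h3
    rw [← polyFun_sum, h3]; simp [polyFun]
  have h4 : ∀ i, polyFun (pderiv i (normSqPoly N)) x = 2 * x i := fun i => by
    rw [normSqPoly, map_sum, polyFun_sum, Finset.sum_eq_single i]
    · rw [pderiv_mul, pderiv_X_self, polyFun_add]; simp [polyFun]; ring
    · intro j _ hj; rw [pderiv_mul, pderiv_X_of_ne hj]; simp [polyFun]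
    · simp
  have h5 : ∀ i, polyFun (pderiv i (tangentialField q k i)) x =
      (2 - k) * (x i * polyFun (pderiv i q) x) + ‖x‖ ^ 2 * polyFun (pderiv i (pderiv i q)) x
        - k * polyFun q x := fun i => by
    have hk : pderiv i (k : MvPolynomial (Fin N) ℝ) = 0 := (pderiv i).map_natCast k
    rw [tangentialField, map_sub, pderiv_mul, pderiv_mul, pderiv_mul, pderiv_X_self, polyFun_sub,
      polyFun_add, polyFun_add, polyFun_mul, polyFun_mul, polyFun_mul, polyFun_mul, polyFun_add,
      polyFun_mul, polyFun_mul, hk, h4, polyFun_normSqPoly, polyFun_X]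
    simp [polyFun]
    ring
  simp only [h5, Finset.sum_add_distrib, Finset.sum_sub_distrib, ← Finset.mul_sum, h1, h2]
  simp [sphereEigenvalue]
  ring

lemma tangentialInner_gradient_polyFun {q : MvPolynomial (Fin N) ℝ} {k : ℕ}
    (hq : q.IsHomogeneous k) (u : EuclideanSpace ℝ (Fin N) → ℝ) (x : EuclideanSpace ℝ (Fin N)) :
    tangentialInner x (gradient u x) (gradient (polyFun q) x) =
      ∑ i, polyFun (tangentialField q k i) x * fderiv ℝ u x (EuclideanSpace.single i 1) := by
  rw [tangentialInner, inner_gradient_polyFun hq, inner_eq_sum, inner_eq_sum, Finset.mul_sum,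
    Finset.sum_mul, ← Finset.sum_sub_distrib]
  refine Finset.sum_congr rfl fun i _ => ?_
  rw [polyFun_tangentialField, gradient_polyFun_apply, gradient_apply]
  ring

/-- Green's formula on the unit sphere against a harmonic homogeneous polynomial. -/
lemma green_sphere (hN : 0 < N) {q : MvPolynomial (Fin N) ℝ} {k : ℕ}
    (hq : q ∈ harmonicPolynomials N k) {u : EuclideanSpace ℝ (Fin N) → ℝ} (hu : ContDiff ℝ 1 u) :
    ∫ θ : UnitSphere N, tangentialInner θ.1 (gradient u θ) (gradient (polyFun q) θ)
      ∂surfaceMeasure N =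
    sphereEigenvalue N k * ∫ θ : UnitSphere N, u θ * polyFun q θ ∂surfaceMeasure N := by
  have hh : q.IsHomogeneous k := hq.1
  have hc : ∀ v, Continuous fun x => fderiv ℝ u x v := fun v =>
    (hu.continuous_fderiv one_ne_zero).clm_apply continuous_const
  set A : EuclideanSpace ℝ (Fin N) → ℝ := fun x =>
    ∑ i, polyFun (tangentialField q k i) x * fderiv ℝ u x (EuclideanSpace.single i 1) with hA
  have hAc : Continuous A :=
    continuous_finsetSum _ fun i _ => (continuous_polyFun _).mul (hc _)
  set B : EuclideanSpace ℝ (Fin N) → ℝ := fun x => u x * polyFun q x with hB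
  have hBc : Continuous B := hu.continuous.mul (continuous_polyFun _)
  have key := integral_sphere_eq_zero_of_radial hN (J := fun x => A x - sphereEigenvalue N k * B x)
    (hAc.sub (continuous_const.mul hBc)) ?_ one_pos
  · simp only [one_smul] at key
    rw [integral_sub (integrable_sphere_coe hAc) ((integrable_sphere_coe hBc).const_mul _),
      integral_const_mul, sub_eq_zero] at key
    rw [← key]
    exact integral_congr_ae (ae_of_all _ fun θ => tangentialInner_gradient_polyFun hh u θ.1)
  · rintro ψ hψ ⟨ε, hε, hz⟩ ⟨R, hR⟩
    have hg := contDiff_comp_norm (N := N) hψ hε hz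
    have hgs := hasCompactSupport_comp_norm (N := N) hR
    have hg1 : ContDiff ℝ 1 fun x : EuclideanSpace ℝ (Fin N) => ψ ‖x‖ := hg.of_le (by simp)
    have h1 := integral_fderiv_field hu
      (X := fun i x => ψ ‖x‖ * polyFun (tangentialField q k i) x)
      (fun i => hg1.mul (contDiff_polyFun _)) (fun i => hgs.mul_right)
    have h2 : ∀ x, ∑ i, ψ ‖x‖ * polyFun (tangentialField q k i) x *
        fderiv ℝ u x (EuclideanSpace.single i 1) = ψ ‖x‖ * A x := fun x => by
      rw [hA, Finset.mul_sum]; exact Finset.sum_congr rfl fun i _ => by ring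
    have h3 : ∀ x, ∑ i, fderiv ℝ (fun x => ψ ‖x‖ * polyFun (tangentialField q k i) x) x
        (EuclideanSpace.single i 1) = - (ψ ‖x‖ * (sphereEigenvalue N k * polyFun q x)) := fun x => by
      have h4 : ∀ i, fderiv ℝ (fun x => ψ ‖x‖ * polyFun (tangentialField q k i) x) x
          (EuclideanSpace.single i 1) = ψ ‖x‖ * polyFun (pderiv i (tangentialField q k i)) x +
            (deriv ψ ‖x‖ * ‖x‖⁻¹) * (x i * polyFun (tangentialField q k i) x) := fun i => by
        rw [fderiv_fun_mul (hg1.differentiable one_ne_zero x) (differentiable_polyFun _ x)]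
        simp only [add_apply, smul_apply, smul_eq_mul, fderiv_polyFun_single,
          fderiv_comp_norm_apply hψ hε hz, EuclideanSpace.inner_single_right]
        simp
        ring
      simp only [h4, Finset.sum_add_distrib, ← Finset.mul_sum, sum_mul_tangentialField hh,
        div_tangentialField hq]
      ring
    simp only [h2, h3] at h1
    simp only [mul_sub]
    have i1 : Integrable fun x => ψ ‖x‖ * A x :=
      (hg.continuous.mul hAc).integrable_of_hasCompactSupport hgs.mul_right
    have i2 : Integrable fun x => ψ ‖x‖ * (sphereEigenvalue N k * B x) :=
      (hg.continuous.mul (continuous_const.mul hBc)).integrable_of_hasCompactSupport hgs.mul_right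
    rw [integral_sub i1 i2, h1, sub_eq_zero, ← integral_neg]
    refine integral_congr_ae (ae_of_all _ fun x => ?_)
    simp only [hB]
    ring

end Green

/-! ### Spherical harmonics -/

section SphericalHarmonics

open MvPolynomial

variable {N : ℕ}

lemma sphereEigenvalue_mono (hN : 2 ≤ N) {k l : ℕ} (h : k ≤ l) :
    sphereEigenvalue N k ≤ sphereEigenvalue N l := by
  have h1 : (k : ℝ) ≤ l := by exact_mod_cast h
  have h2 : (2 : ℝ) ≤ N := by exact_mod_cast hN
  have h3 : (0 : ℝ) ≤ k := Nat.cast_nonneg k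
  unfold sphereEigenvalue
  exact mul_le_mul h1 (by linarith) (by linarith) (by linarith)

lemma sphereEigenvalue_nonneg (hN : 2 ≤ N) (k : ℕ) : 0 ≤ sphereEigenvalue N k := by
  have := sphereEigenvalue_mono hN (Nat.zero_le k)
  simpa [sphereEigenvalue] using this

lemma sphereEigenvalue_injective (hN : 2 ≤ N) : Function.Injective (sphereEigenvalue N) := by
  intro k l h
  by_contra hkl
  have h2 : (2 : ℝ) ≤ N := by exact_mod_cast hN
  have h3 : (1 : ℝ) ≤ k + l := by exact_mod_cast (show 1 ≤ k + l by omega)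
  have h4 : ((k : ℝ) - l) * (k + l + N - 2) = 0 := by
    unfold sphereEigenvalue at h; linear_combination h
  rcases mul_eq_zero.1 h4 with h5 | h5
  · exact hkl (by exact_mod_cast sub_eq_zero.1 h5)
  · linarith

/-- Harmonics of different degrees are orthogonal, being eigenfunctions for different eigenvalues. -/
lemma integral_harmonic_mul_eq_zero (hN : 2 ≤ N) {k l : ℕ} (hkl : k ≠ l)
    {p q : MvPolynomial (Fin N) ℝ} (hp : p ∈ harmonicPolynomials N k)
    (hq : q ∈ harmonicPolynomials N l) :
    ∫ θ : UnitSphere N, polyFun p θ * polyFun q θ ∂surfaceMeasure N = 0 := by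
  have h1 := green_sphere (by omega) hq (contDiff_polyFun p)
  have h2 := green_sphere (by omega) hp (contDiff_polyFun q)
  have h3 : ∀ x g h : EuclideanSpace ℝ (Fin N), tangentialInner x g h = tangentialInner x h g :=
    fun x g h => by rw [tangentialInner, tangentialInner, real_inner_comm]; ring
  simp only [mul_comm (polyFun q _)] at h2
  simp only [h3 _ (gradient (polyFun q) _), h1] at h2
  have h4 := sub_eq_zero.2 h2
  rw [← sub_mul] at h4
  exact (mul_eq_zero.1 h4).resolve_left
    (sub_ne_zero.2 fun h => hkl (sphereEigenvalue_injective hN h).symm)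

/-- A homogeneous polynomial vanishing on the unit sphere vanishes. -/
lemma eq_zero_of_integral_sq_eq_zero (hN : 0 < N) {k : ℕ} {q : MvPolynomial (Fin N) ℝ}
    (hq : q.IsHomogeneous k)
    (h : ∫ θ : UnitSphere N, polyFun q θ * polyFun q θ ∂surfaceMeasure N = 0) : q = 0 := by
  have hc : Continuous fun θ : UnitSphere N => polyFun q θ * polyFun q θ :=
    ((continuous_polyFun q).mul (continuous_polyFun q)).comp continuous_subtype_val
  have h1 := (integral_eq_zero_iff_of_nonneg (fun θ => mul_self_nonneg _) (integrable_sphere hc)).1 h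
  have h2 := (hc.ae_eq_iff_eq (surfaceMeasure N) continuous_zero).1 h1
  refine MvPolynomial.funext fun y => ?_
  have h3 : polyFun q (WithLp.toLp 2 y) = 0 := by
    by_cases hy : WithLp.toLp 2 y = 0
    · obtain ⟨θ⟩ : Nonempty (UnitSphere N) := by
        have : Nonempty (Fin N) := ⟨⟨0, hN⟩⟩
        exact (NormedSpace.sphere_nonempty.2 zero_le_one).to_subtype
      have h5 : polyFun q θ = 0 := mul_self_eq_zero.1 (congrFun h2 θ)
      rw [hy]
      rw [← zero_smul ℝ θ.1, polyFun_smul_arg hq, h5, mul_zero]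
    · have hn := norm_ne_zero_iff.2 hy
      have h4 := congrFun h2 ⟨‖WithLp.toLp 2 y‖⁻¹ • WithLp.toLp 2 y, by simp [norm_smul, hn]⟩
      have h5 := mul_self_eq_zero.1 h4
      rw [polyFun_smul_arg hq] at h5
      exact (mul_eq_zero.1 h5).resolve_left (pow_ne_zero _ (inv_ne_zero hn))
  simpa [polyFun] using h3

/-- An `L²(S)`-orthonormal basis of `Φ_k`, from the inner product that `L²(S)` induces on `Φ_k`. -/
lemma exists_orthonormal_harmonic (hN : 0 < N) (k : ℕ) :
    ∃ Y : Fin (Module.finrank ℝ (harmonicPolynomials N k)) → MvPolynomial (Fin N) ℝ,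
      (∀ i, Y i ∈ harmonicPolynomials N k) ∧
      (∀ i j, ∫ θ : UnitSphere N, polyFun (Y i) θ * polyFun (Y j) θ ∂surfaceMeasure N =
        if i = j then 1 else 0) ∧
      ∀ q ∈ harmonicPolynomials N k, ∃ b : Fin (Module.finrank ℝ (harmonicPolynomials N k)) → ℝ,
        q = ∑ i, b i • Y i := by
  have hint : ∀ p q : MvPolynomial (Fin N) ℝ, Integrable
      (fun θ : UnitSphere N => polyFun p θ * polyFun q θ) (surfaceMeasure N) := fun p q =>
    integrable_sphere_coe ((continuous_polyFun p).mul (continuous_polyFun q))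
  let core : InnerProductSpace.Core ℝ (harmonicPolynomials N k) :=
    { inner := fun p q => ∫ θ : UnitSphere N, polyFun p.1 θ * polyFun q.1 θ ∂surfaceMeasure N
      conj_inner_symm := fun p q => by simp only [mul_comm]; rfl
      re_inner_nonneg := fun p => integral_nonneg fun θ => mul_self_nonneg _
      add_left := fun p q r => by
        simp only [Submodule.coe_add, polyFun_add, add_mul]
        exact integral_add (hint _ _) (hint _ _)
      smul_left := fun p q r => by
        simp only [Submodule.coe_smul, polyFun_smul, mul_assoc, integral_const_mul]
        rfl
      definite := fun p hp => Subtype.ext (eq_zero_of_integral_sq_eq_zero hN p.2.1 hp) }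
  let _ : NormedAddCommGroup (harmonicPolynomials N k) := core.toNormedAddCommGroup
  let _ : InnerProductSpace ℝ (harmonicPolynomials N k) := InnerProductSpace.ofCore core.toCore
  let b := stdOrthonormalBasis ℝ (harmonicPolynomials N k)
  refine ⟨fun i => (b i).1, fun i => (b i).2, fun i j => ?_, fun q hq => ?_⟩
  · exact orthonormal_iff_ite.1 b.orthonormal i j
  · refine ⟨fun i => b.repr ⟨q, hq⟩ i, ?_⟩
    have h := congrArg Subtype.val (b.sum_repr ⟨q, hq⟩)
    rw [AddSubmonoidClass.coe_finsetSum] at h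
    exact h.symm

/-- Indices of an orthonormal system of spherical harmonics: a degree `k`, and a number below
`dim Φ_k`. -/
abbrev HarmIdx (N : ℕ) : Type := Σ k : ℕ, Fin (Module.finrank ℝ (harmonicPolynomials N k))

/-- The indices of degree less than `n`. -/
def harmIdx (N n : ℕ) : Finset (HarmIdx N) := (Finset.range n).sigma fun _ => Finset.univ

lemma mem_harmIdx {n : ℕ} {a : HarmIdx N} : a ∈ harmIdx N n ↔ a.1 < n := by
  simp [harmIdx]

lemma harmIdx_mono {m n : ℕ} (h : m ≤ n) : harmIdx N m ⊆ harmIdx N n := fun _ ha =>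
  mem_harmIdx.2 ((mem_harmIdx.1 ha).trans_le h)

lemma card_harmIdx (n : ℕ) : (harmIdx N n).card =
    ∑ k ∈ Finset.range n, Module.finrank ℝ (harmonicPolynomials N k) := by
  simp [harmIdx, Finset.card_sigma]

/-- `Y` consists, in each degree `k`, of a basis of `Φ_k` that is orthonormal in `L²` of the unit
sphere; polynomials of different degrees are orthogonal as well. -/
structure IsHarmonicBasis (Y : HarmIdx N → MvPolynomial (Fin N) ℝ) : Prop where
  mem (a : HarmIdx N) : Y a ∈ harmonicPolynomials N a.1
  orthonormal : ∀ a b, ∫ θ : UnitSphere N, polyFun (Y a) θ * polyFun (Y b) θ ∂surfaceMeasure N =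
    if a = b then 1 else 0
  expansion : ∀ k, ∀ q ∈ harmonicPolynomials N k, ∃ c : HarmIdx N → ℝ,
    q = ∑ i, c ⟨k, i⟩ • Y ⟨k, i⟩

lemma exists_isHarmonicBasis (hN : 2 ≤ N) :
    ∃ Y : HarmIdx N → MvPolynomial (Fin N) ℝ, IsHarmonicBasis Y := by
  choose Y hY ho hs using fun k => exists_orthonormal_harmonic (N := N) (by omega) k
  refine ⟨fun a => Y a.1 a.2, fun a => hY a.1 a.2, ?_, fun k q hq => ?_⟩
  · rintro ⟨k, i⟩ ⟨l, j⟩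
    by_cases hkl : k = l
    · subst hkl
      rw [ho k i j]
      simp
    · rw [integral_harmonic_mul_eq_zero hN hkl (hY k i) (hY l j), if_neg]
      intro h; exact hkl (congrArg Sigma.fst h)
  · obtain ⟨b, hb⟩ := hs k q hq
    exact ⟨fun a => if h : a.1 = k then b (h ▸ a.2) else 0, by simpa using hb⟩

variable {Y : HarmIdx N → MvPolynomial (Fin N) ℝ}

/-- The linear combination `∑ a ∈ s, c_a Y_a`. -/
def harmSum (Y : HarmIdx N → MvPolynomial (Fin N) ℝ) (s : Finset (HarmIdx N))
    (c : HarmIdx N → ℝ) : MvPolynomial (Fin N) ℝ := ∑ a ∈ s, c a • Y a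

lemma polyFun_harmSum (s : Finset (HarmIdx N)) (c : HarmIdx N → ℝ) (x) :
    polyFun (harmSum Y s c) x = ∑ a ∈ s, c a * polyFun (Y a) x := by
  simp only [harmSum, polyFun_sum, polyFun_smul]

/-- The coefficient `∫_S u Y_a` of `u` along `Y_a`. -/
def harmCoeff (Y : HarmIdx N → MvPolynomial (Fin N) ℝ) (u : EuclideanSpace ℝ (Fin N) → ℝ)
    (a : HarmIdx N) : ℝ :=
  ∫ θ : UnitSphere N, u θ * polyFun (Y a) θ ∂surfaceMeasure N

lemma integral_mul_harmSum {u : EuclideanSpace ℝ (Fin N) → ℝ}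
    (hu : Continuous fun θ : UnitSphere N => u θ) (s : Finset (HarmIdx N)) (c : HarmIdx N → ℝ) :
    ∫ θ : UnitSphere N, u θ * polyFun (harmSum Y s c) θ ∂surfaceMeasure N =
      ∑ a ∈ s, c a * harmCoeff Y u a := by
  have hi : ∀ a, Integrable (fun θ : UnitSphere N => u θ * (c a * polyFun (Y a) θ))
      (surfaceMeasure N) := fun a => integrable_sphere (hu.mul (continuous_const.mul
        ((continuous_polyFun (Y a)).comp continuous_subtype_val)))
  simp only [polyFun_harmSum, Finset.mul_sum]
  rw [integral_finsetSum _ fun a _ => hi a]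
  refine Finset.sum_congr rfl fun a _ => ?_
  rw [harmCoeff, ← integral_const_mul]
  exact integral_congr_ae (ae_of_all _ fun θ => by ring)

lemma harmCoeff_harmSum (hY : IsHarmonicBasis Y) (s : Finset (HarmIdx N)) (c : HarmIdx N → ℝ)
    {a : HarmIdx N} (ha : a ∈ s) : harmCoeff Y (polyFun (harmSum Y s c)) a = c a := by
  have h := integral_mul_harmSum (Y := Y) (u := polyFun (Y a))
    ((continuous_polyFun _).comp continuous_subtype_val) s c
  simp only [harmCoeff, mul_comm (polyFun (harmSum Y s c) _)]
  rw [h, Finset.sum_eq_single_of_mem a ha]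
  · rw [harmCoeff, hY.orthonormal, if_pos rfl, mul_one]
  · intro b _ hb; rw [harmCoeff, hY.orthonormal, if_neg hb.symm, mul_zero]

lemma integral_sub_two_mul_add {X : Type*} [MeasurableSpace X] {μ : Measure X} {f g h : X → ℝ}
    (hf : Integrable f μ) (hg : Integrable g μ) (hh : Integrable h μ) :
    ∫ x, (f x - 2 * g x + h x) ∂μ = ∫ x, f x ∂μ - 2 * ∫ x, g x ∂μ + ∫ x, h x ∂μ := by
  have h2 : Integrable (fun x => f x - 2 * g x) μ := hf.sub (hg.const_mul 2)
  rw [integral_add h2 hh, integral_sub hf (hg.const_mul 2), integral_const_mul]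

/-- Parseval's identity for the difference of `u` and a finite combination of harmonics. -/
lemma integral_sub_harmSum_sq (hY : IsHarmonicBasis Y) {u : EuclideanSpace ℝ (Fin N) → ℝ}
    (hu : Continuous fun θ : UnitSphere N => u θ) (s : Finset (HarmIdx N)) (c : HarmIdx N → ℝ) :
    ∫ θ : UnitSphere N, (u θ - polyFun (harmSum Y s c) θ) ^ 2 ∂surfaceMeasure N =
      ∫ θ : UnitSphere N, u θ ^ 2 ∂surfaceMeasure N - ∑ a ∈ s, harmCoeff Y u a ^ 2
        + ∑ a ∈ s, (c a - harmCoeff Y u a) ^ 2 := by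
  have hP : Continuous fun θ : UnitSphere N => polyFun (harmSum Y s c) θ :=
    (continuous_polyFun _).comp continuous_subtype_val
  have h1 := integral_mul_harmSum (Y := Y) hu s c
  have h2 := integral_mul_harmSum (Y := Y) hP s c
  have e : ∀ θ : UnitSphere N, (u θ - polyFun (harmSum Y s c) θ) ^ 2 =
      u θ ^ 2 - 2 * (u θ * polyFun (harmSum Y s c) θ)
        + polyFun (harmSum Y s c) θ * polyFun (harmSum Y s c) θ := fun θ => by ring
  have h3 : ∑ a ∈ s, c a * harmCoeff Y (polyFun (harmSum Y s c)) a = ∑ a ∈ s, c a * c a :=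
    Finset.sum_congr rfl fun a ha => by rw [harmCoeff_harmSum hY s c ha]
  have i1 : Integrable (fun θ : UnitSphere N => u θ ^ 2) (surfaceMeasure N) :=
    integrable_sphere (hu.pow 2)
  have i2 : Integrable (fun θ : UnitSphere N => u θ * polyFun (harmSum Y s c) θ)
    (surfaceMeasure N) := integrable_sphere (hu.mul hP)
  have i3 : Integrable (fun θ : UnitSphere N => polyFun (harmSum Y s c) θ *
    polyFun (harmSum Y s c) θ) (surfaceMeasure N) := integrable_sphere (hP.mul hP)
  simp only [e]
  rw [integral_sub_two_mul_add i1 i2 i3, h1, h2, h3, sub_add, sub_add]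
  congr 1
  rw [Finset.mul_sum, ← Finset.sum_sub_distrib, ← Finset.sum_sub_distrib]
  exact Finset.sum_congr rfl fun a _ => by ring

/-- Bessel's inequality. -/
lemma sum_harmCoeff_sq_le (hY : IsHarmonicBasis Y) {u : EuclideanSpace ℝ (Fin N) → ℝ}
    (hu : Continuous fun θ : UnitSphere N => u θ) (s : Finset (HarmIdx N)) :
    ∑ a ∈ s, harmCoeff Y u a ^ 2 ≤ ∫ θ : UnitSphere N, u θ ^ 2 ∂surfaceMeasure N := by
  have h := integral_sub_harmSum_sq hY hu s (harmCoeff Y u)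
  have h0 : 0 ≤ ∫ θ : UnitSphere N, (u θ - polyFun (harmSum Y s (harmCoeff Y u)) θ) ^ 2
    ∂surfaceMeasure N := integral_nonneg fun θ => sq_nonneg _
  simp only [sub_self, ne_eq, OfNat.ofNat_ne_zero, not_false_eq_true, zero_pow,
    Finset.sum_const_zero, add_zero] at h
  linarith

/-- Stone–Weierstrass on the sphere. -/
lemma exists_polyFun_near {u : EuclideanSpace ℝ (Fin N) → ℝ}
    (hu : Continuous fun θ : UnitSphere N => u θ) {ε : ℝ} (hε : 0 < ε) :
    ∃ q : MvPolynomial (Fin N) ℝ, ∀ θ : UnitSphere N, |polyFun q θ - u θ| < ε := by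
  let X : Fin N → C(UnitSphere N, ℝ) := fun i => ⟨fun θ => θ.1 i, by fun_prop⟩
  have hX : ∀ (q : MvPolynomial (Fin N) ℝ) (θ : UnitSphere N), aeval X q θ = polyFun q θ := by
    intro q θ
    induction q using MvPolynomial.induction_on with
    | C a => simp [polyFun]
    | add p q hp hq => rw [map_add, ContinuousMap.add_apply, hp, hq, polyFun_add]
    | mul_X p i hp =>
      rw [map_mul, ContinuousMap.mul_apply, hp, polyFun_mul, aeval_X, polyFun_X]; rfl
  have hsep : (aeval X : MvPolynomial (Fin N) ℝ →ₐ[ℝ] C(UnitSphere N, ℝ)).range.SeparatesPoints := by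
    intro θ θ' hne
    obtain ⟨i, hi⟩ : ∃ i, θ.1 i ≠ θ'.1 i := by
      by_contra h
      push Not at h
      exact hne (Subtype.ext (by ext i; exact h i))
    exact ⟨X i, ⟨X i, ⟨MvPolynomial.X i, aeval_X _ _⟩, rfl⟩, hi⟩
  obtain ⟨⟨g, q, rfl⟩, hg⟩ := ContinuousMap.exists_mem_subalgebra_near_continuous_of_separatesPoints
    _ hsep (fun θ : UnitSphere N => u θ) hu ε hε
  refine ⟨q, fun θ => ?_⟩
  have := hg θ
  rw [Real.norm_eq_abs] at this
  rw [← hX]; exact this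

/-- Completeness of the spherical harmonics. -/
lemma integral_sq_le_sum_harmCoeff_sq (hN : 0 < N) (hY : IsHarmonicBasis Y)
    {u : EuclideanSpace ℝ (Fin N) → ℝ} (hu : Continuous fun θ : UnitSphere N => u θ)
    {ε : ℝ} (hε : 0 < ε) :
    ∃ n, ∀ m, n ≤ m → ∫ θ : UnitSphere N, u θ ^ 2 ∂surfaceMeasure N ≤
      ∑ a ∈ harmIdx N m, harmCoeff Y u a ^ 2 + ε := by
  set V : ℝ := (surfaceMeasure N).real Set.univ with hV
  have hV0 : 0 ≤ V := measureReal_nonneg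
  have hδ : 0 < √(ε / (V + 1)) := Real.sqrt_pos.2 (by positivity)
  obtain ⟨q, hq⟩ := exists_polyFun_near hu hδ
  obtain ⟨n, h, hh, hs⟩ := exists_harmonic_sum hN q
  choose c hc using fun k => hY.expansion k (h k) (hh k)
  refine ⟨n, fun m hm => ?_⟩
  have hq' : ∀ θ : UnitSphere N,
      polyFun (harmSum Y (harmIdx N m) fun a => c a.1 a) θ = polyFun q θ := fun θ => by
    have h1 := hs (fun i => θ.1 i)
      (by rw [← EuclideanSpace.real_norm_sq_eq, norm_coe_unitSphere, one_pow]) m hm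
    change polyFun q θ = ∑ j ∈ Finset.range m, polyFun (h j) θ at h1
    rw [h1, polyFun_harmSum, harmIdx, Finset.sum_sigma]
    refine Finset.sum_congr rfl fun k _ => ?_
    conv_rhs => rw [hc k, polyFun_sum]
    exact Finset.sum_congr rfl fun i _ => (polyFun_smul _ _ _).symm
  have h1 := integral_sub_harmSum_sq hY hu (harmIdx N m) (fun a => c a.1 a)
  have h2 : 0 ≤ ∑ a ∈ harmIdx N m, (c a.1 a - harmCoeff Y u a) ^ 2 :=
    Finset.sum_nonneg fun _ _ => sq_nonneg _
  have h3 : ∫ θ : UnitSphere N, (u θ - polyFun (harmSum Y (harmIdx N m) fun a => c a.1 a) θ) ^ 2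
      ∂surfaceMeasure N ≤ ∫ _ : UnitSphere N, ε / (V + 1) ∂surfaceMeasure N := by
    refine integral_mono (integrable_sphere ?_) (integrable_const _) fun θ => ?_
    · exact (hu.sub ((continuous_polyFun _).comp continuous_subtype_val)).pow 2
    · simp only [hq']
      rw [← Real.sq_sqrt (show 0 ≤ ε / (V + 1) by positivity), ← sq_abs, abs_sub_comm]
      exact pow_le_pow_left₀ (abs_nonneg _) (hq θ).le 2
  rw [integral_const, ← hV, smul_eq_mul] at h3
  have h4 : V * (ε / (V + 1)) ≤ ε := by
    rw [mul_div_assoc', div_le_iff₀ (by positivity)]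
    nlinarith
  linarith

lemma tangentialInner_self_nonneg (x g : EuclideanSpace ℝ (Fin N)) :
    0 ≤ tangentialInner x g g := by
  have h := real_inner_mul_inner_self_le x g
  rw [real_inner_self_eq_norm_sq] at h
  unfold tangentialInner
  linarith

lemma tangentialInner_sub_self (x g h : EuclideanSpace ℝ (Fin N)) :
    tangentialInner x (g - h) (g - h) =
      tangentialInner x g g - 2 * tangentialInner x g h + tangentialInner x h h := by
  unfold tangentialInner
  simp only [inner_sub_left, inner_sub_right, real_inner_comm g h]
  ring

lemma gradient_harmSum (s : Finset (HarmIdx N)) (c : HarmIdx N → ℝ)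
    (x : EuclideanSpace ℝ (Fin N)) :
    gradient (polyFun (harmSum Y s c)) x = ∑ a ∈ s, c a • gradient (polyFun (Y a)) x := by
  ext i
  rw [gradient_polyFun_apply, harmSum, map_sum, polyFun_sum]
  simp only [WithLp.ofLp_sum, Finset.sum_apply, PiLp.smul_apply, gradient_polyFun_apply,
    Derivation.map_smul, polyFun_smul, smul_eq_mul]

lemma tangentialInner_sum_right (s : Finset (HarmIdx N)) (c : HarmIdx N → ℝ)
    (x g : EuclideanSpace ℝ (Fin N)) (f : HarmIdx N → EuclideanSpace ℝ (Fin N)) :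
    tangentialInner x g (∑ a ∈ s, c a • f a) = ∑ a ∈ s, c a * tangentialInner x g (f a) := by
  unfold tangentialInner
  simp only [inner_sum, inner_smul_right, Finset.mul_sum, ← Finset.sum_sub_distrib]
  exact Finset.sum_congr rfl fun a _ => by ring

lemma continuous_tangentialInner {f g : EuclideanSpace ℝ (Fin N) → EuclideanSpace ℝ (Fin N)}
    (hf : Continuous f) (hg : Continuous g) : Continuous fun x => tangentialInner x (f x) (g x) := by
  unfold tangentialInner
  fun_prop

lemma continuous_gradient {u : EuclideanSpace ℝ (Fin N) → ℝ} (hu : ContDiff ℝ 1 u) :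
    Continuous (gradient u) := by
  unfold gradient
  exact (LinearIsometryEquiv.continuous _).comp (hu.continuous_fderiv one_ne_zero)

lemma green_harmSum (hN : 0 < N) (hY : IsHarmonicBasis Y) {u : EuclideanSpace ℝ (Fin N) → ℝ}
    (hu : ContDiff ℝ 1 u) (s : Finset (HarmIdx N)) (c : HarmIdx N → ℝ) :
    ∫ θ : UnitSphere N, tangentialInner θ.1 (gradient u θ) (gradient (polyFun (harmSum Y s c)) θ)
      ∂surfaceMeasure N = ∑ a ∈ s, c a * (sphereEigenvalue N a.1 * harmCoeff Y u a) := by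
  simp only [gradient_harmSum, tangentialInner_sum_right]
  rw [integral_finsetSum]
  · refine Finset.sum_congr rfl fun a _ => ?_
    rw [integral_const_mul, green_sphere hN (hY.mem a) hu, harmCoeff]
  · intro a _
    exact (integrable_sphere_coe (continuous_tangentialInner (continuous_gradient hu)
      (continuous_gradient (contDiff_polyFun _)))).const_mul _

lemma integral_tangentialInner_harmSum (hN : 0 < N) (hY : IsHarmonicBasis Y)
    (s : Finset (HarmIdx N)) (c : HarmIdx N → ℝ) :
    ∫ θ : UnitSphere N, tangentialInner θ.1 (gradient (polyFun (harmSum Y s c)) θ)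
      (gradient (polyFun (harmSum Y s c)) θ) ∂surfaceMeasure N =
      ∑ a ∈ s, sphereEigenvalue N a.1 * c a ^ 2 := by
  rw [green_harmSum hN hY (contDiff_polyFun _)]
  refine Finset.sum_congr rfl fun a ha => ?_
  rw [harmCoeff_harmSum hY s c ha]
  ring

/-- Bessel's inequality for the Dirichlet form of the sphere: the form is nonnegative at the
difference of `u` and its projection, and the cross term is given by Green's formula. -/
lemma sum_eigenvalue_harmCoeff_sq_le (hN : 0 < N) (hY : IsHarmonicBasis Y)
    {u : EuclideanSpace ℝ (Fin N) → ℝ} (hu : ContDiff ℝ 1 u) (s : Finset (HarmIdx N)) :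
    ∑ a ∈ s, sphereEigenvalue N a.1 * harmCoeff Y u a ^ 2 ≤
      ∫ θ : UnitSphere N, tangentialInner θ.1 (gradient u θ) (gradient u θ) ∂surfaceMeasure N := by
  set P := harmSum Y s (harmCoeff Y u) with hP
  have hgu := continuous_gradient hu
  have hgP := continuous_gradient (contDiff_polyFun P (n := 1))
  have h0 : 0 ≤ ∫ θ : UnitSphere N, tangentialInner θ.1 (gradient u θ - gradient (polyFun P) θ)
      (gradient u θ - gradient (polyFun P) θ) ∂surfaceMeasure N :=
    integral_nonneg fun θ => tangentialInner_self_nonneg _ _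
  have i1 := integrable_sphere_coe (continuous_tangentialInner hgu hgu)
  have i2 := integrable_sphere_coe (continuous_tangentialInner hgu hgP)
  have i3 := integrable_sphere_coe (continuous_tangentialInner hgP hgP)
  simp only [tangentialInner_sub_self] at h0
  rw [integral_sub_two_mul_add i1 i2 i3, integral_tangentialInner_harmSum hN hY, green_harmSum hN hY hu] at h0
  have e : ∑ a ∈ s, harmCoeff Y u a * (sphereEigenvalue N a.1 * harmCoeff Y u a) =
      ∑ a ∈ s, sphereEigenvalue N a.1 * harmCoeff Y u a ^ 2 :=
    Finset.sum_congr rfl fun a _ => by ring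
  rw [e] at h0
  linarith

/-- Spectral gap of the Laplace–Beltrami operator: on the orthogonal complement of the harmonics of
degree `< k` the tangential Dirichlet form is at least `k(k+N-2)` times the `L²` norm. -/
lemma sphereEigenvalue_mul_le (hN : 2 ≤ N) (hY : IsHarmonicBasis Y)
    {u : EuclideanSpace ℝ (Fin N) → ℝ} (hu : ContDiff ℝ 1 u) (k : ℕ) :
    sphereEigenvalue N k * (∫ θ : UnitSphere N, u θ ^ 2 ∂surfaceMeasure N
        - ∑ a ∈ harmIdx N k, harmCoeff Y u a ^ 2) ≤
      ∫ θ : UnitSphere N, tangentialInner θ.1 (gradient u θ) (gradient u θ) ∂surfaceMeasure N := by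
  have hl := sphereEigenvalue_nonneg hN k
  -- the harmonics of degree `≥ k` carry all but `ε / (λ_k + 1)` of the remaining mass
  refine le_of_forall_pos_le_add fun ε hε => ?_
  obtain ⟨n, hn⟩ := integral_sq_le_sum_harmCoeff_sq (by omega) hY
    (hu.continuous.comp continuous_subtype_val) (show 0 < ε / (sphereEigenvalue N k + 1) by positivity)
  have h1 := hn (max n k) (le_max_left _ _)
  have hsub : harmIdx N k ⊆ harmIdx N (max n k) := harmIdx_mono (le_max_right _ _)
  have h2 := sum_eigenvalue_harmCoeff_sq_le (by omega) hY hu (harmIdx N (max n k) \ harmIdx N k)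
  have h3 : ∑ a ∈ harmIdx N (max n k) \ harmIdx N k, sphereEigenvalue N k * harmCoeff Y u a ^ 2 ≤
      ∑ a ∈ harmIdx N (max n k) \ harmIdx N k, sphereEigenvalue N a.1 * harmCoeff Y u a ^ 2 := by
    refine Finset.sum_le_sum fun a ha => mul_le_mul_of_nonneg_right ?_ (sq_nonneg _)
    refine sphereEigenvalue_mono hN (not_lt.1 fun h => ?_)
    exact (Finset.mem_sdiff.1 ha).2 (mem_harmIdx.2 h)
  rw [← Finset.mul_sum] at h3
  have h4 := Finset.sum_sdiff (f := fun a => harmCoeff Y u a ^ 2) hsub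
  have h5 : sphereEigenvalue N k * (ε / (sphereEigenvalue N k + 1)) ≤ ε := by
    rw [mul_div_assoc', div_le_iff₀ (by positivity)]
    nlinarith
  calc _ ≤ sphereEigenvalue N k * (∑ a ∈ harmIdx N (max n k) \ harmIdx N k, harmCoeff Y u a ^ 2
        + ε / (sphereEigenvalue N k + 1)) := mul_le_mul_of_nonneg_left (by linarith) hl
    _ ≤ _ := by rw [mul_add]; linarith

end SphericalHarmonics

/-! ### One-dimensional Picone inequalities -/

section Picone

variable {M ψ V H H' K : ℝ → ℝ}

/-- Picone's inequality on an interval. The function `ψ` solves the Riccati equation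
`r (M ψ)' = M (V - ψ²)`, and `H`, `K` play the roles of `∫ f²` and `∫ (f')²` for a family of
functions `f`: the hypothesis `hK` is what `∫ (f' - s f)² ≥ 0` says. -/
lemma picone_interval {s t : ℝ} (hs : 0 < s) (hst : s ≤ t) (hM : ∀ r, 0 < r → 0 ≤ M r)
    (hG : ∀ r ∈ Set.Icc s t, HasDerivAt (fun r => M r * ψ r) (M r * (V r - ψ r ^ 2) / r) r)
    (hH : ∀ r ∈ Set.Icc s t, HasDerivAt H (H' r) r)
    (hK : ∀ r, 0 < r → ∀ c, 0 ≤ K r - c * H' r + c ^ 2 * H r)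
    (hE : IntegrableOn (fun r => M r * r * K r + M r / r * V r * H r) (Set.Ioi 0)) :
    M t * ψ t * H t - M s * ψ s * H s ≤ ∫ r in s..t, (M r * r * K r + M r / r * V r * H r) := by
  have hd : ∀ r ∈ Set.Icc s t, HasDerivAt (fun r => M r * ψ r * H r)
      (M r * (V r - ψ r ^ 2) / r * H r + M r * ψ r * H' r) r := fun r hr => (hG r hr).mul (hH r hr)
  refine intervalIntegral.sub_le_integral_of_hasDeriv_right_of_le hst
    (fun r hr => (hd r hr).continuousAt.continuousWithinAt)
    (fun r hr => (hd r (Set.Ioo_subset_Icc_self hr)).hasDerivWithinAt)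
    (hE.mono_set fun r hr => hs.trans_le hr.1) fun r hr => ?_
  have hr : 0 < r := hs.trans hr.1
  -- the integrand exceeds the derivative of `M ψ H` by the square for `c = ψ / r`
  have h1 := mul_nonneg (mul_nonneg (hM r hr) hr.le) (hK r hr (ψ r / r))
  have h2 : M r * r * K r + M r / r * V r * H r -
      (M r * (V r - ψ r ^ 2) / r * H r + M r * ψ r * H' r) =
      M r * r * (K r - ψ r / r * H' r + (ψ r / r) ^ 2 * H r) := by
    field_simp
    ring
  linarith

lemma integral_Ioi_ge_of_zero {E : ℝ → ℝ} (hE : IntegrableOn E (Set.Ioi 0)) {R : ℝ} (hR : 0 < R)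
    (h : ∀ r, R < r → 0 ≤ E r) : ∫ r in (0 : ℝ)..R, E r ≤ ∫ r in Set.Ioi 0, E r := by
  rw [intervalIntegral.integral_of_le hR.le]
  have h1 : Set.Ioc 0 R ∪ Set.Ioi R = Set.Ioi 0 := Set.Ioc_union_Ioi_eq_Ioi hR.le
  rw [← h1, setIntegral_union (Set.Ioc_disjoint_Ioi le_rfl) measurableSet_Ioi
    (hE.mono_set (h1 ▸ Set.subset_union_left)) (hE.mono_set (h1 ▸ Set.subset_union_right))]
  have := setIntegral_nonneg (μ := volume) measurableSet_Ioi fun r (hr : r ∈ Set.Ioi R) => h r hr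
  linarith

lemma tendsto_integral_left {E : ℝ → ℝ} (hE : IntegrableOn E (Set.Ioi 0)) {t : ℝ} (ht : 0 < t) :
    Tendsto (fun s => ∫ r in s..t, E r) (𝓝[>] 0) (𝓝 (∫ r in (0 : ℝ)..t, E r)) := by
  have h : ContinuousOn (fun s => ∫ r in t..s, E r) (Set.uIcc 0 t) :=
    intervalIntegral.continuousOn_primitive_interval' (b₁ := 0) (b₂ := t)
      ((intervalIntegrable_iff_integrableOn_Ioc_of_le ht.le).2
        (hE.mono_set fun r hr => hr.1)) (by simp)
  rw [Set.uIcc_of_le ht.le] at h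
  have h1 : ContinuousWithinAt (fun s => ∫ r in s..t, E r) (Set.Icc 0 t) 0 := by
    simpa only [Pi.neg_def, ← intervalIntegral.integral_symm] using (h 0 ⟨le_rfl, ht.le⟩).neg
  have h2 : 𝓝[>] (0 : ℝ) = 𝓝[Set.Ioc 0 t] 0 := (nhdsWithin_Ioc_eq_nhdsGT ht).symm
  rw [h2]
  exact h1.tendsto.mono_left (nhdsWithin_mono _ Set.Ioc_subset_Icc_self)

lemma continuousAt_integral_right {E : ℝ → ℝ} (hE : IntegrableOn E (Set.Ioi 0)) {a t : ℝ}
    (ha : 0 ≤ a) (ht : 0 < t) : ContinuousAt (fun s => ∫ r in a..s, E r) t := by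
  set b := max a t + 1
  have hb : IntervalIntegrable E volume 0 b :=
    (intervalIntegrable_iff_integrableOn_Ioc_of_le (by positivity)).2
      (hE.mono_set fun r hr => hr.1)
  have hat : a < b ∧ t < b :=
    ⟨(le_max_left a t).trans_lt (lt_add_one _), (le_max_right a t).trans_lt (lt_add_one _)⟩
  have h : ContinuousOn (fun s => ∫ r in a..s, E r) (Set.uIcc 0 b) :=
    intervalIntegral.continuousOn_primitive_interval' hb
      (by rw [Set.uIcc_of_le (by positivity)]; exact ⟨ha, hat.1.le⟩)
  rw [Set.uIcc_of_le (by positivity)] at h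
  exact h.continuousAt (Icc_mem_nhds ht hat.2)

/-- The energy with a global solution `ψ` of the Riccati equation is nonnegative. The boundary term
at the origin disappears along a sequence, because `M H / r` is integrable. -/
lemma energy_nonneg_of_riccati {A R : ℝ} (hR : 0 < R) (hM : ∀ r, 0 < r → 0 ≤ M r)
    (hψ : ∀ r, 0 < r → ψ r ≤ A)
    (hG : ∀ r, 0 < r → HasDerivAt (fun r => M r * ψ r) (M r * (V r - ψ r ^ 2) / r) r)
    (hH : ∀ r, 0 < r → HasDerivAt H (H' r) r) (hH0 : ∀ r, 0 < r → 0 ≤ H r)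
    (hHR : ∀ r, R ≤ r → H r = 0)
    (hK : ∀ r, 0 < r → ∀ c, 0 ≤ K r - c * H' r + c ^ 2 * H r)
    (hE : IntegrableOn (fun r => M r * r * K r + M r / r * V r * H r) (Set.Ioi 0))
    (hMH : IntegrableOn (fun r => M r / r * H r) (Set.Ioi 0)) :
    0 ≤ ∫ r in Set.Ioi 0, (M r * r * K r + M r / r * V r * H r) := by
  set E : ℝ → ℝ := fun r => M r * r * K r + M r / r * V r * H r with hEdef
  have h1 := integral_Ioi_ge_of_zero hE hR fun r hr => by
    have hr0 := hR.trans hr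
    have h2 := hK r hr0 0
    rw [hEdef]
    simp only [hHR r hr.le]
    have := mul_nonneg (mul_nonneg (hM r hr0) hr0.le) (show 0 ≤ K r by simpa using h2)
    linarith
  by_contra hneg
  push Not at hneg
  set I := ∫ r in (0 : ℝ)..R, E r with hI
  have hI0 : I < 0 := h1.trans_lt hneg
  -- near the origin the boundary term stays away from zero, so that `M H / r ≥ const / r`
  have h3 : ∀ᶠ s in 𝓝[>] (0 : ℝ), ∫ r in s..R, E r < I / 2 :=
    (tendsto_integral_left hE hR).eventually (gt_mem_nhds (by linarith))
  obtain ⟨δ, hδ, hδ'⟩ := mem_nhdsGT_iff_exists_Ioo_subset.1 h3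
  have hδ : 0 < δ := hδ
  set d := min δ R with hd
  have hd0 : 0 < d := lt_min hδ hR
  have h4 : ∀ s ∈ Set.Ioo 0 d, -I / 2 ≤ |A| * (M s * H s) := fun s hs => by
    have h5 : ∫ r in s..R, E r < I / 2 := hδ' ⟨hs.1, hs.2.trans_le (min_le_left _ _)⟩
    have h6 := picone_interval hs.1 (hs.2.trans_le (min_le_right _ _)).le hM
      (fun r hr => hG r (hs.1.trans_le hr.1)) (fun r hr => hH r (hs.1.trans_le hr.1)) hK hE
    rw [hHR R le_rfl, mul_zero, zero_sub] at h6
    have h7 : ψ s * (M s * H s) ≤ |A| * (M s * H s) :=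
      mul_le_mul_of_nonneg_right ((hψ s hs.1).trans (le_abs_self A))
        (mul_nonneg (hM s hs.1) (hH0 s hs.1))
    linarith
  have h8 : IntegrableOn (fun r : ℝ => r⁻¹) (Set.Ioo 0 d) := by
    have h9 : IntegrableOn (fun r => (|A| * (2 / -I)) * (M r / r * H r)) (Set.Ioo 0 d) :=
      (hMH.mono_set fun r hr => hr.1).const_mul _
    refine Integrable.mono' h9 measurable_inv.aestronglyMeasurable ?_
    rw [ae_restrict_iff' measurableSet_Ioo]
    refine ae_of_all _ fun r hr => ?_
    have hr0 := hr.1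
    rw [Real.norm_of_nonneg (inv_nonneg.2 hr0.le)]
    have h10 := mul_le_mul_of_nonneg_right (h4 r hr)
      (show 0 ≤ 2 / -I * r⁻¹ from mul_nonneg (div_nonneg two_pos.le (by linarith))
        (inv_nonneg.2 hr0.le))
    have h11 : -I / 2 * (2 / -I * r⁻¹) = r⁻¹ := by field_simp [hI0.ne]
    rw [h11] at h10
    refine h10.trans (le_of_eq ?_)
    ring
  have h12 := (intervalIntegrable_iff_integrableOn_Ioo_of_le hd0.le).2 h8
  rw [intervalIntegrable_inv_iff] at h12
  rcases h12 with h12 | h12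
  · exact hd0.ne h12
  · exact h12 (by simp)

/-- The energy is nonnegative on functions vanishing at the simple pole `r₀` of a solution `ψ` of
the Riccati equation that is nonpositive to the left of `r₀`. -/
lemma energy_nonneg_of_riccati_pole {r₀ R c₀ : ℝ} (hr₀ : 0 < r₀) (hR : r₀ < R)
    (hM : ∀ r, 0 < r → 0 ≤ M r) (hψ : ∀ r, 0 < r → r < r₀ → ψ r ≤ 0)
    (hpole : Tendsto (fun r => M r * ψ r * (r - r₀)) (𝓝[≠] r₀) (𝓝 c₀))
    (hG : ∀ r, 0 < r → r ≠ r₀ → HasDerivAt (fun r => M r * ψ r) (M r * (V r - ψ r ^ 2) / r) r)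
    (hH : ∀ r, 0 < r → HasDerivAt H (H' r) r) (hH0 : ∀ r, 0 < r → 0 ≤ H r)
    (hHr₀ : H r₀ = 0) (hHR : ∀ r, R ≤ r → H r = 0)
    (hK : ∀ r, 0 < r → ∀ c, 0 ≤ K r - c * H' r + c ^ 2 * H r)
    (hE : IntegrableOn (fun r => M r * r * K r + M r / r * V r * H r) (Set.Ioi 0)) :
    0 ≤ ∫ r in Set.Ioi 0, (M r * r * K r + M r / r * V r * H r) := by
  set E : ℝ → ℝ := fun r => M r * r * K r + M r / r * V r * H r with hEdef
  have hR0 : 0 < R := hr₀.trans hR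
  have h1 := integral_Ioi_ge_of_zero hE hR0 fun r hr => by
    have hr0 := hR0.trans hr
    have h2 := hK r hr0 0
    rw [hEdef]
    simp only [hHR r hr.le]
    have := mul_nonneg (mul_nonneg (hM r hr0) hr0.le) (show 0 ≤ K r by simpa using h2)
    linarith
  -- `H ≥ 0` has a double zero at `r₀`, which beats the simple pole
  have hH' : H' r₀ = 0 := by
    refine IsLocalMin.hasDerivAt_eq_zero ?_ (hH r₀ hr₀)
    filter_upwards [Ioi_mem_nhds hr₀] with r hr
    rw [hHr₀]; exact hH0 r hr
  have hlim : Tendsto (fun r => M r * ψ r * H r) (𝓝[≠] r₀) (𝓝 0) := by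
    have h3 := (hH r₀ hr₀).tendsto_slope
    rw [hH'] at h3
    have h4 := hpole.mul h3
    rw [mul_zero] at h4
    refine h4.congr' ?_
    filter_upwards [self_mem_nhdsWithin] with r hr
    have hr : r - r₀ ≠ 0 := sub_ne_zero.2 hr
    rw [slope_def_field, hHr₀]
    field_simp
    ring
  have hleft : 0 ≤ ∫ r in (0 : ℝ)..r₀, E r := by
    have h5 : ∀ t ∈ Set.Ioo 0 r₀, M t * ψ t * H t ≤ ∫ r in (0 : ℝ)..t, E r := fun t ht => by
      refine ge_of_tendsto (tendsto_integral_left hE ht.1) ?_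
      filter_upwards [Ioo_mem_nhdsGT ht.1] with s hs
      have h6 := picone_interval hs.1 hs.2.le hM
        (fun r hr => hG r (hs.1.trans_le hr.1) (hr.2.trans_lt ht.2).ne)
        (fun r hr => hH r (hs.1.trans_le hr.1)) hK hE
      have h7 : M s * ψ s * H s ≤ 0 := mul_nonpos_of_nonpos_of_nonneg
        (mul_nonpos_of_nonneg_of_nonpos (hM s hs.1) (hψ s hs.1 (hs.2.trans ht.2))) (hH0 s hs.1)
      linarith
    have h8 : Tendsto (fun t => ∫ r in (0 : ℝ)..t, E r) (𝓝[<] r₀) (𝓝 (∫ r in (0 : ℝ)..r₀, E r)) :=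
      (continuousAt_integral_right hE le_rfl hr₀).tendsto.mono_left nhdsWithin_le_nhds
    refine le_of_tendsto_of_tendsto (hlim.mono_left (nhdsWithin_mono _ fun r (hr : r ∈ Set.Iio r₀) => ne_of_lt hr)) h8 ?_
    filter_upwards [Ioo_mem_nhdsLT hr₀] with t ht using h5 t ht
  have hright : 0 ≤ ∫ r in r₀..R, E r := by
    have h8 : Tendsto (fun t => ∫ r in t..R, E r) (𝓝[>] r₀) (𝓝 (∫ r in r₀..R, E r)) := by
      have h7 : ContinuousAt (fun t => ∫ r in t..R, E r) r₀ := by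
        simpa only [Pi.neg_def, ← intervalIntegral.integral_symm] using
          (continuousAt_integral_right hE hR0.le hr₀).neg
      exact h7.tendsto.mono_left nhdsWithin_le_nhds
    have h9 := (hlim.mono_left (nhdsWithin_mono _ fun r (hr : r ∈ Set.Ioi r₀) => ne_of_gt hr)).neg
    rw [neg_zero] at h9
    refine le_of_tendsto_of_tendsto h9 h8 ?_
    filter_upwards [Ioo_mem_nhdsGT hR] with t ht
    have ht0 := hr₀.trans ht.1
    have h6 := picone_interval ht0 ht.2.le hM
      (fun r hr => hG r (ht0.trans_le hr.1) (ht.1.trans_le hr.1).ne')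
      (fun r hr => hH r (ht0.trans_le hr.1)) hK hE
    rw [hHR R le_rfl] at h6
    linarith
  have h10 : (∫ r in (0 : ℝ)..r₀, E r) + ∫ r in r₀..R, E r = ∫ r in (0 : ℝ)..R, E r := by
    refine intervalIntegral.integral_add_adjacent_intervals ?_ ?_
    · exact (intervalIntegrable_iff_integrableOn_Ioc_of_le hr₀.le).2 (hE.mono_set fun r hr => hr.1)
    · exact (intervalIntegrable_iff_integrableOn_Ioc_of_le hR.le).2
        (hE.mono_set fun r hr => hr₀.trans hr.1)
  linarith

end Picone

/-! ### The radial weight and the explicit solutions of the Riccati equations -/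

section RadialProfile

/-- The function `r^a (1 + r^β)^b` on `(0, ∞)`. -/
def profile (β a b r : ℝ) : ℝ := r ^ a * (1 + r ^ β) ^ b

/-- The function `T(r) = r^β / (1 + r^β)`, increasing from `0` to `1`, with `r T' = β T (1 - T)`. -/
def logisticPow (β r : ℝ) : ℝ := r ^ β / (1 + r ^ β)

lemma one_add_rpow_pos {r : ℝ} (β : ℝ) (hr : 0 < r) : 0 < 1 + r ^ β := by positivity

lemma profile_pos {β a b r : ℝ} (hr : 0 < r) : 0 < profile β a b r := by
  unfold profile; positivity

lemma profile_mul {β a b a' b' r : ℝ} (hr : 0 < r) :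
    profile β a b r * profile β a' b' r = profile β (a + a') (b + b') r := by
  unfold profile
  rw [Real.rpow_add hr, Real.rpow_add (one_add_rpow_pos β hr)]
  ring

lemma profile_rpow {β a b r : ℝ} (hr : 0 < r) (c : ℝ) :
    profile β a b r ^ c = profile β (a * c) (b * c) r := by
  unfold profile
  rw [Real.mul_rpow (by positivity) (by positivity), ← Real.rpow_mul hr.le,
    ← Real.rpow_mul (one_add_rpow_pos β hr).le]

lemma hasDerivAt_profile {β a b r : ℝ} (hr : 0 < r) :
    HasDerivAt (profile β a b) (profile β a b r * (a + b * β * logisticPow β r) / r) r := by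
  have h1 := Real.hasDerivAt_rpow_const (x := r) (p := a) (Or.inl hr.ne')
  have h2 := (Real.hasDerivAt_rpow_const (x := r) (p := β) (Or.inl hr.ne')).const_add 1
  have h3 := h2.rpow_const (p := b) (Or.inl (one_add_rpow_pos β hr).ne')
  refine (h1.mul h3).congr_deriv ?_
  have hq := (one_add_rpow_pos β hr).ne'
  rw [Real.rpow_sub_one hr.ne', Real.rpow_sub_one hr.ne', Real.rpow_sub_one hq]
  unfold profile logisticPow
  field_simp

lemma logisticPow_eq_profile (β r : ℝ) : logisticPow β r = profile β β (-1) r := by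
  unfold logisticPow profile
  rw [Real.rpow_neg_one, div_eq_mul_inv]

lemma one_sub_logisticPow {β r : ℝ} (hr : 0 < r) : 1 - logisticPow β r = profile β 0 (-1) r := by
  unfold logisticPow profile
  have hq := (one_add_rpow_pos β hr).ne'
  rw [Real.rpow_neg_one, Real.rpow_zero]
  field_simp
  ring

lemma hasDerivAt_logisticPow {β r : ℝ} (hr : 0 < r) :
    HasDerivAt (logisticPow β) (β * logisticPow β r * (1 - logisticPow β r) / r) r := by
  have h := (hasDerivAt_profile (β := β) (a := β) (b := -1) hr)
  have h' : logisticPow β =ᶠ[𝓝 r] profile β β (-1) := by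
    filter_upwards [Ioi_mem_nhds hr] with s hs using logisticPow_eq_profile β s
  refine (h.congr_of_eventuallyEq h').congr_deriv ?_
  rw [← logisticPow_eq_profile]
  ring

lemma logisticPow_pos {β r : ℝ} (hr : 0 < r) : 0 < logisticPow β r := by
  rw [logisticPow_eq_profile]; exact profile_pos hr

lemma logisticPow_lt_one {β r : ℝ} (hr : 0 < r) : logisticPow β r < 1 := by
  have := one_sub_logisticPow (β := β) hr
  have := profile_pos (β := β) (a := 0) (b := -1) hr
  linarith

lemma logisticPow_strictMonoOn {β : ℝ} (hβ : 0 < β) :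
    StrictMonoOn (logisticPow β) (Set.Ioi 0) := by
  intro r hr s hs h
  have hr : 0 < r := hr
  have hs : 0 < s := hs
  have := Real.rpow_lt_rpow hr.le h hβ
  unfold logisticPow
  rw [div_lt_div_iff₀ (one_add_rpow_pos β hr) (one_add_rpow_pos β hs)]
  nlinarith

end RadialProfile

section Weight

variable {N : ℕ} {p α : ℝ}

/-- The exponent `β = (p + α)/(p - 1)`. -/
def betaExp (p α : ℝ) : ℝ := (p + α) / (p - 1)

/-- The exponent `σ = (N - p)/(p + α)`. -/
def sigmaExp (N : ℕ) (p α : ℝ) : ℝ := ((N : ℝ) - p) / (p + α)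

/-- The function `r ↦ |U_α'(r)|`. -/
def slope (N : ℕ) (p α r : ℝ) : ℝ :=
  bubbleConst N p α * (((N : ℝ) - p) / (p - 1)) *
    profile (betaExp p α) (betaExp p α - 1) (-(sigmaExp N p α + 1)) r

/-- The weight `M(r) = r^(N-2) |U_α'(r)|^(p-2)`. -/
def weight (N : ℕ) (p α r : ℝ) : ℝ := r ^ (N - 2) * slope N p α r ^ (p - 2)

/-- The constant `κ` for which the zeroth-order term of the linearized form is
`-|U_α'|^(p-2) r^(-2) κ T (1 - T) v²`. -/
def potentialConst (N : ℕ) (p α : ℝ) : ℝ := (p * (N + α) - N + p) * (N + α) / (p - 1)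

/-- The function `κ T (1 - T)`. -/
def potential (N : ℕ) (p α r : ℝ) : ℝ :=
  potentialConst N p α * logisticPow (betaExp p α) r * (1 - logisticPow (betaExp p α) r)

/-- The critical value `λ* = ζ(α) (ζ(α) + N - 2)` of the angular eigenvalue. -/
def criticalEigenvalue (N : ℕ) (p α : ℝ) : ℝ := (p + α) / p * (N - 1 + α * (p - 1) / p)

lemma betaExp_pos (hp : 1 < p) (hα : 0 < α) : 0 < betaExp p α :=
  div_pos (by linarith) (by linarith)

lemma bubbleConst_pos (hp : 1 < p) (hpN : p < N) (hα : 0 < α) : 0 < bubbleConst N p α := by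
  unfold bubbleConst
  have : 0 < ((N : ℝ) - p) / (p - 1) := div_pos (by linarith) (by linarith)
  have : 0 < (N : ℝ) + α := by linarith
  positivity

lemma slope_pos (hp : 1 < p) (hpN : p < N) (hα : 0 < α) {r : ℝ} (hr : 0 < r) :
    0 < slope N p α r :=
  mul_pos (mul_pos (bubbleConst_pos hp hpN hα) (div_pos (by linarith) (by linarith)))
    (profile_pos hr)

lemma weight_pos (hp : 1 < p) (hpN : p < N) (hα : 0 < α) {r : ℝ} (hr : 0 < r) :
    0 < weight N p α r :=
  mul_pos (pow_pos hr _) (Real.rpow_pos_of_pos (slope_pos hp hpN hα hr) _)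

/-- Up to a constant factor the weight is a `profile`. -/
lemma exists_weight_eq (hN : 2 ≤ N) (hp : 1 < p) (hpN : p < N) (hα : 0 < α) :
    ∃ c > 0, ∀ r, 0 < r → weight N p α r = c * profile (betaExp p α)
      (N - 2 + (betaExp p α - 1) * (p - 2)) (-(sigmaExp N p α + 1) * (p - 2)) r := by
  have hc : 0 < bubbleConst N p α * (((N : ℝ) - p) / (p - 1)) :=
    mul_pos (bubbleConst_pos hp hpN hα) (div_pos (by linarith) (by linarith))
  refine ⟨(bubbleConst N p α * (((N : ℝ) - p) / (p - 1))) ^ (p - 2), Real.rpow_pos_of_pos hc _,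
    fun r hr => ?_⟩
  unfold weight slope
  rw [Real.mul_rpow hc.le (profile_pos hr).le, profile_rpow hr]
  unfold profile
  rw [Real.rpow_add hr, ← Real.rpow_natCast, Nat.cast_sub hN]
  push_cast
  ring

lemma hasDerivAt_weight (hN : 2 ≤ N) (hp : 1 < p) (hpN : p < N) (hα : 0 < α) {r : ℝ} (hr : 0 < r) :
    HasDerivAt (weight N p α) (weight N p α r * (N - 2 + (α + 1) * (p - 2) / (p - 1)
      - (N + α) * (p - 2) / (p - 1) * logisticPow (betaExp p α) r) / r) r := by
  obtain ⟨c, -, h⟩ := exists_weight_eq hN hp hpN hα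
  have h' : weight N p α =ᶠ[𝓝 r] fun r => c * profile (betaExp p α)
      (N - 2 + (betaExp p α - 1) * (p - 2)) (-(sigmaExp N p α + 1) * (p - 2)) r := by
    filter_upwards [Ioi_mem_nhds hr] with s hs using h s hs
  refine (((hasDerivAt_profile hr).const_mul c).congr_of_eventuallyEq h').congr_deriv ?_
  rw [h r hr]
  have h1 : p - 1 ≠ 0 := by linarith
  have h2 : p + α ≠ 0 := by linarith
  unfold betaExp sigmaExp
  field_simp
  ring

/-- The function `A - B T`, the logarithmic derivative `r φ'/φ` of
`φ = r^A (1 + r^β)^(-B/β)`, with `A = β/p` and `B = (N + α)/(p - 1)`. -/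
def riccatiSol (N : ℕ) (p α r : ℝ) : ℝ :=
  betaExp p α / p - (N + α) / (p - 1) * logisticPow (betaExp p α) r

/-- `riccatiSol` solves the Riccati equation for the critical eigenvalue: `φ = r^A (1 + r^β)^(-B/β)` is
a positive solution of the radial equation with that angular eigenvalue. -/
lemma hasDerivAt_weight_mul_riccatiSol (hN : 2 ≤ N) (hp : 1 < p) (hpN : p < N) (hα : 0 < α)
    {r : ℝ} (hr : 0 < r) :
    HasDerivAt (fun r => weight N p α r * riccatiSol N p α r)
      (weight N p α r * ((criticalEigenvalue N p α - potential N p α r) / (p - 1)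
        - riccatiSol N p α r ^ 2) / r) r := by
  have h1 : HasDerivAt (riccatiSol N p α) (-((N + α) / (p - 1) * (betaExp p α *
      logisticPow (betaExp p α) r * (1 - logisticPow (betaExp p α) r) / r))) r :=
    ((hasDerivAt_logisticPow hr).const_mul _).const_sub _
  refine ((hasDerivAt_weight hN hp hpN hα hr).mul h1).congr_deriv ?_
  have h1 : p - 1 ≠ 0 := by linarith
  have h2 : p ≠ 0 := by linarith
  unfold potential potentialConst criticalEigenvalue riccatiSol
  generalize logisticPow (betaExp p α) r = T
  unfold betaExp
  field_simp
  ring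

/-- The function `r Z'/Z` for the derivative `Z` of `λ ↦ λ^((N-p)/p) U_α(λ x)` at `λ = 1`, up to a
constant `Z = (1 - p/(p-1) T) (1 - T)^σ`. It has a pole where `T = (p-1)/p`. -/
def riccatiPoleSol (N : ℕ) (p α r : ℝ) : ℝ :=
  -(p / (p - 1) * betaExp p α * logisticPow (betaExp p α) r * (1 - logisticPow (betaExp p α) r) /
      (1 - p / (p - 1) * logisticPow (betaExp p α) r))
    - (N - p) / (p - 1) * logisticPow (betaExp p α) r

/-- `riccatiPoleSol` solves the Riccati equation for the angular eigenvalue `0`: scaling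
invariance of the equation puts `Z` in the kernel of the radial linearized operator. -/
lemma hasDerivAt_weight_mul_riccatiPoleSol (hN : 2 ≤ N) (hp : 1 < p) (hpN : p < N) (hα : 0 < α)
    {r : ℝ} (hr : 0 < r) (hpole : 1 - p / (p - 1) * logisticPow (betaExp p α) r ≠ 0) :
    HasDerivAt (fun r => weight N p α r * riccatiPoleSol N p α r)
      (weight N p α r * ((0 - potential N p α r) / (p - 1)
        - riccatiPoleSol N p α r ^ 2) / r) r := by
  have hT := hasDerivAt_logisticPow (β := betaExp p α) hr
  have h1 : HasDerivAt (riccatiPoleSol N p α) _ r :=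
    (((((hT.const_mul (p / (p - 1) * betaExp p α)).mul (hT.const_sub 1)).div
      ((hT.const_mul (p / (p - 1))).const_sub 1) hpole).neg).sub (hT.const_mul ((N - p) / (p - 1))))
  refine ((hasDerivAt_weight hN hp hpN hα hr).mul h1).congr_deriv ?_
  have h1 : p - 1 ≠ 0 := by linarith
  have h2 : p ≠ 0 := by linarith
  simp only [Pi.mul_apply]
  unfold potential potentialConst riccatiPoleSol
  generalize logisticPow (betaExp p α) r = T at *
  have h3 : 1 - p / (p - 1) * T = (p - 1 - p * T) / (p - 1) := by field_simp
  rw [h3] at hpole ⊢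
  have h4 : p - 1 - p * T ≠ 0 := fun h => hpole (by rw [h, zero_div])
  unfold betaExp
  field_simp
  ring

/-- The radius `r₀` with `T(r₀) = (p-1)/p`. -/
def poleRadius (p α : ℝ) : ℝ := (p - 1) ^ (betaExp p α)⁻¹

lemma poleRadius_pos (hp : 1 < p) : 0 < poleRadius p α :=
  Real.rpow_pos_of_pos (by linarith) _

lemma logisticPow_poleRadius (hp : 1 < p) (hα : 0 < α) :
    logisticPow (betaExp p α) (poleRadius p α) = (p - 1) / p := by
  unfold logisticPow poleRadius
  rw [← Real.rpow_mul (by linarith),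
    inv_mul_cancel₀ (betaExp_pos hp hα).ne', Real.rpow_one]
  rw [add_sub_cancel]

lemma mul_logisticPow_lt_one_iff (hp : 1 < p) (hα : 0 < α) {r : ℝ} (hr : 0 < r) :
    p / (p - 1) * logisticPow (betaExp p α) r < 1 ↔ r < poleRadius p α := by
  rw [← (logisticPow_strictMonoOn (betaExp_pos hp hα)).lt_iff_lt (Set.mem_Ioi.2 hr)
    (Set.mem_Ioi.2 (poleRadius_pos hp)), logisticPow_poleRadius hp hα,
    lt_div_iff₀ (by linarith), div_mul_eq_mul_div, div_lt_one (by linarith), mul_comm]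

lemma one_sub_mul_logisticPow_ne_zero (hp : 1 < p) (hα : 0 < α) {r : ℝ} (hr : 0 < r)
    (h : r ≠ poleRadius p α) : 1 - p / (p - 1) * logisticPow (betaExp p α) r ≠ 0 := by
  intro h0
  refine h ((logisticPow_strictMonoOn (betaExp_pos hp hα)).injOn (Set.mem_Ioi.2 hr)
    (Set.mem_Ioi.2 (poleRadius_pos hp)) ?_)
  have h1 : p - 1 ≠ 0 := by linarith
  rw [logisticPow_poleRadius hp hα, eq_div_iff (by linarith)]
  field_simp at h0
  linarith

lemma riccatiPoleSol_nonpos (hp : 1 < p) (hpN : p < N) (hα : 0 < α) {r : ℝ} (hr : 0 < r)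
    (h : r < poleRadius p α) : riccatiPoleSol N p α r ≤ 0 := by
  have h1 := (mul_logisticPow_lt_one_iff hp hα hr).2 h
  have hT := logisticPow_pos (β := betaExp p α) hr
  have hT1 := logisticPow_lt_one (β := betaExp p α) hr
  have hβ := betaExp_pos hp hα
  have e1 : 0 ≤ p / (p - 1) * betaExp p α * logisticPow (betaExp p α) r * (1 - logisticPow (betaExp p α) r) /
      (1 - p / (p - 1) * logisticPow (betaExp p α) r) := by
    have : 0 < p - 1 := by linarith
    have : 0 ≤ 1 - logisticPow (betaExp p α) r := by linarith
    have : 0 ≤ 1 - p / (p - 1) * logisticPow (betaExp p α) r := by linarith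
    positivity
  have e2 : 0 ≤ (N - p) / (p - 1) * logisticPow (betaExp p α) r :=
    mul_nonneg (div_nonneg (by linarith) (by linarith)) hT.le
  unfold riccatiPoleSol
  linarith

/-- The pole at `poleRadius` is simple. -/
lemma tendsto_riccatiPoleSol (hN : 2 ≤ N) (hp : 1 < p) (hpN : p < N) (hα : 0 < α) :
    ∃ c, Tendsto (fun r => weight N p α r * riccatiPoleSol N p α r * (r - poleRadius p α))
      (𝓝[≠] poleRadius p α) (𝓝 c) := by
  set r₀ := poleRadius p α with hr₀
  have h0 : 0 < r₀ := poleRadius_pos hp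
  set T := logisticPow (betaExp p α) with hTdef
  have hT : HasDerivAt T (betaExp p α * T r₀ * (1 - T r₀) / r₀) r₀ := hasDerivAt_logisticPow h0
  have hT0 : T r₀ = (p - 1) / p := logisticPow_poleRadius hp hα
  have hd : -(p / (p - 1) * (betaExp p α * T r₀ * (1 - T r₀) / r₀)) ≠ 0 := by
    have h1 := logisticPow_pos (β := betaExp p α) h0
    have h2 := logisticPow_lt_one (β := betaExp p α) h0
    have h3 := betaExp_pos hp hα
    have h4 : 0 < 1 - T r₀ := by linarith
    have : 0 < p - 1 := by linarith
    have : 0 < p / (p - 1) * (betaExp p α * T r₀ * (1 - T r₀) / r₀) := by positivity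
    linarith
  have h1 := ((hT.const_mul (p / (p - 1))).const_sub 1).tendsto_slope
  have h2 := h1.inv₀ hd
  have hTc : Tendsto T (𝓝[≠] r₀) (𝓝 (T r₀)) := hT.continuousAt.tendsto.mono_left nhdsWithin_le_nhds
  have hMc : Tendsto (weight N p α) (𝓝[≠] r₀) (𝓝 (weight N p α r₀)) :=
    (hasDerivAt_weight hN hp hpN hα h0).continuousAt.tendsto.mono_left nhdsWithin_le_nhds
  have hid : Tendsto (fun r => r - r₀) (𝓝[≠] r₀) (𝓝 (r₀ - r₀)) :=
    (tendsto_id.sub_const r₀).mono_left nhdsWithin_le_nhds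
  have h3 := hMc.mul (((((hTc.const_mul (p / (p - 1) * betaExp p α)).mul (hTc.const_sub 1)).mul h2).neg).sub
    ((hTc.const_mul (((N : ℝ) - p) / (p - 1))).mul hid))
  refine ⟨_, h3.congr' ?_⟩
  have hpos : ∀ᶠ r in 𝓝[≠] r₀, 0 < r := nhdsWithin_le_nhds (Ioi_mem_nhds h0)
  filter_upwards [self_mem_nhdsWithin, hpos] with r hr hr0
  have hne : 1 - p / (p - 1) * T r ≠ 0 := one_sub_mul_logisticPow_ne_zero hp hα hr0 hr
  have hr' : r - r₀ ≠ 0 := sub_ne_zero.2 hr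
  have h2' : p - 1 ≠ 0 := by linarith
  have hz : 1 - p / (p - 1) * T r₀ = 0 := by rw [hT0]; field_simp; ring
  have hs : (_root_.slope (fun r => 1 - p / (p - 1) * T r) r₀ r)⁻¹ = (r - r₀) / (1 - p / (p - 1) * T r) := by
    rw [slope_def_field, hz, sub_zero, inv_div]
  rw [hs]
  unfold riccatiPoleSol
  rw [← hTdef]
  ring

end Weight

/-! ### A radial function of negative energy below the critical eigenvalue -/

section RadialTest

variable {N : ℕ} {p α : ℝ}

/-- A function continuous on `(0, ∞)` that vanishes near `0` and near `∞` is integrable. -/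
lemma integrableOn_Ioi_of_eq_zero {E : ℝ → ℝ} (hc : ContinuousOn E (Set.Ioi 0)) {ε R : ℝ}
    (hε : 0 < ε) (h0 : ∀ r, 0 < r → r < ε → E r = 0) (hR : ∀ r, R < r → E r = 0) :
    IntegrableOn E (Set.Ioi 0) := by
  have h1 : IntegrableOn E (Set.Icc ε R) :=
    (hc.mono fun r hr => hε.trans_le hr.1).integrableOn_Icc
  refine (integrableOn_iff_integrable_of_support_subset (f := (Set.Ioi 0).indicator E)
    (s := Set.Icc ε R) fun r hr => ?_).1 (h1.congr_fun (fun r hr => ?_) measurableSet_Icc) |>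
    (integrable_indicator_iff measurableSet_Ioi).1
  · by_contra hn
    rw [Set.mem_Icc, not_and_or, not_le, not_le] at hn
    refine hr ?_
    by_cases hr0 : r ∈ Set.Ioi (0 : ℝ)
    · rw [Set.indicator_of_mem hr0]
      rcases hn with hn | hn
      · exact h0 r hr0 hn
      · exact hR r hn
    · exact Set.indicator_of_notMem hr0 _
  · rw [Set.indicator_of_mem (Set.mem_Ioi.2 (hε.trans_le hr.1))]

lemma continuousOn_profile (β a b : ℝ) : ContinuousOn (profile β a b) (Set.Ioi 0) := fun _ hr =>
  (hasDerivAt_profile (Set.mem_Ioi.1 hr)).continuousAt.continuousWithinAt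

lemma integrableOn_profile {β e b : ℝ} (he : -1 < e) (hb : b ≤ 0) (heb : e + β * b < -1) :
    IntegrableOn (profile β e b) (Set.Ioi 0) := by
  have hmeas : AEStronglyMeasurable (profile β e b) (volume.restrict (Set.Ioi 0)) :=
    (continuousOn_profile β e b).aestronglyMeasurable measurableSet_Ioi
  rw [← Set.Ioc_union_Ioi_eq_Ioi (zero_le_one' ℝ)]
  refine IntegrableOn.union ?_ ?_
  · have h1 : IntegrableOn (fun r : ℝ => r ^ e) (Set.Ioc 0 1) :=
      (intervalIntegrable_iff_integrableOn_Ioc_of_le zero_le_one).1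
        (intervalIntegral.intervalIntegrable_rpow' he)
    refine Integrable.mono' h1 (hmeas.mono_set Set.Ioc_subset_Ioi_self) ?_
    rw [ae_restrict_iff' measurableSet_Ioc]
    refine ae_of_all _ fun r hr => ?_
    have hr0 : 0 < r := hr.1
    rw [Real.norm_of_nonneg (profile_pos hr0).le]
    refine mul_le_of_le_one_right (by positivity) ?_
    exact Real.rpow_le_one_of_one_le_of_nonpos (by linarith [Real.rpow_pos_of_pos hr0 β]) hb
  · have h1 : IntegrableOn (fun r : ℝ => r ^ (e + β * b)) (Set.Ioi 1) :=
      integrableOn_Ioi_rpow_of_lt heb one_pos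
    refine Integrable.mono' h1 (hmeas.mono_set (Set.Ioi_subset_Ioi zero_le_one)) ?_
    rw [ae_restrict_iff' measurableSet_Ioi]
    refine ae_of_all _ fun r hr => ?_
    have hr0 : 0 < r := one_pos.trans hr
    rw [Real.norm_of_nonneg (profile_pos hr0).le, Real.rpow_add hr0, Real.rpow_mul hr0.le]
    refine mul_le_mul_of_nonneg_left ?_ (by positivity)
    exact Real.rpow_le_rpow_of_nonpos (by positivity) (by linarith) hb

/-- The positive function `φ = r^A (1 + r^β)^(-B/β)` with logarithmic derivative
`riccatiSol / r`. -/
def groundState (N : ℕ) (p α : ℝ) : ℝ → ℝ :=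
  profile (betaExp p α) (betaExp p α / p) (-((N + α) / (p - 1)) / betaExp p α)

lemma groundState_pos {r : ℝ} (hr : 0 < r) : 0 < groundState N p α r := profile_pos hr

lemma hasDerivAt_groundState (hp : 1 < p) (hα : 0 < α) {r : ℝ} (hr : 0 < r) :
    HasDerivAt (groundState N p α) (groundState N p α r * riccatiSol N p α r / r) r := by
  refine (hasDerivAt_profile hr).congr_deriv ?_
  have := (betaExp_pos hp hα).ne'
  unfold riccatiSol groundState
  rw [div_mul_cancel₀ _ this]
  ring

/-- The exponents of `M φ² / r` are greater than `-1` at the origin and less than `-1` at infinity. -/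
lemma integrableOn_weight_mul_groundState (hN : 2 ≤ N) (hp : 1 < p) (hpN : p < N) (hα : 0 < α) :
    IntegrableOn (fun r => weight N p α r * groundState N p α r ^ 2 / r) (Set.Ioi 0) := by
  obtain ⟨c, -, h⟩ := exists_weight_eq hN hp hpN hα
  have h1 : p - 1 ≠ 0 := by linarith
  have h2 : p ≠ 0 := by linarith
  have h3 : p + α ≠ 0 := by linarith
  have hp1 : 0 < p - 1 := by linarith
  have hp0 : 0 < p := by linarith
  have hN' : (2 : ℝ) ≤ N := by exact_mod_cast hN
  have hbeta := betaExp_pos hp hα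
  set e : ℝ := (N - 2 + (betaExp p α - 1) * (p - 2)) + betaExp p α / p * 2 - 1 with he
  set b : ℝ := -(sigmaExp N p α + 1) * (p - 2) + -((N + α) / (p - 1)) / betaExp p α * 2 with hb
  have e1 : e = N - 2 + α * (p - 1) / p + (p + α) / (p * (p - 1)) := by
    rw [he]; unfold betaExp; field_simp; ring
  have b1 : b = -(p * (N + α) / (p + α)) := by
    rw [hb]; unfold sigmaExp betaExp; field_simp; ring
  have eb : e + betaExp p α * b = -1 - (p * (p + N - 2) + 2 * α * (p - 1)) / (p * (p - 1)) := by
    rw [e1, b1]; unfold betaExp; field_simp; ring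
  have hint : IntegrableOn (profile (betaExp p α) e b) (Set.Ioi 0) := by
    refine integrableOn_profile ?_ ?_ ?_
    · rw [e1]
      have : 0 < α * (p - 1) / p := by positivity
      have : 0 < (p + α) / (p * (p - 1)) := by positivity
      linarith
    · rw [b1, neg_nonpos]; positivity
    · rw [eb]
      have : 0 < p + N - 2 := by linarith
      have : 0 < (p * (p + N - 2) + 2 * α * (p - 1)) / (p * (p - 1)) := by positivity
      linarith
  have hint' : IntegrableOn (fun r => c * profile (betaExp p α) e b r) (Set.Ioi 0) :=
    hint.const_mul c
  refine hint'.congr_fun (fun r hr => ?_) measurableSet_Ioi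
  have hr : 0 < r := hr
  have h5 : profile (betaExp p α) (-1) 0 r = r⁻¹ := by
    simp [profile, Real.rpow_neg_one]
  change c * profile _ e b r = weight N p α r * groundState N p α r ^ 2 / r
  rw [h r hr, groundState, ← Real.rpow_natCast, profile_rpow hr, div_eq_mul_inv, ← h5, mul_assoc,
    mul_assoc, profile_mul hr, profile_mul hr]
  push_cast
  rw [he, hb]
  ring_nf

/-- Below the critical eigenvalue the radial energy takes a negative value on a function with
compact support in `(0, ∞)`: cut `φ` off at scale `n` in the variable `log r`. -/
lemma exists_radial_test (hN : 2 ≤ N) (hp : 1 < p) (hpN : p < N) (hα : 0 < α) {l : ℝ}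
    (hl : l < criticalEigenvalue N p α) :
    ∃ f : ℝ → ℝ, ContDiff ℝ ∞ f ∧ (∃ ε > 0, ∀ r, r < ε → f r = 0) ∧ (∃ R, ∀ r, R < r → f r = 0) ∧
      ∫ r in Set.Ioi 0, (weight N p α r * r * deriv f r ^ 2 +
        weight N p α r / r * ((l - potential N p α r) / (p - 1)) * f r ^ 2) < 0 := by
  have hp1 : 0 < p - 1 := by linarith
  set μ : ℝ := (criticalEigenvalue N p α - l) / (p - 1) with hμ
  have hμ0 : 0 < μ := div_pos (by linarith) hp1
  set m : ℝ → ℝ := fun r => weight N p α r * groundState N p α r ^ 2 / r with hm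
  have hmpos : ∀ r, 0 < r → 0 < m r := fun r hr =>
    div_pos (mul_pos (weight_pos hp hpN hα hr) (pow_pos (groundState_pos hr) 2)) hr
  have hmi : IntegrableOn m (Set.Ioi 0) := integrableOn_weight_mul_groundState hN hp hpN hα
  let η : ContDiffBump (0 : ℝ) := ⟨1, 2, one_pos, one_lt_two⟩
  have hη : ContDiff ℝ ∞ η := η.contDiff
  have hη' : Continuous (deriv η) := hη.continuous_deriv (by simp)
  obtain ⟨C, hC⟩ := hη'.bounded_above_of_compact_support η.hasCompactSupport.deriv
  set I := ∫ r in Set.Ioi 0, m r with hI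
  set J := ∫ r in Set.Ioc 1 2, m r with hJ
  have hmi' : IntegrableOn m (Set.Ioc 1 2) := hmi.mono_set fun r hr => one_pos.trans hr.1
  have hJ0 : 0 < J := by
    rw [hJ, setIntegral_pos_iff_support_of_nonneg_ae]
    · have : Set.Ioc (1 : ℝ) 2 ⊆ Function.support m ∩ Set.Ioc 1 2 := fun r hr =>
        ⟨(hmpos r (one_pos.trans hr.1)).ne', hr⟩
      refine lt_of_lt_of_le ?_ (measure_mono this)
      simp
    · rw [Filter.EventuallyLE, ae_restrict_iff' measurableSet_Ioc]
      exact ae_of_all _ fun r hr => (hmpos r (one_pos.trans hr.1)).le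
    · exact hmi'
  -- the cut-off costs `C² I / n²`, against the gain `μ J`
  obtain ⟨n, hn1, hn⟩ : ∃ n : ℕ, 1 ≤ n ∧ C ^ 2 / (n : ℝ) ^ 2 * I < μ * J := by
    have h1 : Tendsto (fun n : ℕ => C ^ 2 / (n : ℝ) ^ 2 * I) atTop (𝓝 (0 * I)) :=
      (Tendsto.const_div_atTop
        ((tendsto_pow_atTop two_ne_zero).comp tendsto_natCast_atTop_atTop) _).mul_const _
    rw [zero_mul] at h1
    obtain ⟨n, hn⟩ := ((h1.eventually (gt_mem_nhds (mul_pos hμ0 hJ0))).and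
      (eventually_ge_atTop 1)).exists
    exact ⟨n, hn.2, hn.1⟩
  have hn0 : (0 : ℝ) < n := by exact_mod_cast hn1
  set χ : ℝ → ℝ := fun r => η (Real.log r / n) with hχ
  set f : ℝ → ℝ := fun r => if 0 < r then χ r * groundState N p α r else 0 with hf
  have hfpos : ∀ r, 0 < r → f r = χ r * groundState N p α r := fun r hr => if_pos hr
  have hχ0 : ∀ r, 0 < r → r < Real.exp (-2 * n) → χ r = 0 := fun r hr h => by
    refine η.zero_of_le_dist ?_
    have h1 := (Real.log_lt_log hr h)
    rw [Real.log_exp] at h1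
    rw [dist_zero_right, Real.norm_eq_abs, abs_div, Nat.abs_cast, le_div_iff₀ hn0]
    have := neg_le_abs (Real.log r)
    change 2 * (n : ℝ) ≤ _
    linarith
  have hχR : ∀ r, Real.exp (2 * n) < r → χ r = 0 := fun r h => by
    refine η.zero_of_le_dist ?_
    have h1 := (Real.log_lt_log (Real.exp_pos _) h)
    rw [Real.log_exp] at h1
    rw [dist_zero_right, Real.norm_eq_abs, abs_div, Nat.abs_cast, le_div_iff₀ hn0]
    have := le_abs_self (Real.log r)
    change 2 * (n : ℝ) ≤ _
    linarith
  have hf0 : ∀ r, r < Real.exp (-2 * n) → f r = 0 := fun r h => by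
    by_cases hr : 0 < r
    · rw [hfpos r hr, hχ0 r hr h, zero_mul]
    · exact if_neg hr
  have hfR : ∀ r, Real.exp (2 * n) < r → f r = 0 := fun r h => by
    rw [hfpos r ((Real.exp_pos _).trans h), hχR r h, zero_mul]
  have hfc : ContDiff ℝ ∞ f := by
    rw [contDiff_iff_contDiffAt]
    intro r
    by_cases hr : r < Real.exp (-2 * n)
    · refine contDiffAt_const.congr_of_eventuallyEq (f := fun _ => (0 : ℝ)) ?_
      filter_upwards [Iio_mem_nhds hr] with s hs using hf0 s hs
    · have hr0 : 0 < r := (Real.exp_pos _).trans_le (not_lt.1 hr)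
      have h1 : ContDiffAt ℝ ∞ χ r :=
        hη.contDiffAt.comp r ((Real.contDiffAt_log.2 hr0.ne').div_const _)
      have h2 : ContDiffAt ℝ ∞ (groundState N p α) r := by
        unfold groundState profile
        exact (Real.contDiffAt_rpow_const_of_ne hr0.ne').mul
          ((contDiffAt_const.add (Real.contDiffAt_rpow_const_of_ne hr0.ne')).rpow_const_of_ne
            (one_add_rpow_pos _ hr0).ne')
      refine (h1.mul h2).congr_of_eventuallyEq ?_
      filter_upwards [Ioi_mem_nhds hr0] with s hs using hfpos s hs
  have hfd : ∀ r, 0 < r → deriv f r = deriv η (Real.log r / n) / (n * r) * groundState N p α r +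
      f r * riccatiSol N p α r / r := fun r hr => by
    have h1 : HasDerivAt χ (deriv η (Real.log r / n) * (r⁻¹ / n)) r :=
      (hη.differentiable (by simp) _).hasDerivAt.comp r ((Real.hasDerivAt_log hr.ne').div_const _)
    have h2 := h1.mul (hasDerivAt_groundState (N := N) hp hα hr)
    have h3 : f =ᶠ[𝓝 r] χ * groundState N p α := by
      filter_upwards [Ioi_mem_nhds hr] with s hs using hfpos s hs
    rw [(h2.congr_of_eventuallyEq h3).deriv, hfpos r hr]
    field_simp
  have hfdiff := hfc.differentiable (by simp)
  have hfd0 : ∀ r, r < Real.exp (-2 * n) → deriv f r = 0 := fun r h => by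
    have : f =ᶠ[𝓝 r] fun _ => 0 := by filter_upwards [Iio_mem_nhds h] with s hs using hf0 s hs
    rw [this.deriv_eq, deriv_const]
  have hfdR : ∀ r, Real.exp (2 * n) < r → deriv f r = 0 := fun r h => by
    have : f =ᶠ[𝓝 r] fun _ => 0 := by filter_upwards [Ioi_mem_nhds h] with s hs using hfR s hs
    rw [this.deriv_eq, deriv_const]
  refine ⟨f, hfc, ⟨_, Real.exp_pos _, hf0⟩, ⟨_, hfR⟩, ?_⟩
  set E : ℝ → ℝ := fun r => weight N p α r * r * deriv f r ^ 2 +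
        weight N p α r / r * ((l - potential N p α r) / (p - 1)) * f r ^ 2 with hE
  have hwc : ContinuousOn (weight N p α) (Set.Ioi 0) := fun r hr =>
    (hasDerivAt_weight hN hp hpN hα (Set.mem_Ioi.1 hr)).continuousAt.continuousWithinAt
  have hTc : ContinuousOn (logisticPow (betaExp p α)) (Set.Ioi 0) := fun r hr =>
    (hasDerivAt_logisticPow (Set.mem_Ioi.1 hr)).continuousAt.continuousWithinAt
  have hEi : IntegrableOn E (Set.Ioi 0) := by
    refine integrableOn_Ioi_of_eq_zero ?_ (Real.exp_pos (-2 * n)) (R := Real.exp (2 * n)) ?_ ?_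
    · have hpc : ContinuousOn (potential N p α) (Set.Ioi 0) := by unfold potential; fun_prop
      have h1 : ContinuousOn (deriv f) (Set.Ioi 0) :=
        (hfc.continuous_deriv (by simp)).continuousOn
      have h2 : ContinuousOn f (Set.Ioi 0) := hfc.continuous.continuousOn
      have h3 : ContinuousOn (fun r => weight N p α r / r) (Set.Ioi 0) :=
        hwc.div continuousOn_id fun r hr => ne_of_gt hr
      rw [hE]
      fun_prop
    · intro r _ h; simp [hE, hf0 r h, hfd0 r h]
    · intro r h; simp [hE, hfR r h, hfdR r h]
  set L : ℝ → ℝ := fun r =>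
    ((deriv η (Real.log r / n) / n) ^ 2 - μ * η (Real.log r / n) ^ 2) * m r with hL
  have hC' : ∀ x, deriv η x ^ 2 ≤ C ^ 2 := fun x => by
    rw [← sq_abs]; exact pow_le_pow_left₀ (abs_nonneg _) (by simpa using hC x) 2
  have hLi : IntegrableOn L (Set.Ioi 0) := by
    refine Integrable.bdd_mul (c := C ^ 2 / n ^ 2 + μ) hmi ?_ (ae_of_all _ fun r => ?_)
    · refine Measurable.aestronglyMeasurable ?_
      have h1 : Measurable fun r : ℝ => Real.log r / n := Real.measurable_log.div_const _
      exact (((hη'.measurable.comp h1).div_const _).pow_const 2).sub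
        (((hη.continuous.measurable.comp h1).pow_const 2).const_mul μ)
    · rw [Real.norm_eq_abs, abs_le]
      have h1 := hC' (Real.log r / n)
      have h2 : 0 ≤ η (Real.log r / n) := η.nonneg
      have h3 : η (Real.log r / n) ≤ 1 := η.le_one
      have h4 : η (Real.log r / n) ^ 2 ≤ 1 := pow_le_one₀ h2 h3
      have h5 : (deriv η (Real.log r / n) / n) ^ 2 ≤ C ^ 2 / n ^ 2 := by
        rw [div_pow]; exact div_le_div_of_nonneg_right h1 (by positivity)
      have h6 : 0 ≤ (deriv η (Real.log r / n) / n) ^ 2 := sq_nonneg _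
      constructor <;> nlinarith
  -- Picone's identity: `E - L` is the derivative of `M ψ f²`, where `ψ` is `riccatiSol`
  have hD : ∫ r in Set.Ioi 0, (E r - L r) = 0 := by
    have h1 := integral_Ioi_of_hasDerivAt_of_tendsto (a := 0) (m := 0)
      (f := fun r => weight N p α r * riccatiSol N p α r * f r ^ 2) (f' := fun r => E r - L r)
      ?_ ?_ (hEi.sub hLi) ?_
    · rw [h1, hf0 0 (Real.exp_pos _)]; simp
    · refine ContinuousAt.continuousWithinAt ?_
      refine continuousAt_const.congr (f := fun _ => (0 : ℝ)) ?_
      filter_upwards [Iio_mem_nhds (Real.exp_pos (-2 * (n : ℝ)))] with s hs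
      rw [hf0 s hs]; simp
    · intro r hr
      have hr : 0 < r := hr
      refine ((hasDerivAt_weight_mul_riccatiSol hN hp hpN hα hr).mul
        ((hfdiff r).hasDerivAt.pow 2)).congr_deriv ?_
      simp only [hE, hL, hμ, hm]
      rw [hfd r hr, hfpos r hr]
      simp only [hχ, Pi.pow_apply, Nat.cast_ofNat, Nat.add_one_sub_one, pow_one, hfpos r hr]
      field_simp
      ring
    · refine tendsto_const_nhds.congr' (f₁ := fun _ => (0 : ℝ)) ?_
      filter_upwards [eventually_gt_atTop (Real.exp (2 * n))] with s hs
      rw [hfR s hs]; simp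
  rw [integral_sub hEi hLi, sub_eq_zero] at hD
  rw [hD]
  have hLle : ∀ r ∈ Set.Ioi (0 : ℝ), L r ≤ C ^ 2 / (n : ℝ) ^ 2 * m r -
      μ * (Set.Ioc 1 2).indicator m r := fun r hr => by
    have hr : 0 < r := hr
    have h1 := hC' (Real.log r / n)
    have h5 : (deriv η (Real.log r / n) / n) ^ 2 ≤ C ^ 2 / n ^ 2 := by
      rw [div_pow]; exact div_le_div_of_nonneg_right h1 (by positivity)
    have h6 := mul_le_mul_of_nonneg_right h5 (hmpos r hr).le
    have h7 : (Set.Ioc 1 2).indicator m r ≤ η (Real.log r / n) ^ 2 * m r := by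
      by_cases h : r ∈ Set.Ioc (1 : ℝ) 2
      · have h8 : η (Real.log r / n) = 1 := by
          refine η.one_of_mem_closedBall ?_
          rw [mem_closedBall_zero_iff, Real.norm_eq_abs, abs_of_nonneg
            (div_nonneg (Real.log_nonneg h.1.le) hn0.le), div_le_iff₀ hn0]
          change _ ≤ 1 * (n : ℝ)
          have h9 := Real.log_le_sub_one_of_pos hr
          have h10 : (1 : ℝ) ≤ n := by exact_mod_cast hn1
          linarith [h.2]
        rw [Set.indicator_of_mem h, h8]; simp
      · rw [Set.indicator_of_notMem h]
        exact mul_nonneg (sq_nonneg _) (hmpos r hr).le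
    have h8 := mul_le_mul_of_nonneg_left h7 hμ0.le
    simp only [hL]
    linarith
  have hind : Integrable ((Set.Ioc 1 2).indicator m) (volume.restrict (Set.Ioi 0)) :=
    Integrable.indicator hmi measurableSet_Ioc
  have h1 := setIntegral_mono_on hLi ((hmi.const_mul _).sub (hind.const_mul μ))
    measurableSet_Ioi hLle
  refine h1.trans_lt ?_
  simp only [Pi.sub_apply]
  rw [integral_sub (hmi.const_mul _) (hind.const_mul μ), integral_const_mul, integral_const_mul,
    setIntegral_indicator measurableSet_Ioc]
  have h2 : Set.Ioi (0 : ℝ) ∩ Set.Ioc 1 2 = Set.Ioc 1 2 :=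
    Set.inter_eq_right.2 fun r hr => one_pos.trans hr.1
  rw [h2]
  linarith

end RadialTest

/-! ### The linearized form in polar coordinates -/

section PolarForm

variable {N : ℕ} {p α : ℝ}

lemma radialSolution_eq_profile {x : EuclideanSpace ℝ (Fin N)} :
    radialSolution N p α x = bubbleConst N p α * profile (betaExp p α) 0 (-sigmaExp N p α) ‖x‖ := by
  unfold radialSolution profile
  rw [Real.rpow_zero, one_mul, Real.rpow_neg (by positivity), div_eq_mul_inv]
  rfl

lemma hasDerivAt_radialProfile (hp : 1 < p) (hα : 0 < α) {r : ℝ} (hr : 0 < r) :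
    HasDerivAt (fun r => bubbleConst N p α * profile (betaExp p α) 0 (-sigmaExp N p α) r)
      (-slope N p α r) r := by
  refine ((hasDerivAt_profile hr).const_mul _).congr_deriv ?_
  have h : profile (betaExp p α) (betaExp p α - 1) (-(sigmaExp N p α + 1)) r =
      profile (betaExp p α) 0 (-sigmaExp N p α) r * logisticPow (betaExp p α) r / r := by
    rw [logisticPow_eq_profile, profile_mul hr, eq_div_iff hr.ne']
    have h1 := profile_mul (β := betaExp p α) (a := betaExp p α - 1)
      (b := -(sigmaExp N p α + 1)) (a' := 1) (b' := 0) hr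
    have h2 : profile (betaExp p α) 1 0 r = r := by
      unfold profile; rw [Real.rpow_one, Real.rpow_zero, mul_one]
    rw [h2] at h1
    rw [h1]
    congr 1 <;> ring
  unfold slope
  rw [h]
  have h1 : p - 1 ≠ 0 := by linarith
  have h2 : p + α ≠ 0 := by linarith
  have h3 : sigmaExp N p α * betaExp p α = (N - p) / (p - 1) := by
    unfold sigmaExp betaExp; field_simp
  rw [← h3]
  ring

lemma gradient_radialSolution (hp : 1 < p) (hα : 0 < α) {x : EuclideanSpace ℝ (Fin N)}
    (hx : x ≠ 0) :
    gradient (radialSolution N p α) x = (-slope N p α ‖x‖ * ‖x‖⁻¹) • x := by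
  have h := gradient_comp_norm hx
    (hasDerivAt_radialProfile (N := N) hp hα (norm_pos_iff.2 hx))
  rw [← h]
  congr 1
  funext y
  exact radialSolution_eq_profile

lemma gradient_radialSolution_smul (hp : 1 < p) (hα : 0 < α) {r : ℝ} (hr : 0 < r)
    (θ : UnitSphere N) :
    gradient (radialSolution N p α) (r • (θ : EuclideanSpace ℝ (Fin N))) =
      (-slope N p α r) • (θ : EuclideanSpace ℝ (Fin N)) := by
  have hn : ‖r • (θ : EuclideanSpace ℝ (Fin N))‖ = r := by
    rw [norm_smul, norm_coe_unitSphere, mul_one, Real.norm_eq_abs, abs_of_pos hr]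
  have h0 : r • (θ : EuclideanSpace ℝ (Fin N)) ≠ 0 := by
    rw [← norm_pos_iff, hn]; exact hr
  rw [gradient_radialSolution hp hα h0, hn, smul_smul]
  congr 1
  field_simp

lemma norm_smul_unitSphere {r : ℝ} (hr : 0 < r) (θ : UnitSphere N) :
    ‖r • (θ : EuclideanSpace ℝ (Fin N))‖ = r := by
  rw [norm_smul, norm_coe_unitSphere, mul_one, Real.norm_eq_abs, abs_of_pos hr]

/-- The zeroth-order coefficient of the linearized form, in terms of `T = r^β / (1 + r^β)`. -/
lemma sq_mul_zerothCoeff (hp : 1 < p) (hpN : p < N) (hα : 0 < α) {r : ℝ} (hr : 0 < r)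
    (θ : UnitSphere N) :
    r ^ 2 * ((criticalExponent N p α - 1) * r ^ α *
      radialSolution N p α (r • (θ : EuclideanSpace ℝ (Fin N))) ^ (criticalExponent N p α - 2)) =
      slope N p α r ^ (p - 2) * potential N p α r := by
  have hC := bubbleConst_pos hp hpN hα
  have hNp : (0 : ℝ) < N - p := by linarith
  have hp1 : 0 < p - 1 := by linarith
  have hpα : 0 < p + α := by linarith
  have hNα : (0 : ℝ) < N + α := by linarith
  set τ : ℝ := ((N : ℝ) - p) / (p - 1) with hτ
  have hτ0 : 0 < τ := div_pos hNp hp1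
  have hCpow : bubbleConst N p α ^ (criticalExponent N p α - 2) =
      bubbleConst N p α ^ (p - 2) * ((N + α) * (τ * τ ^ (p - 2))) := by
    have e : criticalExponent N p α - 2 = (p - 2) + p * (p + α) / (N - p) := by
      unfold criticalExponent; field_simp; ring
    rw [e, Real.rpow_add hC]
    congr 1
    unfold bubbleConst
    rw [← hτ, ← Real.rpow_mul (by positivity)]
    have e2 : ((N : ℝ) - p) / (p * (p + α)) * (p * (p + α) / (N - p)) = 1 := by field_simp
    rw [e2, Real.rpow_one]
    have e3 : p - 1 = 1 + (p - 2) := by ring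
    rw [e3, Real.rpow_add hτ0, Real.rpow_one]
  rw [radialSolution_eq_profile, norm_smul_unitSphere hr, Real.mul_rpow hC.le (profile_pos hr).le,
    profile_rpow hr, hCpow]
  unfold potential slope
  rw [← hτ, Real.mul_rpow (by positivity) (profile_pos hr).le, Real.mul_rpow hC.le hτ0.le,
    profile_rpow hr, one_sub_logisticPow hr, logisticPow_eq_profile]
  have hr2 : r ^ 2 * r ^ α = profile (betaExp p α) (2 + α) 0 r := by
    unfold profile
    rw [Real.rpow_zero, mul_one, Real.rpow_add hr, Real.rpow_two]
  have hk : potentialConst N p α = (criticalExponent N p α - 1) * (N + α) * τ := by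
    unfold potentialConst criticalExponent
    rw [hτ]; field_simp; ring
  have h1 : profile (betaExp p α) (2 + α) 0 r *
      profile (betaExp p α) (0 * (criticalExponent N p α - 2))
        (-sigmaExp N p α * (criticalExponent N p α - 2)) r =
      profile (betaExp p α) ((betaExp p α - 1) * (p - 2)) (-(sigmaExp N p α + 1) * (p - 2)) r *
        (profile (betaExp p α) (betaExp p α) (-1) r * profile (betaExp p α) 0 (-1) r) := by
    rw [profile_mul hr, profile_mul hr, profile_mul hr]
    congr 1
    · unfold betaExp; field_simp; ring
    · unfold sigmaExp criticalExponent; field_simp; ring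
  rw [← hr2] at h1
  rw [hk]
  linear_combination ((criticalExponent N p α - 1) * (N + α) * τ * bubbleConst N p α ^ (p - 2) *
    τ ^ (p - 2)) * h1

lemma integral_add_sub_apply {X : Type*} [MeasurableSpace X] {μ : Measure X} {f g h : X → ℝ}
    (hf : Integrable f μ) (hg : Integrable g μ) (hh : Integrable h μ) :
    ∫ x, (f x + g x - h x) ∂μ = ∫ x, f x ∂μ + ∫ x, g x ∂μ - ∫ x, h x ∂μ := by
  have h1 : ∫ x, (f x + g x - h x) ∂μ = ∫ x, (f x + g x) ∂μ - ∫ x, h x ∂μ :=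
    integral_sub (hf.add hg) hh
  rw [h1, integral_add hf hg]

/-- The radial part `|∇U|^(p-2) (x/|x| · ∇v)²` of the energy density. -/
def radialEnergyDensity (N : ℕ) (p α : ℝ) (v : EuclideanSpace ℝ (Fin N) → ℝ)
    (x : EuclideanSpace ℝ (Fin N)) : ℝ :=
  ‖gradient (radialSolution N p α) x‖ ^ (p - 2) * ‖gradient v x‖ ^ 2 *
    (inner ℝ x (gradient v x) / (‖x‖ * ‖gradient v x‖)) ^ 2

/-- The radial part is a bounded measurable multiple of the integrable energy density, so neither
the size nor the measurability of `∇U` near the origin enters. -/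
lemma integrable_radialEnergyDensity {v : EuclideanSpace ℝ (Fin N) → ℝ}
    (hv : IsAdmissible N p α v) : Integrable (radialEnergyDensity N p α v) := by
  have hg : Continuous (gradient v) := continuous_gradient (hv.contDiff.of_le (by simp))
  refine hv.integrable_energy.mul_bdd (c := 1) ?_ ?_
  · exact (((measurable_id.inner hg.measurable).div
      (measurable_norm.mul hg.measurable.norm)).pow_const 2).aestronglyMeasurable
  · refine ae_of_all _ fun x => ?_
    rw [Real.norm_eq_abs, abs_of_nonneg (sq_nonneg _), sq_le_one_iff_abs_le_one]
    exact abs_real_inner_div_norm_mul_norm_le_one _ _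

lemma integrable_zerothOrder (hp : 1 < p) (hpN : p < N) (hα : 0 < α)
    {v : EuclideanSpace ℝ (Fin N) → ℝ} (hv : IsAdmissible N p α v) :
    Integrable fun x => (criticalExponent N p α - 1) * ‖x‖ ^ α
        * radialSolution N p α x ^ (criticalExponent N p α - 2) * v x ^ 2 := by
  have hC := bubbleConst_pos hp hpN hα
  have hβ := betaExp_pos hp hα
  have h1 : ∀ x : EuclideanSpace ℝ (Fin N), 0 < 1 + ‖x‖ ^ betaExp p α := fun x => by positivity
  have hU : Continuous (radialSolution N p α) := by
    unfold radialSolution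
    refine continuous_const.div ?_ fun x => (Real.rpow_pos_of_pos (h1 x) _).ne'
    exact (continuous_const.add (continuous_norm.rpow_const fun _ => Or.inr hβ.le)).rpow_const
      fun x => Or.inl (h1 x).ne'
  have hU0 : ∀ x : EuclideanSpace ℝ (Fin N), radialSolution N p α x ≠ 0 := fun x =>
    (div_pos hC (Real.rpow_pos_of_pos (h1 x) _)).ne'
  refine Continuous.integrable_of_hasCompactSupport ?_ ?_
  · exact ((continuous_const.mul (continuous_norm.rpow_const fun _ => Or.inr hα.le)).mul
      (hU.rpow_const fun x => Or.inl (hU0 x))).mul (hv.contDiff.continuous.pow 2)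
  · refine HasCompactSupport.mul_left (f' := fun x => v x ^ 2) ?_
    simp only [pow_two]
    exact hv.hasCompactSupport.mul_left (f := v)

/-- The two expressions for the radial part of the energy density agree away from the origin; where
`∇v = 0` the quotient in `radialEnergyDensity` is `0`, and so is the left-hand side. -/
lemma linearizedForm_density_eq (hp : 1 < p) (hpN : p < N) (hα : 0 < α)
    {v : EuclideanSpace ℝ (Fin N) → ℝ} {x : EuclideanSpace ℝ (Fin N)} (hx : x ≠ 0) :
    ‖gradient (radialSolution N p α) x‖ ^ (p - 4)
        * (inner ℝ (gradient (radialSolution N p α) x) (gradient v x)) ^ 2 =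
      radialEnergyDensity N p α v x := by
  have hx' := norm_pos_iff.2 hx
  have hs := slope_pos hp hpN hα hx'
  unfold radialEnergyDensity
  rw [gradient_radialSolution hp hα hx, norm_smul, norm_mul, norm_inv, norm_neg, norm_norm,
    inv_mul_cancel_right₀ hx'.ne', Real.norm_eq_abs, abs_of_pos hs, inner_smul_left]
  have e : p - 2 = (p - 4) + 2 := by ring
  rw [e, Real.rpow_add hs, Real.rpow_two]
  by_cases hg : gradient v x = 0
  · simp [hg]
  · have hg' := norm_pos_iff.2 hg
    simp only [conj_trivial]
    field_simp

lemma radialEnergyDensity_polar (hN : 2 ≤ N) (hp : 1 < p) (hpN : p < N) (hα : 0 < α)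
    {v : EuclideanSpace ℝ (Fin N) → ℝ} {r : ℝ} (hr : 0 < r) (θ : UnitSphere N) :
    r ^ (N - 1) * radialEnergyDensity N p α v (r • (θ : EuclideanSpace ℝ (Fin N))) =
      weight N p α r * r * inner ℝ (θ : EuclideanSpace ℝ (Fin N))
        (gradient v (r • (θ : EuclideanSpace ℝ (Fin N)))) ^ 2 := by
  have hx : r • (θ : EuclideanSpace ℝ (Fin N)) ≠ 0 := by
    rw [← norm_pos_iff, norm_smul_unitSphere hr]; exact hr
  have hs := slope_pos hp hpN hα hr
  rw [← linearizedForm_density_eq hp hpN hα hx, gradient_radialSolution_smul hp hα hr, norm_smul,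
    norm_neg, norm_coe_unitSphere, Real.norm_eq_abs, abs_of_pos hs, mul_one, inner_smul_left]
  have e : p - 2 = (p - 4) + 2 := by ring
  have e2 : N - 1 = (N - 2) + 1 := by omega
  unfold weight
  rw [e, Real.rpow_add hs, Real.rpow_two, e2, pow_succ]
  simp only [conj_trivial]
  ring

lemma energyDensity_polar (hN : 2 ≤ N) (hp : 1 < p) (hpN : p < N) (hα : 0 < α)
    {v : EuclideanSpace ℝ (Fin N) → ℝ} {r : ℝ} (hr : 0 < r) (θ : UnitSphere N) :
    r ^ (N - 1) * (‖gradient (radialSolution N p α) (r • (θ : EuclideanSpace ℝ (Fin N)))‖ ^ (p - 2)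
        * ‖gradient v (r • (θ : EuclideanSpace ℝ (Fin N)))‖ ^ 2) =
      weight N p α r * r * ‖gradient v (r • (θ : EuclideanSpace ℝ (Fin N)))‖ ^ 2 := by
  have hs := slope_pos hp hpN hα hr
  rw [gradient_radialSolution_smul hp hα hr, norm_smul,
    norm_neg, norm_coe_unitSphere, Real.norm_eq_abs, abs_of_pos hs, mul_one]
  have e2 : N - 1 = (N - 2) + 1 := by omega
  unfold weight
  rw [e2, pow_succ]
  ring

lemma zerothOrder_polar (hN : 2 ≤ N) (hp : 1 < p) (hpN : p < N) (hα : 0 < α)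
    {v : EuclideanSpace ℝ (Fin N) → ℝ} {r : ℝ} (hr : 0 < r) (θ : UnitSphere N) :
    r ^ (N - 1) * ((criticalExponent N p α - 1) * ‖r • (θ : EuclideanSpace ℝ (Fin N))‖ ^ α
        * radialSolution N p α (r • (θ : EuclideanSpace ℝ (Fin N))) ^ (criticalExponent N p α - 2)
        * v (r • (θ : EuclideanSpace ℝ (Fin N))) ^ 2) =
      weight N p α r / r * potential N p α r * v (r • (θ : EuclideanSpace ℝ (Fin N))) ^ 2 := by
  have h := sq_mul_zerothCoeff hp hpN hα hr θ
  rw [norm_smul_unitSphere hr]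
  have e2 : N - 1 = (N - 2) + 1 := by omega
  unfold weight
  rw [e2, pow_succ]
  field_simp
  linear_combination (v (r • (θ : EuclideanSpace ℝ (Fin N))) ^ 2) * h

/-- The integral of the squared radial derivative of `v` over the sphere of radius `r`. -/
def sphereRadialEnergy (v : EuclideanSpace ℝ (Fin N) → ℝ) (r : ℝ) : ℝ :=
  ∫ θ : UnitSphere N, inner ℝ (θ : EuclideanSpace ℝ (Fin N))
    (gradient v (r • (θ : EuclideanSpace ℝ (Fin N)))) ^ 2 ∂surfaceMeasure N

/-- The integral of the squared tangential gradient of `v` over the sphere of radius `r`. -/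
def sphereAngularEnergy (v : EuclideanSpace ℝ (Fin N) → ℝ) (r : ℝ) : ℝ :=
  ∫ θ : UnitSphere N, tangentialInner (θ : EuclideanSpace ℝ (Fin N))
    (gradient v (r • (θ : EuclideanSpace ℝ (Fin N))))
    (gradient v (r • (θ : EuclideanSpace ℝ (Fin N)))) ∂surfaceMeasure N

/-- The integral of `v²` over the sphere of radius `r`. -/
def sphereMass (v : EuclideanSpace ℝ (Fin N) → ℝ) (r : ℝ) : ℝ :=
  ∫ θ : UnitSphere N, v (r • (θ : EuclideanSpace ℝ (Fin N))) ^ 2 ∂surfaceMeasure N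

lemma continuous_gradient_smul {v : EuclideanSpace ℝ (Fin N) → ℝ} (hv : ContDiff ℝ 1 v) :
    Continuous fun q : ℝ × UnitSphere N =>
      gradient v (q.1 • (q.2 : EuclideanSpace ℝ (Fin N))) :=
  (continuous_gradient hv).comp (by fun_prop)

lemma continuous_sphereRadialEnergy {v : EuclideanSpace ℝ (Fin N) → ℝ} (hv : ContDiff ℝ 1 v) :
    Continuous (sphereRadialEnergy v) := by
  refine continuous_integral_sphere (N := N) (F := fun r θ => inner ℝ (θ : EuclideanSpace ℝ (Fin N))
    (gradient v (r • (θ : EuclideanSpace ℝ (Fin N)))) ^ 2) ?_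
  exact ((continuous_subtype_val.comp continuous_snd).inner (continuous_gradient_smul hv)).pow 2

lemma continuous_sphereMass {v : EuclideanSpace ℝ (Fin N) → ℝ} (hv : Continuous v) :
    Continuous (sphereMass v) := by
  refine continuous_integral_sphere (N := N) (F := fun r θ => v (r • (θ : EuclideanSpace ℝ (Fin N))) ^ 2) ?_
  simp only [Function.uncurry_def]
  fun_prop

lemma integral_norm_gradient_sq {v : EuclideanSpace ℝ (Fin N) → ℝ} (hv : ContDiff ℝ 1 v) (r : ℝ) :
    ∫ θ : UnitSphere N, ‖gradient v (r • (θ : EuclideanSpace ℝ (Fin N)))‖ ^ 2 ∂surfaceMeasure N =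
      sphereRadialEnergy v r + sphereAngularEnergy v r := by
  have h : Continuous fun θ : UnitSphere N => gradient v (r • (θ : EuclideanSpace ℝ (Fin N))) :=
    (continuous_gradient hv).comp (by fun_prop)
  have h2 : Continuous fun θ : UnitSphere N => (θ : EuclideanSpace ℝ (Fin N)) := by fun_prop
  unfold sphereRadialEnergy sphereAngularEnergy
  have i1 : Continuous fun θ : UnitSphere N => inner ℝ (θ : EuclideanSpace ℝ (Fin N))
      (gradient v (r • (θ : EuclideanSpace ℝ (Fin N)))) ^ 2 := (h2.inner h).pow 2
  rw [← integral_add (integrable_sphere i1)]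
  · refine integral_congr_ae (ae_of_all _ fun θ => ?_)
    simp only [tangentialInner, norm_coe_unitSphere, real_inner_self_eq_norm_sq]
    ring
  · simp only [tangentialInner]
    exact integrable_sphere (((h2.norm.pow 2).mul (h.inner h)).sub ((h2.inner h).mul (h2.inner h)))

/-- The three terms of the linearized form are integrable, and in polar coordinates the form is the
sum of a radial, an angular and a zeroth-order part. -/
lemma integrable_sphere_energies (hN : 2 ≤ N) (hp : 1 < p) (hpN : p < N) (hα : 0 < α)
    {v : EuclideanSpace ℝ (Fin N) → ℝ} (hv : IsAdmissible N p α v) :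
    IntegrableOn (fun r => weight N p α r * r * sphereRadialEnergy v r) (Set.Ioi 0) ∧
    IntegrableOn (fun r => weight N p α r * r * sphereAngularEnergy v r) (Set.Ioi 0) ∧
    IntegrableOn (fun r => weight N p α r / r * potential N p α r * sphereMass v r) (Set.Ioi 0) ∧
    linearizedForm N p α v = ∫ r in Set.Ioi 0,
      ((p - 1) * (weight N p α r * r * sphereRadialEnergy v r) +
        weight N p α r * r * sphereAngularEnergy v r -
        weight N p α r / r * potential N p α r * sphereMass v r) := by
  have hN0 : 0 < N := by omega
  have hv1 : ContDiff ℝ 1 v := hv.contDiff.of_le (by simp)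
  obtain ⟨i1, e1⟩ := integral_polar hN0 (integrable_radialEnergyDensity hv)
  obtain ⟨i2, e2⟩ := integral_polar hN0 hv.integrable_energy
  obtain ⟨i3, e3⟩ := integral_polar hN0 (integrable_zerothOrder hp hpN hα hv)
  have c1 : Set.EqOn (fun r : ℝ => r ^ (N - 1) * ∫ θ : UnitSphere N, radialEnergyDensity N p α v
      (r • (θ : EuclideanSpace ℝ (Fin N))) ∂surfaceMeasure N)
      (fun r => weight N p α r * r * sphereRadialEnergy v r) (Set.Ioi 0) := fun r hr => by
    simp only [sphereRadialEnergy]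
    rw [← integral_const_mul, ← integral_const_mul]
    simp only [radialEnergyDensity_polar hN hp hpN hα hr]
  have c2 : Set.EqOn (fun r : ℝ => r ^ (N - 1) * ∫ θ : UnitSphere N,
      (‖gradient (radialSolution N p α) (r • (θ : EuclideanSpace ℝ (Fin N)))‖ ^ (p - 2)
        * ‖gradient v (r • (θ : EuclideanSpace ℝ (Fin N)))‖ ^ 2) ∂surfaceMeasure N)
      (fun r => weight N p α r * r * (sphereRadialEnergy v r + sphereAngularEnergy v r))
      (Set.Ioi 0) := fun r hr => by
    beta_reduce
    rw [← integral_norm_gradient_sq hv1, ← integral_const_mul, ← integral_const_mul]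
    simp only [energyDensity_polar hN hp hpN hα hr]
  have c3 : Set.EqOn (fun r : ℝ => r ^ (N - 1) * ∫ θ : UnitSphere N,
      ((criticalExponent N p α - 1) * ‖r • (θ : EuclideanSpace ℝ (Fin N))‖ ^ α
        * radialSolution N p α (r • (θ : EuclideanSpace ℝ (Fin N))) ^ (criticalExponent N p α - 2)
        * v (r • (θ : EuclideanSpace ℝ (Fin N))) ^ 2) ∂surfaceMeasure N)
      (fun r => weight N p α r / r * potential N p α r * sphereMass v r) (Set.Ioi 0) :=
    fun r hr => by
      simp only [sphereMass]
      rw [← integral_const_mul, ← integral_const_mul]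
      simp only [zerothOrder_polar hN hp hpN hα hr]
  have j1 := i1.congr_fun c1 measurableSet_Ioi
  have j2 := i2.congr_fun c2 measurableSet_Ioi
  have j3 := i3.congr_fun c3 measurableSet_Ioi
  rw [setIntegral_congr_fun measurableSet_Ioi c1] at e1
  rw [setIntegral_congr_fun measurableSet_Ioi c2] at e2
  rw [setIntegral_congr_fun measurableSet_Ioi c3] at e3
  have j4 : IntegrableOn (fun r => weight N p α r * r * sphereAngularEnergy v r) (Set.Ioi 0) := by
    refine (j2.sub j1).congr_fun (fun r _ => ?_) measurableSet_Ioi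
    simp only [Pi.sub_apply]
    ring
  refine ⟨j1, j4, j3, ?_⟩
  have hae : ∀ᵐ x : EuclideanSpace ℝ (Fin N), x ≠ 0 := by
    have : Nonempty (Fin N) := ⟨⟨0, hN0⟩⟩
    exact Measure.ae_ne volume 0
  have hQ : linearizedForm N p α v = ∫ x, (‖gradient (radialSolution N p α) x‖ ^ (p - 2)
      * ‖gradient v x‖ ^ 2 + (p - 2) * radialEnergyDensity N p α v x
      - (criticalExponent N p α - 1) * ‖x‖ ^ α
        * radialSolution N p α x ^ (criticalExponent N p α - 2) * v x ^ 2) := by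
    refine integral_congr_ae ?_
    filter_upwards [hae] with x hx
    rw [← linearizedForm_density_eq hp hpN hα hx, mul_assoc (p - 2)]
  have k1 := (integrable_radialEnergyDensity hv).const_mul (p - 2)
  rw [hQ, integral_add_sub_apply hv.integrable_energy k1 (integrable_zerothOrder hp hpN hα hv),
    integral_const_mul, e1, e2, e3, integral_add_sub_apply (j1.const_mul _) j4 j3,
    integral_const_mul]
  simp only [mul_add]
  rw [integral_add j1 j4]
  ring

end PolarForm

/-! ### Nonnegativity on functions with vanishing low modes at the pole radius -/

section UpperBound

variable {N : ℕ} {p α : ℝ} {Y : HarmIdx N → MvPolynomial (Fin N) ℝ}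
  {v : EuclideanSpace ℝ (Fin N) → ℝ}

/-- The coefficient of `θ ↦ v (r θ)` along the spherical harmonic `Y_a`. -/
def modeCoeff (Y : HarmIdx N → MvPolynomial (Fin N) ℝ) (v : EuclideanSpace ℝ (Fin N) → ℝ)
    (r : ℝ) (a : HarmIdx N) : ℝ :=
  harmCoeff Y (fun y => v (r • y)) a

/-- The `r`-derivative of `modeCoeff`. -/
def modeCoeffDeriv (Y : HarmIdx N → MvPolynomial (Fin N) ℝ) (v : EuclideanSpace ℝ (Fin N) → ℝ)
    (r : ℝ) (a : HarmIdx N) : ℝ :=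
  harmCoeff Y (fun y => inner ℝ y (gradient v (r • y))) a

lemma hasDerivAt_smul_arg (hv : ContDiff ℝ 1 v) (r : ℝ) (y : EuclideanSpace ℝ (Fin N)) :
    HasDerivAt (fun s : ℝ => v (s • y)) (inner ℝ y (gradient v (r • y))) r := by
  have h1 : HasFDerivAt v (fderiv ℝ v (r • y)) (r • y) :=
    (hv.differentiable one_ne_zero _).hasFDerivAt
  have h2 : HasDerivAt (fun s : ℝ => s • y) y r := by
    simpa using (hasDerivAt_id r).smul_const y
  refine (h1.comp_hasDerivAt r h2).congr_deriv ?_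
  rw [real_inner_comm, inner_gradient_left]

lemma gradient_smul_arg (hv : ContDiff ℝ 1 v) (r : ℝ) (y : EuclideanSpace ℝ (Fin N)) :
    gradient (fun y => v (r • y)) y = r • gradient v (r • y) := by
  refine HasGradientAt.gradient ?_
  have h1 : HasFDerivAt v (fderiv ℝ v (r • y)) (r • y) :=
    (hv.differentiable one_ne_zero _).hasFDerivAt
  have h2 := h1.comp y ((hasFDerivAt_id y).const_smul r)
  rw [hasGradientAt_iff_hasFDerivAt]
  refine h2.congr_fderiv ?_
  ext w
  simp

lemma continuous_inner_gradient_smul (hv : ContDiff ℝ 1 v) :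
    Continuous fun q : ℝ × UnitSphere N => inner ℝ (q.2 : EuclideanSpace ℝ (Fin N))
      (gradient v (q.1 • (q.2 : EuclideanSpace ℝ (Fin N)))) :=
  (continuous_subtype_val.comp continuous_snd).inner (continuous_gradient_smul hv)

lemma continuous_polyFun_sphere (q : MvPolynomial (Fin N) ℝ) :
    Continuous fun θ : UnitSphere N => polyFun q θ :=
  (continuous_polyFun q).comp continuous_subtype_val

lemma hasDerivAt_modeCoeff (hv : ContDiff ℝ 1 v) (r : ℝ) (a : HarmIdx N) :
    HasDerivAt (fun r => modeCoeff Y v r a) (modeCoeffDeriv Y v r a) r := by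
  have hc := hv.continuous
  refine hasDerivAt_integral_sphere (N := N)
    (F := fun r θ => v (r • (θ : EuclideanSpace ℝ (Fin N))) * polyFun (Y a) θ)
    (F' := fun r θ => inner ℝ (θ : EuclideanSpace ℝ (Fin N))
      (gradient v (r • (θ : EuclideanSpace ℝ (Fin N)))) * polyFun (Y a) θ) ?_ ?_ ?_ r
  · intro r
    have := continuous_polyFun_sphere (Y a)
    fun_prop
  · exact (continuous_inner_gradient_smul hv).mul
      ((continuous_polyFun_sphere (Y a)).comp continuous_snd)
  · intro r θ
    exact (hasDerivAt_smul_arg hv r θ.1).mul_const _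

lemma continuous_modeCoeffDeriv (hv : ContDiff ℝ 1 v) (a : HarmIdx N) :
    Continuous fun r => modeCoeffDeriv Y v r a :=
  continuous_integral_sphere (N := N) (F := fun r θ => inner ℝ (θ : EuclideanSpace ℝ (Fin N))
      (gradient v (r • (θ : EuclideanSpace ℝ (Fin N)))) * polyFun (Y a) θ)
    ((continuous_inner_gradient_smul hv).mul
      ((continuous_polyFun_sphere (Y a)).comp continuous_snd))

lemma continuous_modeCoeff (hv : ContDiff ℝ 1 v) (a : HarmIdx N) :
    Continuous fun r => modeCoeff Y v r a :=
  continuous_iff_continuousAt.2 fun r => (hasDerivAt_modeCoeff hv r a).continuousAt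

/-- Half the `r`-derivative of `sphereMass`. -/
def sphereCross (v : EuclideanSpace ℝ (Fin N) → ℝ) (r : ℝ) : ℝ :=
  ∫ θ : UnitSphere N, v (r • (θ : EuclideanSpace ℝ (Fin N))) *
    inner ℝ (θ : EuclideanSpace ℝ (Fin N)) (gradient v (r • (θ : EuclideanSpace ℝ (Fin N))))
    ∂surfaceMeasure N

lemma hasDerivAt_sphereMass (hv : ContDiff ℝ 1 v) (r : ℝ) :
    HasDerivAt (sphereMass v) (2 * sphereCross v r) r := by
  have hc := hv.continuous
  have h1 : ∀ (r : ℝ) (θ : UnitSphere N),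
      HasDerivAt (fun s : ℝ => v (s • (θ : EuclideanSpace ℝ (Fin N))) ^ 2)
        (2 * (v (r • (θ : EuclideanSpace ℝ (Fin N))) * inner ℝ (θ : EuclideanSpace ℝ (Fin N))
          (gradient v (r • (θ : EuclideanSpace ℝ (Fin N)))))) r := fun r θ => by
    have h2 := (hasDerivAt_smul_arg hv r θ.1).fun_pow 2
    have e : ∀ a b : ℝ, ((2 : ℕ) : ℝ) * a ^ (2 - 1) * b = 2 * (a * b) := fun a b => by
      push_cast; ring
    rwa [e] at h2
  have h := hasDerivAt_integral_sphere (N := N)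
    (F := fun r θ => v (r • (θ : EuclideanSpace ℝ (Fin N))) ^ 2)
    (F' := fun r θ => 2 * (v (r • (θ : EuclideanSpace ℝ (Fin N))) *
      inner ℝ (θ : EuclideanSpace ℝ (Fin N))
      (gradient v (r • (θ : EuclideanSpace ℝ (Fin N)))))) (fun r => by fun_prop) ?_ h1 r
  · rw [integral_const_mul] at h
    exact h
  · refine continuous_const.mul (Continuous.mul ?_ (continuous_inner_gradient_smul hv))
    fun_prop

/-- Bessel's inequality for `∂_r v - c v` on the sphere of radius `r`. -/
lemma sum_modeCoeff_le (hY : IsHarmonicBasis Y) (hv : ContDiff ℝ 1 v) (s : Finset (HarmIdx N))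
    (r c : ℝ) :
    ∑ a ∈ s, (modeCoeffDeriv Y v r a - c * modeCoeff Y v r a) ^ 2 ≤
      sphereRadialEnergy v r - c * (2 * sphereCross v r) + c ^ 2 * sphereMass v r := by
  have hc := hv.continuous
  have hg : Continuous fun θ : UnitSphere N => inner ℝ (θ : EuclideanSpace ℝ (Fin N))
      (gradient v (r • (θ : EuclideanSpace ℝ (Fin N)))) := by
    have h1 : Continuous fun θ : UnitSphere N => gradient v (r • (θ : EuclideanSpace ℝ (Fin N))) :=
      (continuous_gradient hv).comp (by fun_prop)
    have h2 : Continuous fun θ : UnitSphere N => (θ : EuclideanSpace ℝ (Fin N)) := by fun_prop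
    exact h2.inner h1
  have hv' : Continuous fun θ : UnitSphere N => v (r • (θ : EuclideanSpace ℝ (Fin N))) := by
    fun_prop
  have h := sum_harmCoeff_sq_le hY (u := fun y => inner ℝ y (gradient v (r • y)) - c * v (r • y))
    (hg.sub (continuous_const.mul hv')) s
  have h1 : ∀ a, harmCoeff Y (fun y => inner ℝ y (gradient v (r • y)) - c * v (r • y)) a =
      modeCoeffDeriv Y v r a - c * modeCoeff Y v r a := by
    intro a
    have hp := continuous_polyFun_sphere (Y a)
    unfold modeCoeffDeriv modeCoeff harmCoeff
    have h2 := integral_sub (integrable_sphere (hg.mul hp))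
      ((integrable_sphere (hv'.mul hp)).const_mul c)
    simp only [Pi.mul_apply] at h2
    rw [← integral_const_mul, ← h2]
    refine integral_congr_ae (ae_of_all _ fun θ => ?_)
    beta_reduce
    ring
  simp only [h1] at h
  refine h.trans_eq ?_
  have h2 := integral_sub_two_mul_add (integrable_sphere (hg.pow 2))
    ((integrable_sphere (hv'.mul hg)).const_mul c) ((integrable_sphere (hv'.pow 2)).const_mul (c ^ 2))
  simp only [Pi.mul_apply, Pi.pow_apply, integral_const_mul] at h2
  unfold sphereRadialEnergy sphereCross sphereMass
  rw [show ∀ A B C : ℝ, A - c * (2 * B) + C = A - 2 * (c * B) + C from fun A B C => by ring]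
  refine Eq.trans (integral_congr_ae (ae_of_all _ fun θ => ?_)) h2
  beta_reduce
  ring

/-- The spectral gap on the sphere of radius `r`, for the part of `v` of degree `≥ k`. -/
lemma sphereEigenvalue_mul_highMass_le (hN : 2 ≤ N) (hY : IsHarmonicBasis Y) (hv : ContDiff ℝ 1 v)
    (k : ℕ) (r : ℝ) :
    sphereEigenvalue N k * (sphereMass v r - ∑ a ∈ harmIdx N k, modeCoeff Y v r a ^ 2) ≤
      r ^ 2 * sphereAngularEnergy v r := by
  have hu : ContDiff ℝ 1 fun y => v (r • y) := hv.comp (contDiff_const_smul r)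
  refine (sphereEigenvalue_mul_le hN hY hu k).trans_eq ?_
  unfold sphereAngularEnergy
  rw [← integral_const_mul]
  refine integral_congr_ae (ae_of_all _ fun θ => ?_)
  simp only [gradient_smul_arg hv, tangentialInner, inner_smul_left, inner_smul_right, conj_trivial]
  ring

lemma continuousOn_weight (hN : 2 ≤ N) (hp : 1 < p) (hpN : p < N) (hα : 0 < α) :
    ContinuousOn (weight N p α) (Set.Ioi 0) := fun _ hr =>
  (hasDerivAt_weight hN hp hpN hα hr).continuousAt.continuousWithinAt

lemma continuousOn_potential : ContinuousOn (potential N p α) (Set.Ioi 0) := by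
  have h : ContinuousOn (logisticPow (betaExp p α)) (Set.Ioi 0) := fun _ hr =>
    (hasDerivAt_logisticPow hr).continuousAt.continuousWithinAt
  exact (continuousOn_const.mul h).mul (continuousOn_const.sub h)

lemma potential_nonneg (hp : 1 < p) (hpN : p < N) (hα : 0 < α) {r : ℝ} (hr : 0 < r) :
    0 ≤ potential N p α r := by
  have h1 := logisticPow_pos (β := betaExp p α) hr
  have h2 := logisticPow_lt_one (β := betaExp p α) hr
  have h3 : 0 ≤ potentialConst N p α := by
    unfold potentialConst
    have : (0 : ℝ) ≤ p * (N + α) - N + p := by nlinarith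
    exact div_nonneg (mul_nonneg this (by linarith)) (by linarith)
  exact mul_nonneg (mul_nonneg h3 h1.le) (by linarith)

lemma criticalEigenvalue_pos (hN : 2 ≤ N) (hp : 1 < p) (hα : 0 < α) :
    0 < criticalEigenvalue N p α := by
  have h2 : (2 : ℝ) ≤ N := by exact_mod_cast hN
  have : 0 < α * (p - 1) / p := div_pos (mul_pos hα (by linarith)) (by linarith)
  exact mul_pos (div_pos (by linarith) (by linarith)) (by linarith)

lemma integrableOn_of_le_of_nonneg {f g : ℝ → ℝ} (hf : ContinuousOn f (Set.Ioi 0))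
    (hg : IntegrableOn g (Set.Ioi 0)) (h0 : ∀ r, 0 < r → 0 ≤ f r) (h : ∀ r, 0 < r → f r ≤ g r) :
    IntegrableOn f (Set.Ioi 0) := by
  refine Integrable.mono' hg (hf.aestronglyMeasurable measurableSet_Ioi) ?_
  filter_upwards [ae_restrict_mem measurableSet_Ioi] with r hr
  rw [Real.norm_eq_abs, abs_of_nonneg (h0 r hr)]
  exact h r hr

/-- If the modes of degree `< k` of `v` vanish on the sphere of radius `r₀`, and `λ_k` is at least
the critical eigenvalue, then the quadratic form is nonnegative at `v`: the low modes are handled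
by the scaling solution, which changes sign exactly at `r₀`, and the high modes by the positive
solution for the critical eigenvalue. -/
theorem linearizedForm_nonneg (hN : 2 ≤ N) (hp : 1 < p) (hpN : p < N) (hα : 0 < α)
    (hY : IsHarmonicBasis Y) {k : ℕ} (hk : criticalEigenvalue N p α ≤ sphereEigenvalue N k)
    (hv : IsAdmissible N p α v)
    (h0 : ∀ a ∈ harmIdx N k, modeCoeff Y v (poleRadius p α) a = 0) :
    0 ≤ linearizedForm N p α v := by
  set s := harmIdx N k with hs
  have hv1 : ContDiff ℝ 1 v := hv.contDiff.of_le (by simp)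
  obtain ⟨iK, iT, iH, hQ⟩ := integrable_sphere_energies hN hp hpN hα hv
  have hp1 : 0 < p - 1 := by linarith
  have hl0 := criticalEigenvalue_pos hN hp hα
  have hlk := hl0.trans_le hk
  have hM : ∀ r, 0 < r → 0 < weight N p α r := fun r hr => weight_pos hp hpN hα hr
  have cM := continuousOn_weight hN hp hpN hα
  have cP := continuousOn_potential (N := N) (p := p) (α := α)
  -- mass, its derivative, and radial energy of the modes of degree `< k`; the high modes carry the
  -- difference to the full quantities
  set L : ℝ → ℝ := fun r => ∑ a ∈ s, modeCoeff Y v r a ^ 2 with hL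
  set X : ℝ → ℝ := fun r => ∑ a ∈ s, 2 * modeCoeff Y v r a * modeCoeffDeriv Y v r a with hX
  set D : ℝ → ℝ := fun r => ∑ a ∈ s, modeCoeffDeriv Y v r a ^ 2 with hD
  have cL : Continuous L := continuous_finsetSum _ fun a _ => (continuous_modeCoeff hv1 a).pow 2
  have cD : Continuous D := continuous_finsetSum _ fun a _ => (continuous_modeCoeffDeriv hv1 a).pow 2
  have cmass := continuous_sphereMass hv1.continuous
  have crad := continuous_sphereRadialEnergy hv1
  have dL : ∀ r, HasDerivAt L (X r) r := fun r => by
    refine (HasDerivAt.fun_sum fun a _ => (hasDerivAt_modeCoeff hv1 r a).pow 2).congr_deriv ?_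
    refine Finset.sum_congr rfl fun a _ => ?_
    push_cast
    ring
  have hsq : ∀ r c, D r - c * X r + c ^ 2 * L r =
      ∑ a ∈ s, (modeCoeffDeriv Y v r a - c * modeCoeff Y v r a) ^ 2 := fun r c => by
    simp only [hD, hX, hL, Finset.mul_sum]
    rw [← Finset.sum_sub_distrib, ← Finset.sum_add_distrib]
    exact Finset.sum_congr rfl fun a _ => by ring
  have hlow : ∀ r c, 0 ≤ D r - c * X r + c ^ 2 * L r := fun r c => by
    rw [hsq]; exact Finset.sum_nonneg fun a _ => sq_nonneg _
  have hhigh : ∀ r c, 0 ≤ (sphereRadialEnergy v r - D r) - c * (2 * sphereCross v r - X r) +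
      c ^ 2 * (sphereMass v r - L r) := fun r c => by
    have h := sum_modeCoeff_le hY hv1 s r c
    rw [← hsq] at h
    linarith
  have hL0 : ∀ r, 0 ≤ L r := fun r => Finset.sum_nonneg fun a _ => sq_nonneg _
  have hD0 : ∀ r, 0 ≤ D r := fun r => Finset.sum_nonneg fun a _ => sq_nonneg _
  have hDr : ∀ r, 0 ≤ sphereRadialEnergy v r - D r := fun r => by simpa using hhigh r 0
  have hLm : ∀ r, 0 ≤ sphereMass v r - L r := fun r => by
    have h := sum_harmCoeff_sq_le hY (u := fun y => v (r • y))
      (hv1.continuous.comp (by fun_prop)) s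
    exact sub_nonneg.2 h
  -- the angular energy controls the singular potential `1 / r²` on the high modes
  have hang : ∀ r, 0 < r → sphereEigenvalue N k * (weight N p α r / r * (sphereMass v r - L r)) ≤
      weight N p α r * r * sphereAngularEnergy v r := fun r hr => by
    have h := mul_le_mul_of_nonneg_left (sphereEigenvalue_mul_highMass_le hN hY hv1 k r)
      (div_nonneg (hM r hr).le hr.le)
    refine le_trans (le_of_eq ?_) (h.trans_eq ?_)
    · rw [← hs]; ring
    · field_simp
  obtain ⟨R, hR0, hR⟩ : ∃ R > poleRadius p α, ∀ x : EuclideanSpace ℝ (Fin N), R ≤ ‖x‖ → v x = 0 := by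
    obtain ⟨R, hR⟩ := hv.hasCompactSupport.isBounded.subset_closedBall 0
    refine ⟨max (R + 1) (poleRadius p α + 1), (lt_add_one _).trans_le (le_max_right _ _),
      fun x hx => ?_⟩
    by_contra hne
    have h1 := hR (subset_tsupport v hne)
    rw [mem_closedBall_zero_iff] at h1
    linarith [(le_max_left _ _).trans hx]
  have hr₀ : 0 < poleRadius p α := poleRadius_pos hp
  have hRpos : 0 < R := hr₀.trans hR0
  have hvR : ∀ r, R ≤ r → ∀ θ : UnitSphere N, v (r • (θ : EuclideanSpace ℝ (Fin N))) = 0 :=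
    fun r hr θ => hR _ (by rw [norm_smul_unitSphere (hRpos.trans_le hr)]; exact hr)
  have hmR : ∀ r, R ≤ r → sphereMass v r = 0 := fun r hr => by
    simp [sphereMass, hvR r hr]
  have hLR : ∀ r, R ≤ r → L r = 0 := fun r hr => by
    simp [hL, modeCoeff, harmCoeff, hvR r hr]
  have cinv : ContinuousOn (fun r => weight N p α r / r) (Set.Ioi 0) :=
    cM.div continuousOn_id fun r hr => (Set.mem_Ioi.1 hr).ne'
  have cMr : ContinuousOn (fun r => weight N p α r * r) (Set.Ioi 0) := cM.mul continuousOn_id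
  have i1 : IntegrableOn (fun r => weight N p α r * r * D r) (Set.Ioi 0) :=
    integrableOn_of_le_of_nonneg (cMr.mul cD.continuousOn) iK
      (fun r hr => mul_nonneg (mul_nonneg (hM r hr).le hr.le) (hD0 r))
      (fun r hr => mul_le_mul_of_nonneg_left (by linarith [hDr r])
        (mul_nonneg (hM r hr).le hr.le))
  have i2 : IntegrableOn (fun r => weight N p α r / r * potential N p α r * L r) (Set.Ioi 0) :=
    integrableOn_of_le_of_nonneg ((cinv.mul cP).mul cL.continuousOn) iH
      (fun r hr => mul_nonneg (mul_nonneg (div_nonneg (hM r hr).le hr.le)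
        (potential_nonneg hp hpN hα hr)) (hL0 r))
      (fun r hr => mul_le_mul_of_nonneg_left (by linarith [hLm r])
        (mul_nonneg (div_nonneg (hM r hr).le hr.le) (potential_nonneg hp hpN hα hr)))
  have i3 : IntegrableOn (fun r => weight N p α r / r * (sphereMass v r - L r)) (Set.Ioi 0) :=
    integrableOn_of_le_of_nonneg (cinv.mul (cmass.sub cL).continuousOn)
      (iT.const_mul (sphereEigenvalue N k)⁻¹)
      (fun r hr => mul_nonneg (div_nonneg (hM r hr).le hr.le) (hLm r))
      (fun r hr => by
        rw [← div_eq_inv_mul, le_div_iff₀ hlk, mul_comm]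
        exact hang r hr)
  have i4 : IntegrableOn (fun r => weight N p α r * r * (sphereRadialEnergy v r - D r)) (Set.Ioi 0) :=
    (iK.sub i1).congr_fun (fun r _ => by simp only [Pi.sub_apply]; ring) measurableSet_Ioi
  have i5 : IntegrableOn (fun r => weight N p α r / r * potential N p α r * (sphereMass v r - L r))
      (Set.Ioi 0) :=
    (iH.sub i2).congr_fun (fun r _ => by simp only [Pi.sub_apply]; ring) measurableSet_Ioi
  have iE1 : IntegrableOn (fun r => weight N p α r * r * D r +
      weight N p α r / r * ((0 - potential N p α r) / (p - 1)) * L r) (Set.Ioi 0) :=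
    (i1.sub (i2.const_mul (p - 1)⁻¹)).congr_fun
      (fun r _ => by simp only [Pi.sub_apply]; ring) measurableSet_Ioi
  have iE2 : IntegrableOn (fun r => weight N p α r * r * (sphereRadialEnergy v r - D r) +
      weight N p α r / r * ((criticalEigenvalue N p α - potential N p α r) / (p - 1)) *
        (sphereMass v r - L r)) (Set.Ioi 0) :=
    ((i4.add (i3.const_mul (criticalEigenvalue N p α / (p - 1)))).sub
      (i5.const_mul (p - 1)⁻¹)).congr_fun
      (fun r _ => by simp only [Pi.sub_apply, Pi.add_apply]; ring) measurableSet_Ioi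
  obtain ⟨c₀, hc₀⟩ := tendsto_riccatiPoleSol hN hp hpN hα
  have q1 := energy_nonneg_of_riccati_pole (M := weight N p α) (ψ := riccatiPoleSol N p α)
    (V := fun r => (0 - potential N p α r) / (p - 1)) (K := D) (H := L) (H' := X)
    hr₀ hR0 (fun r hr => (hM r hr).le) (fun r hr h => riccatiPoleSol_nonpos hp hpN hα hr h) hc₀
    (fun r hr h => hasDerivAt_weight_mul_riccatiPoleSol hN hp hpN hα hr
      (one_sub_mul_logisticPow_ne_zero hp hα hr h)) (fun r _ => dL r) (fun r _ => hL0 r)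
    (Finset.sum_eq_zero fun a ha => by rw [h0 a ha]; ring) hLR (fun r _ c => hlow r c) iE1
  have q2 := energy_nonneg_of_riccati (M := weight N p α) (ψ := riccatiSol N p α)
    (V := fun r => (criticalEigenvalue N p α - potential N p α r) / (p - 1))
    (K := fun r => sphereRadialEnergy v r - D r) (H := fun r => sphereMass v r - L r)
    (H' := fun r => 2 * sphereCross v r - X r) (A := betaExp p α / p)
    hRpos (fun r hr => (hM r hr).le) (fun r hr => by
      have h1 := logisticPow_pos (β := betaExp p α) hr
      have h2 : 0 ≤ ((N : ℝ) + α) / (p - 1) := div_nonneg (by linarith) hp1.le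
      unfold riccatiSol
      nlinarith [mul_nonneg h2 h1.le])
    (fun r hr => hasDerivAt_weight_mul_riccatiSol hN hp hpN hα hr)
    (fun r _ => (hasDerivAt_sphereMass hv1 r).sub (dL r)) (fun r _ => hLm r)
    (fun r hr => by simp only [hmR r hr, hLR r hr, sub_self]) (fun r _ c => hhigh r c) iE2 i3
  rw [hQ]
  have q3 := mul_nonneg hp1.le (add_nonneg q1 q2)
  rw [← integral_add iE1 iE2, ← integral_const_mul] at q3
  refine q3.trans (setIntegral_mono_on ((iE1.add iE2).const_mul _)
    (((iK.const_mul _).add iT).sub iH) measurableSet_Ioi fun r hr => ?_)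
  have hr : 0 < r := hr
  have h1 := hang r hr
  have h2 : criticalEigenvalue N p α * (weight N p α r / r * (sphereMass v r - L r)) ≤
      sphereEigenvalue N k * (weight N p α r / r * (sphereMass v r - L r)) :=
    mul_le_mul_of_nonneg_right hk (mul_nonneg (div_nonneg (hM r hr).le hr.le) (hLm r))
  refine le_trans (le_of_eq ?_) (sub_le_sub_right (add_le_add_right (h2.trans h1)
    ((p - 1) * (weight N p α r * r * sphereRadialEnergy v r)))
    (weight N p α r / r * potential N p α r * sphereMass v r))
  field_simp
  ring

/-- A negative subspace has dimension at most the number of spherical harmonics of degree `< k`, as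
soon as `λ_k` is at least the critical eigenvalue. -/
theorem finrank_le_of_isNegativeSubspace (hN : 2 ≤ N) (hp : 1 < p) (hpN : p < N) (hα : 0 < α)
    {k : ℕ} (hk : criticalEigenvalue N p α ≤ sphereEigenvalue N k)
    {V : Submodule ℝ (EuclideanSpace ℝ (Fin N) → ℝ)} [FiniteDimensional ℝ V]
    (hV : IsNegativeSubspace N p α V) : Module.finrank ℝ V ≤ (harmIdx N k).card := by
  obtain ⟨Y, hY⟩ := exists_isHarmonicBasis hN
  have hi : ∀ (v : V) (a : HarmIdx N), Integrable (fun θ : UnitSphere N =>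
      v.1 (poleRadius p α • (θ : EuclideanSpace ℝ (Fin N))) * polyFun (Y a) θ)
      (surfaceMeasure N) := fun v a => by
    have hc := (hV v.1 v.2).1.contDiff.continuous
    refine integrable_sphere (Continuous.mul ?_ (continuous_polyFun_sphere _))
    fun_prop
  -- a negative vector in the kernel would contradict `linearizedForm_nonneg`
  let Λ : V →ₗ[ℝ] (harmIdx N k → ℝ) :=
    { toFun := fun v a => modeCoeff Y v.1 (poleRadius p α) a.1
      map_add' := fun v w => by
        funext a
        simp only [modeCoeff, harmCoeff, Submodule.coe_add, Pi.add_apply, add_mul]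
        exact integral_add (hi v a) (hi w a)
      map_smul' := fun c v => by
        funext a
        simp only [modeCoeff, harmCoeff, Submodule.coe_smul, Pi.smul_apply, smul_eq_mul, mul_assoc,
          RingHom.id_apply]
        exact integral_const_mul _ _ }
  have hinj : Function.Injective Λ := by
    rw [← LinearMap.ker_eq_bot, LinearMap.ker_eq_bot']
    intro v hv0
    by_contra hne
    obtain ⟨hadm, hneg⟩ := hV v.1 v.2
    have h1 := hneg fun h => hne (Subtype.ext h)
    have h2 := linearizedForm_nonneg hN hp hpN hα hY hk hadm
      fun a ha => congrFun hv0 ⟨a, ha⟩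
    linarith
  have h := LinearMap.finrank_le_finrank_of_injective hinj
  rwa [Module.finrank_fintype_fun_eq_card, Fintype.card_coe] at h

end UpperBound

/-! ### The negative subspace -/

section LowerBound

variable {N : ℕ} {p α : ℝ} {Y : HarmIdx N → MvPolynomial (Fin N) ℝ} {f : ℝ → ℝ}

/-- The function `f(|x|) Y_a(x/|x|)`. -/
def modeFun (Y : HarmIdx N → MvPolynomial (Fin N) ℝ) (f : ℝ → ℝ) (a : HarmIdx N)
    (x : EuclideanSpace ℝ (Fin N)) : ℝ :=
  f ‖x‖ / ‖x‖ ^ a.1 * polyFun (Y a) x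

/-- The linear combination `∑ a ∈ s, c_a f(|x|) Y_a(x/|x|)`. -/
def modeSum (Y : HarmIdx N → MvPolynomial (Fin N) ℝ) (f : ℝ → ℝ) (s : Finset (HarmIdx N))
    (c : HarmIdx N → ℝ) (x : EuclideanSpace ℝ (Fin N)) : ℝ :=
  ∑ a ∈ s, c a * modeFun Y f a x

lemma contDiff_div_pow (hf : ContDiff ℝ ∞ f) {ε : ℝ} (hε : 0 < ε) (h0 : ∀ r, r < ε → f r = 0)
    (k : ℕ) : ContDiff ℝ ∞ fun r => f r / r ^ k := by
  rw [contDiff_iff_contDiffAt]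
  intro r
  by_cases hr : r < ε
  · refine contDiffAt_const (c := (0 : ℝ)) |>.congr_of_eventuallyEq ?_
    filter_upwards [Iio_mem_nhds hr] with t ht
    rw [h0 t ht, zero_div]
  · have : r ≠ 0 := by linarith
    exact hf.contDiffAt.div (contDiffAt_id.pow k) (pow_ne_zero k this)

lemma contDiff_modeFun (hf : ContDiff ℝ ∞ f) {ε : ℝ} (hε : 0 < ε) (h0 : ∀ r, r < ε → f r = 0)
    (a : HarmIdx N) : ContDiff ℝ ∞ (modeFun Y f a) :=
  (contDiff_comp_norm (contDiff_div_pow hf hε h0 a.1) hε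
    fun r hr => by rw [h0 r hr, zero_div]).mul (contDiff_polyFun _)

lemma contDiff_modeSum (hf : ContDiff ℝ ∞ f) {ε : ℝ} (hε : 0 < ε) (h0 : ∀ r, r < ε → f r = 0)
    (s : Finset (HarmIdx N)) (c : HarmIdx N → ℝ) : ContDiff ℝ ∞ (modeSum Y f s c) :=
  ContDiff.sum fun a _ => contDiff_const.mul (contDiff_modeFun hf hε h0 a)

lemma modeSum_eq_zero (s : Finset (HarmIdx N)) (c : HarmIdx N → ℝ)
    {x : EuclideanSpace ℝ (Fin N)} (hx : f ‖x‖ = 0) : modeSum Y f s c x = 0 :=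
  Finset.sum_eq_zero fun a _ => by rw [modeFun, hx]; ring

lemma hasCompactSupport_modeSum {R : ℝ} (hR : ∀ r, R < r → f r = 0) (s : Finset (HarmIdx N))
    (c : HarmIdx N → ℝ) : HasCompactSupport (modeSum Y f s c) := by
  refine HasCompactSupport.of_support_subset_isCompact
    (isCompact_closedBall (0 : EuclideanSpace ℝ (Fin N)) R) fun x hx => ?_
  by_contra hxR
  exact hx (modeSum_eq_zero s c (hR _ (by simpa using hxR)))

lemma norm_gradient_radialSolution (hp : 1 < p) (hpN : p < N) (hα : 0 < α)
    {x : EuclideanSpace ℝ (Fin N)} (hx : x ≠ 0) :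
    ‖gradient (radialSolution N p α) x‖ = slope N p α ‖x‖ := by
  have hx' := norm_pos_iff.2 hx
  rw [gradient_radialSolution hp hα hx, norm_smul, norm_mul, norm_inv, norm_neg, norm_norm,
    inv_mul_cancel_right₀ hx'.ne', Real.norm_eq_abs, abs_of_pos (slope_pos hp hpN hα hx')]

/-- A test function vanishing near the critical point `0` of `U` is admissible. -/
lemma isAdmissible_of_eq_zero (hp : 1 < p) (hpN : p < N) (hα : 0 < α)
    {v : EuclideanSpace ℝ (Fin N) → ℝ} (hv : ContDiff ℝ ∞ v) (hvc : HasCompactSupport v) {ε : ℝ}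
    (hε : 0 < ε) (h0 : ∀ x, ‖x‖ < ε → v x = 0) : IsAdmissible N p α v := by
  refine ⟨hv, hvc, ?_⟩
  have hg : Continuous (gradient v) := continuous_gradient (hv.of_le (by simp))
  have hz : ∀ x, v =ᶠ[𝓝 x] (fun _ => 0) → gradient v x = 0 := fun x hx => by
    rw [hx.gradient_eq]
    exact gradient_fun_const x (0 : ℝ)
  refine Continuous.integrable_of_hasCompactSupport ?_ ?_
  · refine continuous_iff_continuousAt.2 fun x => ?_
    by_cases hx : ‖x‖ < ε
    · refine (continuousAt_const (y := (0 : ℝ))).congr ?_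
      have ho : ∀ᶠ y : EuclideanSpace ℝ (Fin N) in 𝓝 x, ‖y‖ < ε :=
        continuous_norm.continuousAt.eventually_lt continuousAt_const hx
      filter_upwards [ho.eventually_nhds] with y hy
      rw [hz y (hy.mono fun z hz => h0 z hz)]
      simp
    · have hx0 : x ≠ 0 := fun h => hx (by rw [h, norm_zero]; exact hε)
      have hxp := norm_pos_iff.2 hx0
      have hs : ContinuousAt (slope N p α) ‖x‖ :=
        ((hasDerivAt_profile hxp).const_mul _).continuousAt
      have hs' : ContinuousAt (fun y : EuclideanSpace ℝ (Fin N) => slope N p α ‖y‖ ^ (p - 2)) x :=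
        (hs.comp continuous_norm.continuousAt).rpow_const
          (Or.inl (slope_pos hp hpN hα hxp).ne')
      refine (hs'.mul (hg.norm.pow 2).continuousAt).congr ?_
      filter_upwards [isOpen_ne.mem_nhds hx0] with y hy
      rw [norm_gradient_radialSolution hp hpN hα hy]
      rfl
  · refine HasCompactSupport.of_support_subset_isCompact hvc fun x hx => ?_
    by_contra hxs
    refine hx ?_
    have := hz x (notMem_tsupport_iff_eventuallyEq.1 hxs)
    simp [this]

lemma modeSum_smul (hY : IsHarmonicBasis Y) (s : Finset (HarmIdx N)) (c : HarmIdx N → ℝ) {r : ℝ}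
    (hr : 0 < r) (θ : UnitSphere N) : modeSum Y f s c (r • (θ : EuclideanSpace ℝ (Fin N))) =
      f r * polyFun (harmSum Y s c) θ := by
  unfold modeSum
  rw [polyFun_harmSum, Finset.mul_sum]
  refine Finset.sum_congr rfl fun a _ => ?_
  rw [modeFun, norm_smul_unitSphere hr, polyFun_smul_arg (hY.mem a).1]
  field_simp

lemma integral_polyFun_harmSum_sq (hY : IsHarmonicBasis Y) (s : Finset (HarmIdx N))
    (c : HarmIdx N → ℝ) :
    ∫ θ : UnitSphere N, polyFun (harmSum Y s c) θ ^ 2 ∂surfaceMeasure N = ∑ a ∈ s, c a ^ 2 := by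
  have h := integral_mul_harmSum (Y := Y) (u := polyFun (harmSum Y s c))
    (continuous_polyFun_sphere _) s c
  simp only [← sq] at h
  rw [h]
  refine Finset.sum_congr rfl fun a ha => ?_
  rw [harmCoeff_harmSum hY s c ha, sq]

lemma sphereMass_modeSum (hY : IsHarmonicBasis Y) (s : Finset (HarmIdx N)) (c : HarmIdx N → ℝ)
    {r : ℝ} (hr : 0 < r) :
    sphereMass (modeSum Y f s c) r = f r ^ 2 * ∑ a ∈ s, c a ^ 2 := by
  unfold sphereMass
  simp only [modeSum_smul hY s c hr, mul_pow]
  rw [integral_const_mul, integral_polyFun_harmSum_sq hY]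

lemma sphereRadialEnergy_modeSum (hY : IsHarmonicBasis Y) (hf : ContDiff ℝ ∞ f) {ε : ℝ}
    (hε : 0 < ε) (h0 : ∀ r, r < ε → f r = 0) (s : Finset (HarmIdx N)) (c : HarmIdx N → ℝ)
    {r : ℝ} (hr : 0 < r) :
    sphereRadialEnergy (modeSum Y f s c) r = deriv f r ^ 2 * ∑ a ∈ s, c a ^ 2 := by
  have hv : ContDiff ℝ 1 (modeSum Y f s c) := (contDiff_modeSum hf hε h0 s c).of_le (by simp)
  have h : ∀ θ : UnitSphere N, inner ℝ (θ : EuclideanSpace ℝ (Fin N))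
      (gradient (modeSum Y f s c) (r • (θ : EuclideanSpace ℝ (Fin N)))) =
      deriv f r * polyFun (harmSum Y s c) θ := fun θ => by
    refine (hasDerivAt_smul_arg hv r θ.1).unique ?_
    refine (((hf.differentiable (by simp) r).hasDerivAt).mul_const _).congr_of_eventuallyEq ?_
    filter_upwards [Ioi_mem_nhds hr] with t ht using modeSum_smul hY s c ht θ
  unfold sphereRadialEnergy
  simp only [h, mul_pow]
  rw [integral_const_mul, integral_polyFun_harmSum_sq hY]

/-- On the sphere, the gradient of a combination of functions `ψ_a(|y|) Y_a(y)` with common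
boundary value `ψ_a(1) = F` is `F ∇P` up to a radial vector, where `P = ∑ c_a Y_a`. -/
lemma exists_gradient_sum_comp_norm (s : Finset (HarmIdx N)) (c : HarmIdx N → ℝ)
    {ψ : HarmIdx N → ℝ → ℝ} {d : HarmIdx N → ℝ} {F : ℝ} (hψ : ∀ a, HasDerivAt (ψ a) (d a) 1)
    (hF : ∀ a, ψ a 1 = F) (θ : UnitSphere N) :
    ∃ μ : ℝ, gradient (fun y : EuclideanSpace ℝ (Fin N) =>
        ∑ a ∈ s, c a * (ψ a ‖y‖ * polyFun (Y a) y)) θ =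
      F • gradient (polyFun (harmSum Y s c)) θ + μ • (θ : EuclideanSpace ℝ (Fin N)) := by
  have hn := norm_coe_unitSphere θ
  have hθ : (θ : EuclideanSpace ℝ (Fin N)) ≠ 0 := by rw [← norm_pos_iff, hn]; exact one_pos
  have h1 : ∀ a, HasFDerivAt (fun y : EuclideanSpace ℝ (Fin N) => ψ a ‖y‖)
      ((d a * ‖(θ : EuclideanSpace ℝ (Fin N))‖⁻¹) • innerSL ℝ (θ : EuclideanSpace ℝ (Fin N)))
      (θ : EuclideanSpace ℝ (Fin N)) :=
    fun a => hasFDerivAt_comp_norm hθ (by rw [hn]; exact hψ a)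
  have h2 : ∀ a, HasFDerivAt (polyFun (Y a)) (fderiv ℝ (polyFun (Y a)) θ)
      (θ : EuclideanSpace ℝ (Fin N)) := fun a => (differentiable_polyFun (Y a) _).hasFDerivAt
  have h3 := HasFDerivAt.fun_sum (u := s) fun a _ => ((h1 a).mul (h2 a)).const_mul (c a)
  refine ⟨∑ a ∈ s, c a * (polyFun (Y a) θ * d a), ext_inner_right ℝ fun w => ?_⟩
  rw [inner_gradient_left]
  refine (congrArg (fun L => L w) h3.fderiv).trans ?_
  rw [gradient_harmSum, inner_add_left, inner_smul_left, inner_smul_left, sum_inner]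
  simp only [sum_apply, smul_apply,
    add_apply, inner_smul_left, inner_gradient_left, conj_trivial, smul_eq_mul,
    innerSL_apply_apply, hn, hF, inv_one, mul_one, Finset.mul_sum, Finset.sum_mul]
  rw [← Finset.sum_add_distrib]
  exact Finset.sum_congr rfl fun a _ => by ring

lemma tangentialInner_smul_add_smul {x g : EuclideanSpace ℝ (Fin N)} (F μ : ℝ) :
    tangentialInner x (F • g + μ • x) (F • g + μ • x) = F ^ 2 * tangentialInner x g g := by
  unfold tangentialInner
  simp only [inner_add_left, inner_add_right, inner_smul_left, inner_smul_right, conj_trivial,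
    real_inner_self_eq_norm_sq, real_inner_comm x g]
  ring

lemma sphereAngularEnergy_modeSum (hN : 0 < N) (hY : IsHarmonicBasis Y) (hf : ContDiff ℝ ∞ f)
    {ε : ℝ} (hε : 0 < ε) (h0 : ∀ r, r < ε → f r = 0) (s : Finset (HarmIdx N))
    (c : HarmIdx N → ℝ) {r : ℝ} (hr : 0 < r) :
    r ^ 2 * sphereAngularEnergy (modeSum Y f s c) r =
      f r ^ 2 * ∑ a ∈ s, sphereEigenvalue N a.1 * c a ^ 2 := by
  have hv : ContDiff ℝ 1 (modeSum Y f s c) := (contDiff_modeSum hf hε h0 s c).of_le (by simp)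
  have hψ : ∀ a : HarmIdx N, HasDerivAt (fun t : ℝ => r ^ a.1 * (f (r * t) / (r * t) ^ a.1))
      (r ^ a.1 * (deriv (fun t => f t / t ^ a.1) r * r)) 1 := fun a => by
    have h1 : HasDerivAt (fun t => f t / t ^ a.1) (deriv (fun t => f t / t ^ a.1) r) (r * 1) := by
      rw [mul_one]
      exact ((contDiff_div_pow hf hε h0 a.1).differentiable (by simp) r).hasDerivAt
    have h2 : HasDerivAt (fun t : ℝ => r * t) r 1 := by
      simpa using (hasDerivAt_id (1 : ℝ)).const_mul r
    exact (h1.comp 1 h2).const_mul _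
  have hfun : (fun y : EuclideanSpace ℝ (Fin N) => modeSum Y f s c (r • y)) = fun y =>
      ∑ a ∈ s, c a * ((r ^ a.1 * (f (r * ‖y‖) / (r * ‖y‖) ^ a.1)) * polyFun (Y a) y) := by
    funext y
    refine Finset.sum_congr rfl fun a _ => ?_
    rw [modeFun, polyFun_smul_arg (hY.mem a).1, norm_smul, Real.norm_eq_abs, abs_of_pos hr]
    ring
  have hkey : ∀ θ : UnitSphere N, r ^ 2 * tangentialInner (θ : EuclideanSpace ℝ (Fin N))
      (gradient (modeSum Y f s c) (r • (θ : EuclideanSpace ℝ (Fin N))))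
      (gradient (modeSum Y f s c) (r • (θ : EuclideanSpace ℝ (Fin N)))) =
      f r ^ 2 * tangentialInner (θ : EuclideanSpace ℝ (Fin N))
        (gradient (polyFun (harmSum Y s c)) θ) (gradient (polyFun (harmSum Y s c)) θ) := fun θ => by
    obtain ⟨μ, hμ⟩ := exists_gradient_sum_comp_norm (Y := Y) s c (F := f r) hψ
      (fun a => by rw [mul_one]; field_simp) θ
    rw [← hfun, gradient_smul_arg hv] at hμ
    have h1 := tangentialInner_smul_add_smul (x := (θ : EuclideanSpace ℝ (Fin N)))
      (g := gradient (polyFun (harmSum Y s c)) θ) (f r) μ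
    have h2 := tangentialInner_smul_add_smul (x := (θ : EuclideanSpace ℝ (Fin N)))
      (g := gradient (modeSum Y f s c) (r • (θ : EuclideanSpace ℝ (Fin N)))) r 0
    rw [zero_smul, add_zero] at h2
    rw [← h1, ← h2, hμ]
  unfold sphereAngularEnergy
  rw [← integral_const_mul]
  simp only [hkey]
  rw [integral_const_mul, integral_tangentialInner_harmSum hN hY]

/-- The quadratic form at `f(|x|) ∑ c_a Y_a(x/|x|)`, when all degrees are at most `k`, is bounded by
the one-dimensional energy of `f` with angular eigenvalue `λ_k`. -/
lemma linearizedForm_modeSum_le (hN : 2 ≤ N) (hp : 1 < p) (hpN : p < N) (hα : 0 < α)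
    (hY : IsHarmonicBasis Y) (hf : ContDiff ℝ ∞ f) {ε R : ℝ}
    (hε : 0 < ε) (h0 : ∀ r, r < ε → f r = 0) (hR : ∀ r, R < r → f r = 0) (k : ℕ)
    (c : HarmIdx N → ℝ)
    (hint : IntegrableOn (fun r => weight N p α r * r * deriv f r ^ 2 + weight N p α r / r *
      ((sphereEigenvalue N k - potential N p α r) / (p - 1)) * f r ^ 2) (Set.Ioi 0)) :
    linearizedForm N p α (modeSum Y f (harmIdx N (k + 1)) c) ≤
      (p - 1) * (∑ a ∈ harmIdx N (k + 1), c a ^ 2) *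
        ∫ r in Set.Ioi 0, (weight N p α r * r * deriv f r ^ 2 + weight N p α r / r *
          ((sphereEigenvalue N k - potential N p α r) / (p - 1)) * f r ^ 2) := by
  set s := harmIdx N (k + 1) with hs
  have hadm : IsAdmissible N p α (modeSum Y f s c) :=
    isAdmissible_of_eq_zero hp hpN hα (contDiff_modeSum hf hε h0 s c)
      (hasCompactSupport_modeSum hR s c) hε fun x hx => modeSum_eq_zero s c (h0 _ hx)
  obtain ⟨iK, iT, iH, hQ⟩ := integrable_sphere_energies hN hp hpN hα hadm
  rw [hQ, ← integral_const_mul]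
  refine setIntegral_mono_on (((iK.const_mul _).add iT).sub iH) (hint.const_mul _)
    measurableSet_Ioi fun r hr => ?_
  have hr : 0 < r := hr
  have hM := weight_pos (N := N) hp hpN hα hr
  have h1 := sphereAngularEnergy_modeSum (by omega) hY hf hε h0 s c hr
  have h2 : ∑ a ∈ s, sphereEigenvalue N a.1 * c a ^ 2 ≤
      sphereEigenvalue N k * ∑ a ∈ s, c a ^ 2 := by
    rw [Finset.mul_sum]
    refine Finset.sum_le_sum fun a ha => mul_le_mul_of_nonneg_right
      (sphereEigenvalue_mono hN ?_) (sq_nonneg _)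
    exact Nat.lt_succ_iff.1 (mem_harmIdx.1 ha)
  have h3 : weight N p α r * r * sphereAngularEnergy (modeSum Y f s c) r ≤
      weight N p α r / r * (f r ^ 2 * (sphereEigenvalue N k * ∑ a ∈ s, c a ^ 2)) := by
    have e : weight N p α r * r * sphereAngularEnergy (modeSum Y f s c) r =
        weight N p α r / r * (r ^ 2 * sphereAngularEnergy (modeSum Y f s c) r) := by field_simp
    rw [e, h1]
    exact mul_le_mul_of_nonneg_left (mul_le_mul_of_nonneg_left h2 (sq_nonneg _))
      (div_nonneg hM.le hr.le)
  rw [sphereMass_modeSum hY s c hr, sphereRadialEnergy_modeSum hY hf hε h0 s c hr]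
  have hp1 : p - 1 ≠ 0 := by linarith
  refine le_trans (sub_le_sub_right (add_le_add_right h3 _) _) (le_of_eq ?_)
  field_simp
  ring

/-- If `λ_k` is below the critical eigenvalue, the spherical harmonics of degree `≤ k` give a
negative subspace. -/
theorem exists_isNegativeSubspace (hN : 2 ≤ N) (hp : 1 < p) (hpN : p < N) (hα : 0 < α) {k : ℕ}
    (hk : sphereEigenvalue N k < criticalEigenvalue N p α) :
    ∃ V : Submodule ℝ (EuclideanSpace ℝ (Fin N) → ℝ), FiniteDimensional ℝ V ∧
      IsNegativeSubspace N p α V ∧ Module.finrank ℝ V = (harmIdx N (k + 1)).card := by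
  obtain ⟨Y, hY⟩ := exists_isHarmonicBasis hN
  obtain ⟨f, hf, ⟨ε, hε, h0⟩, ⟨R, hR⟩, hneg⟩ := exists_radial_test hN hp hpN hα hk
  have hint : IntegrableOn (fun r => weight N p α r * r * deriv f r ^ 2 + weight N p α r / r *
      ((sphereEigenvalue N k - potential N p α r) / (p - 1)) * f r ^ 2) (Set.Ioi 0) := by
    by_contra h
    rw [integral_undef h] at hneg
    exact lt_irrefl _ hneg
  obtain ⟨r, hr, hfr⟩ : ∃ r, 0 < r ∧ f r ≠ 0 := by
    by_contra! h
    refine hneg.not_ge (setIntegral_nonneg measurableSet_Ioi fun r hr => ?_)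
    have hr : 0 < r := hr
    rw [h r hr]
    have := mul_nonneg (mul_nonneg (weight_pos (N := N) hp hpN hα hr).le hr.le)
      (sq_nonneg (deriv f r))
    simpa using this
  set s := harmIdx N (k + 1) with hs
  let Ψ : (s → ℝ) →ₗ[ℝ] (EuclideanSpace ℝ (Fin N) → ℝ) := Fintype.linearCombination ℝ fun a : s =>
    modeFun Y f a.1
  let ext : (s → ℝ) → HarmIdx N → ℝ := fun c a => if h : a ∈ s then c ⟨a, h⟩ else 0
  have hext : ∀ (c : s → ℝ) (a : s), ext c a.1 = c a := fun c a => dif_pos a.2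
  have hΨ : ∀ c, Ψ c = modeSum Y f s (ext c) := fun c => by
    funext x
    simp only [Ψ, Fintype.linearCombination_apply, Finset.sum_apply, Pi.smul_apply, smul_eq_mul,
      modeSum]
    rw [← Finset.sum_coe_sort s]
    simp only [hext]
  have hinj : Function.Injective Ψ := by
    rw [← LinearMap.ker_eq_bot, LinearMap.ker_eq_bot']
    intro c hc
    rw [hΨ] at hc
    have h1 : ∀ θ : UnitSphere N, polyFun (harmSum Y s (ext c)) θ = 0 := fun θ => by
      have h := modeSum_smul (f := f) hY s (ext c) hr θ
      rw [hc] at h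
      exact (mul_eq_zero.1 h.symm).resolve_left hfr
    funext a
    rw [← hext c a, ← harmCoeff_harmSum hY s (ext c) a.2]
    simp [harmCoeff, h1]
  refine ⟨LinearMap.range Ψ, inferInstance, ?_, ?_⟩
  · rintro _ ⟨c, rfl⟩
    rw [hΨ]
    refine ⟨isAdmissible_of_eq_zero hp hpN hα (contDiff_modeSum hf hε h0 s _)
      (hasCompactSupport_modeSum hR s _) hε fun x hx => modeSum_eq_zero s _ (h0 _ hx),
      fun hne => ?_⟩
    refine (linearizedForm_modeSum_le hN hp hpN hα hY hf hε h0 hR k (ext c) hint).trans_lt ?_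
    refine mul_neg_of_pos_of_neg (mul_pos (by linarith) ?_) hneg
    refine (Finset.sum_nonneg fun a _ => sq_nonneg _).lt_of_ne fun h => hne ?_
    have h2 := (Finset.sum_eq_zero_iff_of_nonneg fun a _ => sq_nonneg _).1 h.symm
    funext x
    exact Finset.sum_eq_zero fun a ha => by rw [pow_eq_zero_iff two_ne_zero |>.1 (h2 a ha), zero_mul]
  · rw [LinearMap.finrank_range_of_inj hinj, Module.finrank_fintype_fun_eq_card, Fintype.card_coe]

/-- The Morse index is the number of spherical harmonics whose eigenvalue is below the critical
one. -/
theorem morseIndex_eq (hN : 2 ≤ N) (hp : 1 < p) (hpN : p < N) (hα : 0 < α) {k : ℕ}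
    (h1 : sphereEigenvalue N k < criticalEigenvalue N p α)
    (h2 : criticalEigenvalue N p α ≤ sphereEigenvalue N (k + 1)) :
    morseIndex N p α = ((∑ j ∈ Finset.range (k + 1),
      Module.finrank ℝ (harmonicPolynomials N j) : ℕ) : ℕ∞) := by
  rw [← card_harmIdx]
  refine le_antisymm ?_ ?_
  · refine iSup_le fun V => iSup_le fun hV => iSup_le fun hneg => ?_
    exact_mod_cast finrank_le_of_isNegativeSubspace hN hp hpN hα h2 hneg
  · obtain ⟨V, hV, hneg, hd⟩ := exists_isNegativeSubspace hN hp hpN hα h1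
    rw [← hd]
    exact le_iSup_of_le V (le_iSup_of_le hV (le_iSup_of_le hneg le_rfl))

end LowerBound

/-! ### The threshold `ζ` and the critical values of `α` -/

section Threshold

variable {N : ℕ} {p α : ℝ}

/-- The radicand in the definition of `ζ(α)`. -/
def zetaRadicand (N : ℕ) (p α : ℝ) : ℝ :=
  4 * (p - 1) * α ^ 2 + 4 * p * (N + p - 2) * α + (N : ℝ) ^ 2 * p ^ 2

lemma zeta_eq : zeta N p α = ((2 * p - N * p) + √(zetaRadicand N p α)) / (2 * p) := rfl

lemma zetaRadicand_strictMonoOn (hN : 2 ≤ N) (hp : 1 < p) :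
    StrictMonoOn (zetaRadicand N p) (Set.Ici 0) := by
  intro a ha b hb hab
  have ha : 0 ≤ a := ha
  have h2 : (2 : ℝ) ≤ N := by exact_mod_cast hN
  have h3 : 0 < 4 * p * ((N : ℝ) + p - 2) := by nlinarith
  have h4 : a ^ 2 ≤ b ^ 2 := by nlinarith
  unfold zetaRadicand
  nlinarith [mul_le_mul_of_nonneg_left h4 (show 0 ≤ 4 * (p - 1) by linarith),
    mul_lt_mul_of_pos_left hab h3]

lemma zetaRadicand_nonneg (hN : 2 ≤ N) (hp : 1 < p) (hα : 0 ≤ α) : 0 ≤ zetaRadicand N p α := by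
  have h2 : (2 : ℝ) ≤ N := by exact_mod_cast hN
  have h3 : 0 ≤ 4 * p * ((N : ℝ) + p - 2) := by nlinarith
  have : 0 ≤ p - 1 := by linarith
  unfold zetaRadicand
  positivity

lemma zeta_strictMonoOn (hN : 2 ≤ N) (hp : 1 < p) : StrictMonoOn (zeta N p) (Set.Ici 0) := by
  intro a ha b hb hab
  have h := Real.sqrt_lt_sqrt (zetaRadicand_nonneg (N := N) hN hp ha)
    (zetaRadicand_strictMonoOn hN hp ha hb hab)
  rw [zeta_eq, zeta_eq]
  gcongr

/-- At `α = 0` the threshold is `1`; as `ζ` increases, `ζ(α) > 1` for `α > 0`. -/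
lemma zeta_zero (hp : 1 < p) : zeta N p 0 = 1 := by
  have h : zetaRadicand N p 0 = (N * p) ^ 2 := by unfold zetaRadicand; ring
  rw [zeta_eq, h, Real.sqrt_sq (by positivity)]
  field_simp
  ring

lemma one_lt_zeta (hN : 2 ≤ N) (hp : 1 < p) (hα : 0 < α) : 1 < zeta N p α := by
  rw [← zeta_zero (N := N) hp]
  exact zeta_strictMonoOn hN hp Set.self_mem_Ici hα.le hα

/-- `ζ(α)` is the degree whose spherical eigenvalue is the critical one. -/
lemma zeta_mul_eq (hN : 2 ≤ N) (hp : 1 < p) (hα : 0 ≤ α) :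
    zeta N p α * (zeta N p α + N - 2) = criticalEigenvalue N p α := by
  have h := Real.sq_sqrt (zetaRadicand_nonneg (N := N) hN hp hα)
  rw [zeta_eq]
  set S := √(zetaRadicand N p α)
  unfold zetaRadicand at h
  unfold criticalEigenvalue
  field_simp
  linear_combination h

lemma sphereEigenvalue_lt_criticalEigenvalue_iff (hN : 2 ≤ N) (hp : 1 < p) (hα : 0 < α) (k : ℕ) :
    sphereEigenvalue N k < criticalEigenvalue N p α ↔ (k : ℝ) < zeta N p α := by
  have h2 : (2 : ℝ) ≤ N := by exact_mod_cast hN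
  have h1 := one_lt_zeta hN hp hα
  have hk : (0 : ℝ) ≤ k := Nat.cast_nonneg k
  rw [← zeta_mul_eq hN hp hα.le, ← sub_pos, sphereEigenvalue,
    show zeta N p α * (zeta N p α + N - 2) - k * (k + N - 2) =
      (zeta N p α - k) * (zeta N p α + k + N - 2) by ring,
    mul_pos_iff_of_pos_right (by linarith), sub_pos]

theorem morseIndex_eq_sum (hN : 2 ≤ N) (hp : 1 < p) (hpN : p < N) (hα : 0 < α) :
    morseIndex N p α = ((∑ k ∈ Finset.range ⌈zeta N p α⌉₊,
      Module.finrank ℝ (harmonicPolynomials N k) : ℕ) : ℕ∞) := by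
  have h1 := one_lt_zeta (N := N) hN hp hα
  obtain ⟨k, hk⟩ : ∃ k, ⌈zeta N p α⌉₊ = k + 1 :=
    Nat.exists_eq_succ_of_ne_zero (Nat.ceil_pos.2 (by linarith)).ne'
  rw [hk]
  refine morseIndex_eq hN hp hpN hα ?_ ?_
  · rw [sphereEigenvalue_lt_criticalEigenvalue_iff hN hp hα, ← Nat.lt_ceil, hk]
    exact Nat.lt_succ_self k
  · rw [← not_lt, sphereEigenvalue_lt_criticalEigenvalue_iff hN hp hα, not_lt, ← Nat.ceil_le, hk]

lemma alphaCrit_pos (hN : 2 ≤ N) (hp : 1 < p) {k : ℕ} (hk : 2 ≤ k) : 0 < alphaCrit N p k := by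
  have h2 : (2 : ℝ) ≤ N := by exact_mod_cast hN
  have hk2 : (2 : ℝ) ≤ k := by exact_mod_cast hk
  have h3 : 0 < (N : ℝ) + p - 2 := by linarith
  have h4 : 0 < 4 * ((k : ℝ) - 1) * (p - 1) * (k + N - 1) :=
    mul_pos (mul_pos (by linarith) (by linarith)) (by linarith)
  have h5 : (N : ℝ) + p - 2 <
      √(((N : ℝ) + p - 2) ^ 2 + 4 * ((k : ℝ) - 1) * (p - 1) * (k + N - 1)) :=
    Real.lt_sqrt_of_sq_lt (by linarith)
  unfold alphaCrit
  refine div_pos ?_ (by linarith)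
  nlinarith

lemma zeta_alphaCrit (hN : 2 ≤ N) (hp : 1 < p) {k : ℕ} (hk : 2 ≤ k) :
    zeta N p (alphaCrit N p k) = k := by
  have h2 : (2 : ℝ) ≤ N := by exact_mod_cast hN
  have hk2 : (2 : ℝ) ≤ k := by exact_mod_cast hk
  have hp1 : p - 1 ≠ 0 := by linarith
  have h4 : 0 < 4 * ((k : ℝ) - 1) * (p - 1) * (k + N - 1) :=
    mul_pos (mul_pos (by linarith) (by linarith)) (by linarith)
  have h := Real.sq_sqrt (show 0 ≤ ((N : ℝ) + p - 2) ^ 2 +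
    4 * ((k : ℝ) - 1) * (p - 1) * (k + N - 1) by positivity)
  have e : zetaRadicand N p (alphaCrit N p k) = (p * (2 * k + N - 2)) ^ 2 := by
    unfold zetaRadicand alphaCrit
    set S := √(((N : ℝ) + p - 2) ^ 2 + 4 * ((k : ℝ) - 1) * (p - 1) * (k + N - 1))
    field_simp
    linear_combination 4 * h
  rw [zeta_eq, e, Real.sqrt_sq (mul_nonneg (by linarith) (by linarith))]
  field_simp
  ring

lemma sum_finrank_lt (hN : 2 ≤ N) {m n : ℕ} (h : m < n) :
    ∑ k ∈ Finset.range m, Module.finrank ℝ (harmonicPolynomials N k) <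
      ∑ k ∈ Finset.range n, Module.finrank ℝ (harmonicPolynomials N k) := by
  refine Finset.sum_lt_sum_of_subset (i := m) (Finset.range_mono h.le) (Finset.mem_range.2 h)
    (by simp) (finrank_harmonicPolynomials_pos hN m) fun _ _ _ => Nat.zero_le _

lemma le_sum_finrank (hN : 2 ≤ N) (n : ℕ) :
    n ≤ ∑ k ∈ Finset.range n, Module.finrank ℝ (harmonicPolynomials N k) := by
  have h := Finset.card_nsmul_le_sum (Finset.range n)
    (fun k => Module.finrank ℝ (harmonicPolynomials N k)) 1
    fun k _ => finrank_harmonicPolynomials_pos hN k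
  simpa using h

theorem morseIndex_lt (hN : 2 ≤ N) (hp : 1 < p) (hpN : p < N) {k : ℕ} (hk : 2 ≤ k) {β : ℝ}
    (hα : 0 < α) (h1 : α < alphaCrit N p k) (h2 : alphaCrit N p k < β) :
    morseIndex N p α < morseIndex N p β := by
  have h0 := alphaCrit_pos hN hp hk
  have hβ := h0.trans h2
  rw [morseIndex_eq_sum hN hp hpN hα, morseIndex_eq_sum hN hp hpN hβ, Nat.cast_lt]
  refine sum_finrank_lt hN (lt_of_le_of_lt (b := k) ?_ ?_)
  · rw [Nat.ceil_le, ← zeta_alphaCrit hN hp hk]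
    exact (zeta_strictMonoOn hN hp hα.le h0.le h1).le
  · rw [Nat.lt_ceil, ← zeta_alphaCrit hN hp hk]
    exact zeta_strictMonoOn hN hp h0.le hβ.le h2

lemma tendsto_zeta (hN : 2 ≤ N) (hp : 1 < p) : Tendsto (zeta N p) atTop atTop := by
  have h2 : (2 : ℝ) ≤ N := by exact_mod_cast hN
  have hlow : Tendsto (fun α : ℝ => 4 * p * ((N : ℝ) + p - 2) * α) atTop atTop :=
    tendsto_id.const_mul_atTop (by nlinarith)
  have hrad : Tendsto (zetaRadicand N p) atTop atTop := by
    refine tendsto_atTop_mono (fun α => ?_) hlow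
    have : 0 ≤ p - 1 := by linarith
    have : 0 ≤ 4 * (p - 1) * α ^ 2 + (N : ℝ) ^ 2 * p ^ 2 := by positivity
    unfold zetaRadicand
    linarith
  exact (tendsto_atTop_add_const_left _ _ (Real.tendsto_sqrt_atTop.comp hrad)).atTop_div_const
    (by linarith)

theorem tendsto_morseIndex (hN : 2 ≤ N) (hp : 1 < p) (hpN : p < N) :
    Tendsto (fun α : ℝ => morseIndex N p α) atTop (𝓝 ⊤) := by
  have h1 : Tendsto (fun α => ⌈zeta N p α⌉₊) atTop atTop :=
    tendsto_nat_ceil_atTop.comp (tendsto_zeta hN hp)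
  rw [ENat.tendsto_nhds_top_iff_natCast_lt]
  intro n
  filter_upwards [h1.eventually_gt_atTop n, eventually_gt_atTop 0] with α hn hα
  rw [morseIndex_eq_sum hN hp hpN hα, Nat.cast_lt]
  exact hn.trans_le (le_sum_finrank hN _)

end Threshold

end Henon

end

theorem corollary1p4 (N : ℕ) (p : ℝ) (hN : 2 ≤ N) (hp : 1 < p) (hpN : p < N) :
    -- the Morse index is the sum of `dim Φ_k(ℝ^N)` over the integers `0 ≤ k < ζ(α)`
    -- (for a natural number `k`, `k < ⌈ζ⌉₊` means exactly `k < ζ`)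
    (∀ α : ℝ, 0 < α →
      Henon.morseIndex N p α =
        ((∑ k ∈ Finset.range ⌈Henon.zeta N p α⌉₊,
            Module.finrank ℝ (Henon.harmonicPolynomials N k) : ℕ) : ℕ∞)) ∧
    -- the explicit value of these dimensions
    Module.finrank ℝ (Henon.harmonicPolynomials N 0) = 1 ∧
    (∀ k : ℕ, ¬ (N = 2 ∧ k = 0) →
      (Module.finrank ℝ (Henon.harmonicPolynomials N k) : ℝ) =
        ((N : ℝ) + 2 * k - 2) * ((N + k - 3)! : ℝ) / (((N - 2)! : ℝ) * (k ! : ℝ))) ∧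
    -- the Morse index changes as `α` crosses `α(k)`, `k ≥ 2`
    (∀ k : ℕ, 2 ≤ k →
      0 < Henon.alphaCrit N p k ∧
      ∀ α β : ℝ, 0 < α → α < Henon.alphaCrit N p k → Henon.alphaCrit N p k < β →
        Henon.morseIndex N p α < Henon.morseIndex N p β) ∧
    -- the Morse index tends to infinity
    Tendsto (fun α : ℝ => Henon.morseIndex N p α) atTop (𝓝 ⊤) := by
  exact ⟨fun _ hα => Henon.morseIndex_eq_sum hN hp hpN hα, Henon.finrank_harmonicPolynomials_zero,
    fun k hk => Henon.finrank_harmonicPolynomials hN k hk,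
    fun k hk => ⟨Henon.alphaCrit_pos hN hp hk, fun _ _ hα h1 h2 =>
      Henon.morseIndex_lt hN hp hpN hk hα h1 h2⟩, Henon.tendsto_morseIndex hN hp hpN⟩
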